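/- Setting. Let $\mathcal S,\mathcal A$ be finite nonempty sets, $\mathcal P(\cdot|s,a)$ a transition kernel on $\mathcal S$, $c:\mathcal S\times\mathcal A\to\mathbb R$ a cost with $|c|\le\bar c$, and $\gamma\in(0,1)$. For each $s$ let $p\mapsto h^p(s)$ be an extended-valued closed convex function on the probability simplex $\Delta_{|\mathcal A|}$ with $|h^p(s)|\le\bar h$ on its domain; a policy $\pi$ is feasible if $h^{\pi}(s):=h^{\pi(\cdot|s)}(s)<\infty$ for all $s$. Let $D_{p}^{q}(s)=\sum_a q(a|s)\log\frac{q(a|s)}{p(a|s)}$, and let $\mu>0$ be such that $h^{q}(s)-h^{p}(s)-\langle (h')^{p}(s,\cdot),q(\cdot|s)-p(\cdot|s)\rangle\ge\mu D_{p}^{q}(s)$ for all $q$ and all strictly positive $p$ in the domain and all subgradients $(h')^p(s,\cdot)$ of $h(s)$ at $p$. Let $V^\pi(s)$, $Q^\pi(s,a)$ be the expected discounted sums $\mathbb E[\sum_{t\ge 0}\gamma^t(c(s_t,a_t)+h^\pi(s_t))]$ given $s_0=s$, resp. $(s_0,a_0)=(s,a)$, under $\pi$. Let $\pi^*$ be a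 feasible policy minimizing $V^\pi(s)$ over feasible $\pi$ for all $s$ simultaneously, $\nu^*$ a stationary distribution of the state chain under $\pi^*$, $f(\pi)=\mathbb E_{s\sim\nu^*}[V^\pi(s)]$, $\mathcal D(\pi,\pi^*)=\mathbb E_{s\sim\nu^*}[D_\pi^{\pi^*}(s)]$. Let $\Pi$ be a set of feasible policies such that, for some $\underline\pi>0$, $\pi(a|s)\ge\underline\pi$ for all $\pi\in\Pi$ and all $(s,a)$, and such that the state chain of each $\pi\in\Pi$ is ergodic (its transition matrix has a power with positive entries only), with stationary distribution $\nu(\pi)$. Put $M^\pi=\mathrm{Diag}(\nu(\pi))\otimes\mathrm{Diag}(\pi)$, $T^\pi\theta(s,a)=c(s,a)+h^\pi(s)+\gamma\sum_{s'}\mathcal P(s'|s,a)\sum_{a'}\pi(a'|s')\theta(s',a')$, $F^\pi(\theta)=M^\pi(\theta-T^\pi\theta)$ and, for a transition $\zeta=(s,a,s',a')$, $\tilde F^\pi(\theta,\zeta)=(\theta(s,a)-c(s,a)-h^\pi(s)-\gamma\theta(s',a'))\,e(s,a)$, where $e(s,a)$ is the unit vector. Call $(\Lambda_{\min},\Lambda_{\max},C,\rho,B)$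 valid for $\Pi$ if $C>0$, $\rho\in(0,1)$ and, for all $\pi\in\Pi$: $0<\Lambda_{\min}\le(1-\gamma)\lambda_{\min}(M^\pi)$, $(1-\gamma)\lambda_{\max}(M^\pi)\le\Lambda_{\max}$, $\|Q^\pi\|_2\le B$, and $$\|F^\pi(\theta)-\mathbb E[\tilde F^\pi(\theta,\zeta^\alpha)\mid z_0]\|_2\le C\rho^\alpha\|\theta-Q^\pi\|_2$$ for all $\theta$, all integers $\alpha\ge1$ and all pairs $z_0\in\mathcal S\times\mathcal A$, where $\zeta^1,\dots,\zeta^\alpha$ are the first $\alpha$ transitions of the chain of state-action pairs started at $z_0$ under $\pi$. Given valid constants let $n=|\mathcal S||\mathcal A|$, $l=\lceil\log_\gamma\frac14\rceil$, $\bar\theta=\sqrt n\,\frac{\bar c+\bar h}{1-\gamma}$, $t_0=8\max\{\Lambda_{\max}^2,8(1+\gamma)^2\}/\Lambda_{\min}^2$, $R^2=8B^2+\frac{3[B^2+2(\bar c+\bar h)^2]}{4(1+\gamma)^2}$, $\sigma_F^2=4(1+\gamma)^2R^2+B^2+2(\bar c+\bar h)^2$, and let $$T_k=t_0(3\bar\theta2^{\lfloor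 k/l\rfloor+2})^{2/3}+(4t_0^2\bar\theta^22^{\lfloor k/l\rfloor+2})^{1/2}+24\sigma_F^2\Lambda_{\min}^{-2}2^{\lfloor k/l\rfloor+2},$$ $$\alpha_k=\max\Big\{2(\lfloor\tfrac kl\rfloor+2)\log_\rho\tfrac12+\log_\rho\tfrac{\Lambda_{\min}}{24CR^2},\ (\lfloor\tfrac kl\rfloor+2)\log_\rho\tfrac12+\log_\rho\tfrac{\Lambda_{\min}}{3CR^2},\ \log_\rho\tfrac{\Lambda_{\min}}{9C}\Big\},$$ where $T_k$ is rounded up to an integer and $\alpha_k$ is rounded up to an integer $\ge1$. Algorithm. Along one trajectory of state-action pairs (with arbitrary initial law), starting from the uniform policy $\pi_0$, iteration $k$ of SPMD runs $T_k$ steps of conditional temporal difference under the policy $\pi_k$: start at $\theta_1=0$; at step $t$ observe the next $\alpha_k$ transitions $\zeta_t^1,\dots,\zeta_t^{\alpha_k}$ of the trajectory and set $\theta_{t+1}=\theta_t-\beta_t\tilde F^{\pi_k}(\theta_t,\zeta_t^{\alpha_k})$ with $\beta_t=\frac{2}{\Lambda_{\min}(t+t_0-1)}$. With $\mathcal Q_k=\theta_{T_k+1}$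 and $\eta=\frac{1-\gamma}{\gamma\mu}$ it then sets $\pi_{k+1}(\cdot|s)=\operatorname{argmin}_{p}\{\eta[\langle\mathcal Q_k(s,\cdot),p\rangle+h^p(s)]+D_{\pi_k}^p(s)\}$ for all $s$, over the domain of $h(s)$. Assume that almost surely all iterates $\pi_k$ belong to $\Pi$. Claim. Valid constants for $\Pi$ exist, and for every choice of them the following holds. Let $$\Delta:=f(\pi_0)-f(\pi^*)+\tfrac1{1-\gamma}\big(\mu\log|\mathcal A|+\tfrac52+\tfrac5{8\gamma\mu}\big).$$ (1) For all $k\ge0$, $\ \mathbb E\big[f(\pi_k)-f(\pi^*)+\frac{\mu}{1-\gamma}\mathcal D(\pi_k,\pi^*)\big]\le2^{-\lfloor k/l\rfloor}\Delta$, the quantity on the left being integrable. (2) There are iteration numbers $\bar k(\varepsilon)$, $\varepsilon>0$, common to all such trajectories, with $\mathbb E[f(\pi_{\bar k(\varepsilon)})-f(\pi^*)+\frac\mu{1-\gamma}\mathcal D(\pi_{\bar k(\varepsilon)},\pi^*)]\le\varepsilon$, such that for all sufficiently small $\varepsilon>0$ $$\bar k(\varepsilon)\le K\log_\gamma\varepsilon,$$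 and the total number $N(\varepsilon)=\sum_{k<\bar k(\varepsilon)}T_k\alpha_k$ of samples satisfies $$N(\varepsilon)\le K\,(\log_\gamma\tfrac12)\Big(\log_2\tfrac1\varepsilon\,\log_\rho\tfrac12+\log_\rho\tfrac{\Lambda_{\min}}{CR^2}\Big)\Big(\tfrac{t_0\bar\theta^{2/3}}{(\mu(1-\gamma)\varepsilon)^{2/3}}+\tfrac{t_0\bar\theta}{\sqrt{\mu(1-\gamma)\varepsilon}}+\tfrac{\sigma_F^2}{\mu(1-\gamma)\Lambda_{\min}^2\varepsilon}\Big),$$ and, if $CR^2\ge2\Lambda_{\min}$, also $$N(\varepsilon)\le K\,(\log_\gamma\tfrac12)(\log_2\tfrac1\varepsilon)\Big(\log_\rho\tfrac{\Lambda_{\min}}{CR^2}\Big)\Big(\tfrac{t_0\bar\theta^{2/3}}{(\mu(1-\gamma)\varepsilon)^{2/3}}+\tfrac{t_0\bar\theta}{\sqrt{\mu(1-\gamma)\varepsilon}}+\tfrac{\sigma_F^2}{\mu(1-\gamma)\Lambda_{\min}^2\varepsilon}\Big).$$ Here the constant $K>0$ depends only on an upper bound $\kappa$ of the number $\mu(1-\gamma)\Delta$;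 in particular not on $\varepsilon$, nor otherwise on the problem, the trajectory or the valid constants. -/

import Mathlib

open MeasureTheory ProbabilityTheory

universe u v w

/-- A finite discounted Markov decision process with a convex policy regularizer.
`P s a s'` is the transition probability to `s'` from `s` under the action `a`, and `c` is the cost.
The extended-valued regularizer `h^π(s)`, a function of `π(·|s)`, is given by its effective domain
`dom s`, a subset of the probability simplex, and by its (finite) values `h s` on that domain. -/
structure RegMDP (S A : Type*) [Fintype S] [Fintype A] where
  P : S → A → S → ℝ
  c : S → A → ℝ
  γ : ℝ
  dom : S → Set (A → ℝ)
  h : S → (A → ℝ) → ℝ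
  P_nonneg : ∀ s a s', 0 ≤ P s a s'
  P_sum : ∀ s a, ∑ s', P s a s' = 1
  γ_pos : 0 < γ
  γ_lt_one : γ < 1
  dom_subset : ∀ s, dom s ⊆ stdSimplex ℝ A
  h_convex : ∀ s, ConvexOn ℝ (dom s) (h s)
  h_closed : ∀ s, IsClosed {z : (A → ℝ) × ℝ | z.1 ∈ dom s ∧ h s z.1 ≤ z.2}

/-- A policy, `π s a` being the probability of the action `a` at the state `s`. -/
abbrev Policy (S A : Type*) := S → A → ℝ

/-- The Kullback-Leibler divergence `KL(p ‖ q)`, used for strictly positive `q`. -/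
noncomputable def klDist {A : Type*} [Fintype A] (p q : A → ℝ) : ℝ :=
  ∑ a, p a * Real.log (p a / q a)

/-- The Euclidean norm. -/
noncomputable def norm2 {ι : Type*} [Fintype ι] (x : ι → ℝ) : ℝ :=
  Real.sqrt (∑ i, x i ^ 2)

/-- The uniform policy. -/
noncomputable def uniformPolicy (S A : Type*) [Fintype A] : Policy S A :=
  fun _ _ => 1 / (Fintype.card A : ℝ)

/-- The smallest eigenvalue of a real matrix with real spectrum. -/
noncomputable def minEig {ι : Type*} [Fintype ι] [DecidableEq ι] (M : Matrix ι ι ℝ) : ℝ :=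
  sInf (spectrum ℝ M)

/-- The largest eigenvalue of a real matrix with real spectrum. -/
noncomputable def maxEig {ι : Type*} [Fintype ι] [DecidableEq ι] (M : Matrix ι ι ℝ) : ℝ :=
  sSup (spectrum ℝ M)

namespace RegMDP

variable {S A : Type*} [Fintype S] [Fintype A] [DecidableEq S] [DecidableEq A]

/-- Feasible policies: those with `h^π(s) < ∞` (in particular `π(·|s)` in the simplex). -/
def Feasible (M : RegMDP S A) (π : Policy S A) : Prop := ∀ s, π s ∈ M.dom s

/-- `g` is a subgradient at `p` of the extended-valued convex function `h(s)`. -/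
def IsSubgradient (M : RegMDP S A) (s : S) (p g : A → ℝ) : Prop :=
  ∀ q ∈ M.dom s, M.h s p + ∑ a, g a * (q a - p a) ≤ M.h s q

/-- The regularizer has strong convexity modulus `μ` relative to the Kullback-Leibler divergence:
`h^q(s) - [h^p(s) + ⟨h'^p(s, ·), q - p⟩] ≥ μ KL(q ‖ p)` for all subgradients `h'^p(s, ·)`. -/
def StronglyConvex (M : RegMDP S A) (μ : ℝ) : Prop :=
  ∀ s, ∀ p ∈ M.dom s, (∀ a, 0 < p a) → ∀ g, M.IsSubgradient s p g → ∀ q ∈ M.dom s,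
    μ * klDist q p ≤ M.h s q - (M.h s p + ∑ a, g a * (q a - p a))

/-- The transition matrix `P^π` of the states under the policy `π`. -/
def stateMat (M : RegMDP S A) (π : Policy S A) : Matrix S S ℝ :=
  Matrix.of fun s s' => ∑ a, π s a * M.P s a s'

/-- The transition matrix of the state-action pairs under the policy `π`. -/
def pairMat (M : RegMDP S A) (π : Policy S A) : Matrix (S × A) (S × A) ℝ :=
  Matrix.of fun z z' => M.P z.1 z.2 z'.1 * π z'.1 z'.2

/-- The running cost `c(s, a) + h^π(s)` at the pair `z = (s, a)`. -/
def runCost (M : RegMDP S A) (π : Policy S A) (z : S × A) : ℝ :=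
  M.c z.1 z.2 + M.h z.1 (π z.1)

/-- The state-value function: the expected discounted cost from `s₀ = s` under `π`, the law of
`s_t` being the row `s` of the `t`-th power of `P^π`. -/
noncomputable def V (M : RegMDP S A) (π : Policy S A) (s : S) : ℝ :=
  ∑' t : ℕ, M.γ ^ t * ∑ s', (M.stateMat π ^ t) s s' * ∑ a, π s' a * M.runCost π (s', a)

/-- The action-value function: the expected discounted cost from `(s₀, a₀) = z` under `π`. -/
noncomputable def Q (M : RegMDP S A) (π : Policy S A) (z : S × A) : ℝ :=
  ∑' t : ℕ, M.γ ^ t * ∑ z', (M.pairMat π ^ t) z z' * M.runCost π z'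

/-- An optimal policy: feasible, and of minimal value at every state simultaneously. -/
def IsOptimal (M : RegMDP S A) (πs : Policy S A) : Prop :=
  M.Feasible πs ∧ ∀ π, M.Feasible π → ∀ s, M.V πs s ≤ M.V π s

/-- `ν` is a stationary distribution of the state chain under `π`. -/
def IsStationary (M : RegMDP S A) (π : Policy S A) (ν : S → ℝ) : Prop :=
  ν ∈ stdSimplex ℝ S ∧ Matrix.vecMul ν (M.stateMat π) = ν

open Classical in
/-- The stationary distribution of the state chain under `π`; it is only used for policies whose
chain is ergodic, hence has exactly one stationary distribution. -/
noncomputable def statDist (M : RegMDP S A) (π : Policy S A) : S → ℝ :=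
  if hν : ∃ ν, M.IsStationary π ν then hν.choose else 0

/-- The objective `f(π) = E_{s ∼ ν} [V^π(s)]`. -/
noncomputable def f (M : RegMDP S A) (ν : S → ℝ) (π : Policy S A) : ℝ := ∑ s, ν s * M.V π s

/-- The distance `E_{s ∼ ν} [KL(π*(·|s) ‖ π(·|s))]`. -/
noncomputable def dist (_M : RegMDP S A) (ν : S → ℝ) (π πs : Policy S A) : ℝ :=
  ∑ s, ν s * klDist (πs s) (π s)

/-- The optimality gap `f(π) - f(π*) + μ / (1 - γ) * D(π, π*)`. -/
noncomputable def gap (M : RegMDP S A) (μ : ℝ) (ν : S → ℝ) (πs π : Policy S A) : ℝ :=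
  M.f ν π - M.f ν πs + μ / (1 - M.γ) * M.dist ν π πs

/-- The constant
`f(π₀) - f(π*) + (μ log |A| + 5 / 2 + 5 / (8 γ μ)) / (1 - γ)` with `π₀` uniform. -/
noncomputable def gapConst (M : RegMDP S A) (μ : ℝ) (ν : S → ℝ) (πs : Policy S A) : ℝ :=
  M.f ν (uniformPolicy S A) - M.f ν πs +
    1 / (1 - M.γ) * (μ * Real.log (Fintype.card A) + 5 / 2 + 5 / (8 * M.γ * μ))

/-- The weighting matrix `M^π = Diag(ν(π)) ⊗ Diag(π)`. -/
noncomputable def weight (M : RegMDP S A) (π : Policy S A) : Matrix (S × A) (S × A) ℝ :=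
  Matrix.diagonal fun z => M.statDist π z.1 * π z.1 z.2

/-- The Bellman operator `T^π`. -/
def bellman (M : RegMDP S A) (π : Policy S A) (θ : S × A → ℝ) : S × A → ℝ :=
  fun z => M.runCost π z + M.γ * ∑ s', M.P z.1 z.2 s' * ∑ a', π s' a' * θ (s', a')

/-- The operator `F^π(θ) = M^π (θ - T^π θ)`. -/
noncomputable def opF (M : RegMDP S A) (π : Policy S A) (θ : S × A → ℝ) : S × A → ℝ :=
  Matrix.mulVec (M.weight π) (θ - M.bellman π θ)

/-- The stochastic operator `F̃^π(θ, ζ)` at the transition `ζ = (z, z')`. -/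
def opFtilde (M : RegMDP S A) (π : Policy S A) (θ : S × A → ℝ) (z z' : S × A) : S × A → ℝ :=
  Pi.single z (θ z - M.runCost π z - M.γ * θ z')

/-- The expectation of `F̃^π(θ, ζ^α)` given that the first of the `α ≥ 1` transitions
`ζ¹, …, ζ^α` of the policy `π` starts at the state-action pair `z₀`. -/
noncomputable def meanOpFtilde (M : RegMDP S A) (π : Policy S A) (θ : S × A → ℝ) (α : ℕ)
    (z₀ : S × A) : S × A → ℝ :=
  ∑ z, (M.pairMat π ^ (α - 1)) z₀ z • ∑ z', M.pairMat π z z' • M.opFtilde π θ z z'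

end RegMDP

/-- The constants which govern the conditional temporal difference method:
bounds `lamMin`, `lamMax` for the spectrum of the weighting matrices, the mixing constants
`C`, `ρ`, and a bound `B` for the Euclidean norm of the action-value functions. -/
structure CTDConst where
  lamMin : ℝ
  lamMax : ℝ
  C : ℝ
  ρ : ℝ
  B : ℝ

namespace RegMDP

variable {S A : Type*} [Fintype S] [Fintype A] [DecidableEq S] [DecidableEq A]

/-- The constants are valid, uniformly for all policies of the class `Pol`. -/
structure ValidConst (M : RegMDP S A) (Pol : Set (Policy S A)) (k : CTDConst) : Prop where
  lamMin_pos : 0 < k.lamMin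
  lamMin_le : ∀ π ∈ Pol, k.lamMin ≤ (1 - M.γ) * minEig (M.weight π)
  le_lamMax : ∀ π ∈ Pol, (1 - M.γ) * maxEig (M.weight π) ≤ k.lamMax
  C_pos : 0 < k.C
  ρ_pos : 0 < k.ρ
  ρ_lt_one : k.ρ < 1
  mixing : ∀ π ∈ Pol, ∀ (θ : S × A → ℝ) (z₀ : S × A) (α : ℕ), 1 ≤ α →
    norm2 (M.opF π θ - M.meanOpFtilde π θ α z₀) ≤ k.C * k.ρ ^ α * norm2 (θ - M.Q π)
  norm_le : ∀ π ∈ Pol, norm2 (M.Q π) ≤ k.B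

section parameters

variable (M : RegMDP S A) (cbar hbar : ℝ) (k : CTDConst)

/-- The epoch length `l = ⌈log_γ (1 / 4)⌉`. -/
noncomputable def epochLen : ℕ := ⌈Real.logb M.γ (1 / 4)⌉₊

/-- `θ̄ = √n (c̄ + h̄) / (1 - γ)` with `n = |S| |A|`. -/
noncomputable def thetaBar : ℝ :=
  Real.sqrt ((Fintype.card S : ℝ) * Fintype.card A) * ((cbar + hbar) / (1 - M.γ))

/-- `t₀ = 8 max {Λ_max², 8 (1 + γ)²} / Λ_min²`. -/
noncomputable def tZero : ℝ :=
  8 * max (k.lamMax ^ 2) (8 * (1 + M.γ) ^ 2) / k.lamMin ^ 2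

/-- `R²`, for the initial point `θ₁ = 0` and with `‖θ*‖₂` bounded by `B`. -/
noncomputable def Rsq : ℝ :=
  8 * k.B ^ 2 + 3 * (k.B ^ 2 + 2 * (cbar + hbar) ^ 2) / (4 * (1 + M.γ) ^ 2)

/-- `σ_F²`, with `‖θ*‖₂` bounded by `B`. -/
noncomputable def sigmaFsq : ℝ :=
  4 * (1 + M.γ) ^ 2 * M.Rsq cbar hbar k + k.B ^ 2 + 2 * (cbar + hbar) ^ 2

/-- The number `T_j` of temporal difference steps in the iteration `j`, rounded up. -/
noncomputable def numSteps (j : ℕ) : ℕ :=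
  ⌈M.tZero k * (3 * M.thetaBar cbar hbar * 2 ^ (j / M.epochLen + 2)) ^ (2 / 3 : ℝ)
    + Real.sqrt (4 * M.tZero k ^ 2 * M.thetaBar cbar hbar ^ 2 * 2 ^ (j / M.epochLen + 2))
    + 24 * M.sigmaFsq cbar hbar k / k.lamMin ^ 2 * 2 ^ (j / M.epochLen + 2)⌉₊

/-- The skipping parameter `α_j`, rounded up to a positive integer. The third term of the maximum
is the requirement `C ρ^α ≤ Λ_min / 9` on every skipping parameter of the method. -/
noncomputable def skip (j : ℕ) : ℕ :=
  max 1 ⌈max (max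
    (2 * ((j / M.epochLen : ℕ) + 2 : ℝ) * Real.logb k.ρ (1 / 2)
      + Real.logb k.ρ (k.lamMin / (24 * k.C * M.Rsq cbar hbar k)))
    (((j / M.epochLen : ℕ) + 2 : ℝ) * Real.logb k.ρ (1 / 2)
      + Real.logb k.ρ (k.lamMin / (3 * k.C * M.Rsq cbar hbar k))))
    (Real.logb k.ρ (k.lamMin / (9 * k.C)))⌉₊

/-- The step size `β_t = 2 / (Λ_min (t + t₀ - 1))`. -/
noncomputable def stepSize (t : ℕ) : ℝ := 2 / (k.lamMin * (t + M.tZero k - 1))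

/-- The number of samples used in the first `j` iterations. -/
noncomputable def numSamples (j : ℕ) : ℕ :=
  ∑ i ∈ Finset.range j, M.numSteps cbar hbar k i * M.skip cbar hbar k i

end parameters

/-- Conditional temporal difference for evaluating `π` along the trajectory `Z`, starting at time
`n₀`, with `α` transitions per step and step sizes `β`: `ctd … t` is the iterate `θ_{t+1}`, where
`θ₁ = 0` and the step `t` uses the last transition of the `t`-th block of `α` transitions. -/
noncomputable def ctd (M : RegMDP S A) (π : Policy S A) (α : ℕ) (β : ℕ → ℝ) (Z : ℕ → S × A)
    (n₀ : ℕ) : ℕ → S × A → ℝ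
  | 0 => 0
  | t + 1 => M.ctd π α β Z n₀ t - β (t + 1) • M.opFtilde π (M.ctd π α β Z n₀ t)
      (Z (n₀ + (t + 1) * α - 1)) (Z (n₀ + (t + 1) * α))

/-- `π₊` is the result of the prox-mapping at `π` with step size `η` and estimate `G`. -/
def IsProx (M : RegMDP S A) (η : ℝ) (G : S × A → ℝ) (π πp : Policy S A) : Prop :=
  ∀ s, πp s ∈ M.dom s ∧
    IsMinOn (fun p => η * (∑ a, G (s, a) * p a + M.h s p) + klDist p (π s)) (M.dom s) (πp s)

/-- The σ-algebra generated by the trajectory `Z` up to time `n`. -/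
abbrev history {Ω : Type*} (Z : ℕ → Ω → S × A) (n : ℕ) : MeasurableSpace Ω :=
  ⨆ i ∈ Finset.range (n + 1), MeasurableSpace.comap (Z i) ⊤

/-- A run of stochastic policy mirror descent with step size `η = (1 - γ) / (γ μ)` and conditional
temporal difference evaluation along one trajectory `Z` of state-action pairs (with arbitrary
initial law). The iteration `j` uses the transitions number
`numSamples j, …, numSamples (j + 1) - 1` of the trajectory, which follow the policy `π j`. -/
structure IsRun (M : RegMDP S A) (μ cbar hbar : ℝ) (k : CTDConst) {Ω : Type*}
    [MeasurableSpace Ω] (Pr : Measure Ω) (Z : ℕ → Ω → S × A) (π : ℕ → Ω → Policy S A) :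
    Prop where
  meas : ∀ n, @Measurable Ω (S × A) _ ⊤ (Z n)
  init : ∀ ω, π 0 ω = uniformPolicy S A
  step : ∀ᵐ ω ∂Pr, ∀ j, M.IsProx ((1 - M.γ) / (M.γ * μ))
    (M.ctd (π j ω) (M.skip cbar hbar k j) (M.stepSize k) (fun n => Z n ω)
      (M.numSamples cbar hbar k j) (M.numSteps cbar hbar k j)) (π j ω) (π (j + 1) ω)
  markov : ∀ j n, M.numSamples cbar hbar k j ≤ n → n < M.numSamples cbar hbar k (j + 1) →
    ∀ z' : S × A, Pr⟦Z (n + 1) ⁻¹' {z'} | history Z n⟧ =ᵐ[Pr]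
      fun ω => M.P (Z n ω).1 (Z n ω).2 z'.1 * π j ω z'.1 z'.2

/-- `t₀ θ̄^{2/3} / (μ (1-γ) ε)^{2/3} + t₀ θ̄ / √(μ (1-γ) ε) + σ_F² / (μ (1-γ) Λ_min² ε)`. -/
noncomputable def sampleRate (M : RegMDP S A) (μ cbar hbar : ℝ) (k : CTDConst) (ε : ℝ) : ℝ :=
  M.tZero k * M.thetaBar cbar hbar ^ (2 / 3 : ℝ) / (μ * (1 - M.γ) * ε) ^ (2 / 3 : ℝ)
    + M.tZero k * M.thetaBar cbar hbar / Real.sqrt (μ * (1 - M.γ) * ε)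
    + M.sigmaFsq cbar hbar k / (μ * (1 - M.γ) * k.lamMin ^ 2 * ε)

end RegMDP

/-! One mirror descent step with an inexact estimate `G` of `Q^π`, with error `δ = G - Q^π`,
satisfies `gap (π₊) ≤ γ gap (π) + ‖δ‖² / (γ μ) + ⟨δ, ν (π* - π)⟩` (`gap_prox_le`). This combines the
three-point inequality of the prox-mapping with the performance difference identity. The step size
is chosen so that `1 + η μ = 1 / γ`, which makes the value gap and the divergence contract by the
same factor `γ`. In expectation the step therefore needs only the mean square of `δ` and its bias in
a direction fixed by the past.

Both are controlled for conditional temporal difference. The mean square obeys `a (t+1) ≤ (1 - 3/τ)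
a t + D/τ²` with `τ = t + t₀`, hence decays like `1/t`. The bias is estimated by duality: pairing
the error after a step with a vector `V` amounts to pairing the error before it with `V - β F* V`,
where `F*` is the adjoint of the linear part of `F^π`, up to a mixing error `C ρ^α`. Each dual step
contracts by `√(1 - 3/τ)`, so the initial bias decays like `t^(-3/2)`, faster than the root mean
square error. This explains the three summands of `numSteps`: the exponent 2/3 serves the bias, the
other two the mean square (`Follows.ctd_accuracy`).

With accuracies halved in each epoch the perturbed contraction gives the factor `1/2` per epoch
(`epoch_recursion_le`, `IsRun.integral_gap_le`). For the complexity, the work in successive epochs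
grows geometrically, so its sum is comparable to the last term, of order `1/ε` (`sum_rawSteps_le`).
The bound on `μ (1 - γ) Δ` forces `γ` away from zero, which makes the rounding in the epoch length
harmless (`epochLen_le`, `complexity_le`).

The random policies are not assumed measurable. Strong convexity makes the prox-mapping
single-valued, so almost surely they are functions of finitely many coordinates of the trajectory
(`IsRun.ae_eq_policyOf`), and all expectations reduce to finite-valued functions. Valid constants
exist by a minorization that is uniform over the class (`exists_validConst`). -/

set_option linter.unusedSectionVars false

/-! ### The Euclidean norm. -/

section Norm

variable {ι : Type*} [Fintype ι]

lemma norm2_nonneg (x : ι → ℝ) : 0 ≤ norm2 x := Real.sqrt_nonneg _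

lemma norm2_sq (x : ι → ℝ) : norm2 x ^ 2 = ∑ i, x i ^ 2 :=
  Real.sq_sqrt (Finset.sum_nonneg fun _ _ => sq_nonneg _)

lemma norm2_le_iff {x : ι → ℝ} {b : ℝ} (hb : 0 ≤ b) : norm2 x ≤ b ↔ ∑ i, x i ^ 2 ≤ b ^ 2 :=
  Real.sqrt_le_left hb

lemma sum_mul_le_norm2 (x y : ι → ℝ) : ∑ i, x i * y i ≤ norm2 x * norm2 y :=
  Real.sum_mul_le_sqrt_mul_sqrt _ _ _

lemma norm2_neg (x : ι → ℝ) : norm2 (-x) = norm2 x := by simp [norm2]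

lemma abs_sum_mul_le_norm2 (x y : ι → ℝ) : |∑ i, x i * y i| ≤ norm2 x * norm2 y := by
  refine abs_le.2 ⟨?_, sum_mul_le_norm2 x y⟩
  have := sum_mul_le_norm2 (-x) y
  simp only [norm2_neg, Pi.neg_apply, neg_mul, Finset.sum_neg_distrib] at this
  linarith

lemma abs_apply_le_norm2 (x : ι → ℝ) (i : ι) : |x i| ≤ norm2 x := by
  rw [← Real.sqrt_sq_eq_abs]
  exact Real.sqrt_le_sqrt (Finset.single_le_sum (f := fun i => x i ^ 2)
    (fun _ _ => sq_nonneg _) (Finset.mem_univ i))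

lemma norm2_le_of_abs_le {x : ι → ℝ} {b : ℝ} (hb : 0 ≤ b) (h : ∀ i, |x i| ≤ b) :
    norm2 x ≤ Real.sqrt (Fintype.card ι) * b := by
  rw [norm2_le_iff (by positivity), mul_pow, Real.sq_sqrt (by positivity)]
  calc ∑ i, x i ^ 2 ≤ ∑ _i : ι, b ^ 2 :=
        Finset.sum_le_sum fun i _ => sq_le_sq.2 ((h i).trans (le_abs_self b))
    _ = _ := by simp

end Norm

/-! ### Stochastic matrices and discounted sums. -/

section Stochastic

variable {ι : Type*} [Fintype ι] [DecidableEq ι] {K : Matrix ι ι ℝ}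

lemma stochastic_sum_le (hK : K ∈ Matrix.rowStochastic ℝ ι) {r : ι → ℝ} {b : ℝ}
    (hr : ∀ j, r j ≤ b) (i : ι) : ∑ j, K i j * r j ≤ b := by
  calc ∑ j, K i j * r j ≤ ∑ j, K i j * b :=
        Finset.sum_le_sum fun j _ => mul_le_mul_of_nonneg_left (hr j) (hK.1 i j)
    _ = b := by rw [← Finset.sum_mul, Matrix.sum_row_of_mem_rowStochastic hK, one_mul]

lemma abs_stochastic_sum_le (hK : K ∈ Matrix.rowStochastic ℝ ι) {r : ι → ℝ} {b : ℝ}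
    (hr : ∀ j, |r j| ≤ b) (i : ι) : |∑ j, K i j * r j| ≤ b := by
  refine abs_le.2 ⟨?_, stochastic_sum_le hK (fun j => (abs_le.1 (hr j)).2) i⟩
  have := stochastic_sum_le hK (r := fun j => - r j) (b := b)
    (fun j => by linarith [(abs_le.1 (hr j)).1]) i
  simp only [mul_neg, Finset.sum_neg_distrib] at this
  linarith

lemma sq_stochastic_sum_le (hK : K ∈ Matrix.rowStochastic ℝ ι) (r : ι → ℝ) (i : ι) :
    (∑ j, K i j * r j) ^ 2 ≤ ∑ j, K i j * r j ^ 2 := by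
  set m := ∑ j, K i j * r j with hm
  have h : 0 ≤ ∑ j, K i j * (r j - m) ^ 2 :=
    Finset.sum_nonneg fun j _ => mul_nonneg (hK.1 i j) (sq_nonneg _)
  have e : ∑ j, K i j * (r j - m) ^ 2
      = ∑ j, K i j * r j ^ 2 - 2 * m * ∑ j, K i j * r j + m ^ 2 * ∑ j, K i j := by
    simp only [Finset.mul_sum, ← Finset.sum_sub_distrib, ← Finset.sum_add_distrib]
    exact Finset.sum_congr rfl fun j _ => by ring
  rw [e, Matrix.sum_row_of_mem_rowStochastic hK, ← hm] at h
  nlinarith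

/-- Maximum principle: at a maximizer `m` of `u` the hypothesis gives `u m ≤ b + γ u m`. -/
lemma le_of_discounted_le [Nonempty ι] (hK : K ∈ Matrix.rowStochastic ℝ ι) {γ : ℝ} (h0 : 0 ≤ γ)
    (h1 : γ < 1) {u : ι → ℝ} {b : ℝ} (hu : ∀ i, u i ≤ b + γ * ∑ j, K i j * u j) (i : ι) :
    u i ≤ b / (1 - γ) := by
  obtain ⟨m, hm⟩ := Finite.exists_max u
  have h := hu m
  have h2 := mul_le_mul_of_nonneg_left (stochastic_sum_le hK hm m) h0
  refine (hm i).trans ?_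
  rw [le_div_iff₀ (by linarith)]
  nlinarith

lemma eq_of_discounted_eq [Nonempty ι] (hK : K ∈ Matrix.rowStochastic ℝ ι) {γ : ℝ} (h0 : 0 ≤ γ)
    (h1 : γ < 1) {r u v : ι → ℝ} (hu : ∀ i, u i = r i + γ * ∑ j, K i j * u j)
    (hv : ∀ i, v i = r i + γ * ∑ j, K i j * v j) : u = v := by
  have key : ∀ a b : ι → ℝ, (∀ i, a i = r i + γ * ∑ j, K i j * a j) →
      (∀ i, b i = r i + γ * ∑ j, K i j * b j) → ∀ i, a i ≤ b i := by
    intro a b ha hb i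
    have := le_of_discounted_le hK h0 h1 (u := fun i => a i - b i) (b := 0) (fun i => by
      simp only [mul_sub, Finset.sum_sub_distrib]
      rw [ha i, hb i]
      apply le_of_eq
      have e1 : ∀ i, r i + γ * ∑ j, K i j * a j = a i := fun i => (ha i).symm
      have e2 : ∀ i, r i + γ * ∑ j, K i j * b j = b i := fun i => (hb i).symm
      simp only [e1, e2]
      linarith [ha i, hb i]) i
    simp only [zero_div] at this
    linarith
  exact funext fun i => le_antisymm (key u v hu hv i) (key v u hv hu i)

/-- The expected discounted sum of the rewards `r` along the Markov chain `K`. -/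
noncomputable def discSum (γ : ℝ) (K : Matrix ι ι ℝ) (r : ι → ℝ) (i : ι) : ℝ :=
  ∑' t : ℕ, γ ^ t * ∑ j, (K ^ t) i j * r j

lemma summable_discSum (hK : K ∈ Matrix.rowStochastic ℝ ι) {γ : ℝ} (h0 : 0 ≤ γ)
    (h1 : γ < 1) (r : ι → ℝ) (i : ι) :
    Summable fun t : ℕ => γ ^ t * ∑ j, (K ^ t) i j * r j := by
  refine Summable.of_norm_bounded (g := fun t : ℕ => γ ^ t * ∑ j, |r j|)
    ((summable_geometric_of_lt_one h0 h1).mul_right _) fun t => ?_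
  rw [Real.norm_eq_abs, abs_mul, abs_of_nonneg (pow_nonneg h0 t)]
  refine mul_le_mul_of_nonneg_left ?_ (pow_nonneg h0 t)
  exact abs_stochastic_sum_le (pow_mem hK t)
    (fun j => Finset.single_le_sum (f := fun j => |r j|) (fun _ _ => abs_nonneg _)
      (Finset.mem_univ j)) i

/-- The term `t = 0` is `r i`; every later term has one factor `γ` and one factor `K` to pull out.
-/
lemma discSum_eq (hK : K ∈ Matrix.rowStochastic ℝ ι) {γ : ℝ} (h0 : 0 ≤ γ)
    (h1 : γ < 1) (r : ι → ℝ) (i : ι) :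
    discSum γ K r i = r i + γ * ∑ j, K i j * discSum γ K r j := by
  unfold discSum
  rw [(summable_discSum hK h0 h1 r i).tsum_eq_zero_add]
  congr 1
  · simp [Matrix.one_apply]
  · have e : ∀ t : ℕ, γ ^ (t + 1) * ∑ j, (K ^ (t + 1)) i j * r j
        = ∑ l, γ * (K i l * (γ ^ t * ∑ j, (K ^ t) l j * r j)) := by
      intro t
      rw [pow_succ' K, pow_succ' γ]
      simp only [Matrix.mul_apply, Finset.sum_mul, Finset.mul_sum]
      rw [Finset.sum_comm]
      exact Finset.sum_congr rfl fun _ _ => Finset.sum_congr rfl fun _ _ => by ring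
    simp only [e]
    rw [Summable.tsum_finsetSum]
    · rw [Finset.mul_sum]
      exact Finset.sum_congr rfl fun l _ => by rw [tsum_mul_left, tsum_mul_left]
    · exact fun l _ => ((summable_discSum hK h0 h1 r l).mul_left _).mul_left _

lemma abs_discSum_le [Nonempty ι] (hK : K ∈ Matrix.rowStochastic ℝ ι) {γ : ℝ} (h0 : 0 ≤ γ)
    (h1 : γ < 1) {r : ι → ℝ} {b : ℝ} (hr : ∀ i, |r i| ≤ b) (i : ι) :
    |discSum γ K r i| ≤ b / (1 - γ) := by
  refine abs_le.2 ⟨?_, le_of_discounted_le hK h0 h1 (fun i => ?_) i⟩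
  · have := le_of_discounted_le hK h0 h1 (u := fun i => - discSum γ K r i) (b := b) (fun i => by
      simp only [mul_neg, Finset.sum_neg_distrib]
      rw [discSum_eq hK h0 h1 r i]
      linarith [(abs_le.1 (hr i)).1]) i
    linarith
  · rw [discSum_eq hK h0 h1 r i]
    linarith [(abs_le.1 (hr i)).2]

end Stochastic

/-! ### Bellman equations of the value functions. -/

namespace RegMDP

variable {S A : Type*} [Fintype S] [Fintype A] [DecidableEq S] [DecidableEq A]
  {M : RegMDP S A} {π : Policy S A}

lemma Feasible.simplex (hπ : M.Feasible π) (s : S) : π s ∈ stdSimplex ℝ A :=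
  M.dom_subset s (hπ s)

lemma stateMat_mem (hπ : ∀ s, π s ∈ stdSimplex ℝ A) :
    M.stateMat π ∈ Matrix.rowStochastic ℝ S := by
  refine Matrix.mem_rowStochastic_iff_sum.2 ⟨fun s s' =>
    Finset.sum_nonneg fun a _ => mul_nonneg ((hπ s).1 a) (M.P_nonneg _ _ _), fun s => ?_⟩
  simp only [stateMat, Matrix.of_apply]
  rw [Finset.sum_comm]
  simp only [← Finset.mul_sum, M.P_sum, mul_one]
  exact (hπ s).2

lemma pairMat_mem (hπ : ∀ s, π s ∈ stdSimplex ℝ A) :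
    M.pairMat π ∈ Matrix.rowStochastic ℝ (S × A) := by
  refine Matrix.mem_rowStochastic_iff_sum.2 ⟨fun z z' =>
    mul_nonneg (M.P_nonneg _ _ _) ((hπ _).1 _), fun z => ?_⟩
  simp only [pairMat, Matrix.of_apply, Fintype.sum_prod_type, ← Finset.mul_sum]
  simp only [(hπ _).2, mul_one, M.P_sum]

lemma sum_pairMat_mul (z : S × A) (x : S × A → ℝ) :
    ∑ z', M.pairMat π z z' * x z' = ∑ s', M.P z.1 z.2 s' * ∑ a', π s' a' * x (s', a') := by
  simp only [pairMat, Matrix.of_apply, Fintype.sum_prod_type, Finset.mul_sum, mul_assoc]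

lemma V_eq (hπ : ∀ s, π s ∈ stdSimplex ℝ A) (s : S) :
    M.V π s = ∑ a, π s a * M.runCost π (s, a) + M.γ * ∑ s', M.stateMat π s s' * M.V π s' :=
  discSum_eq (stateMat_mem hπ) M.γ_pos.le M.γ_lt_one _ s

lemma Q_eq (hπ : ∀ s, π s ∈ stdSimplex ℝ A) (z : S × A) :
    M.Q π z = M.runCost π z + M.γ * ∑ z', M.pairMat π z z' * M.Q π z' :=
  discSum_eq (pairMat_mem hπ) M.γ_pos.le M.γ_lt_one _ z

lemma sum_stateMat_mul (s : S) (x : S → ℝ) :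
    ∑ s', M.stateMat π s s' * x s' = ∑ a, π s a * ∑ s', M.P s a s' * x s' := by
  simp only [stateMat, Matrix.of_apply, Finset.sum_mul, Finset.mul_sum, mul_assoc]
  rw [Finset.sum_comm]

variable [Nonempty S] [Nonempty A]

/-- The right-hand side solves the same fixed point equation as `Q`, whose solution is unique by the
maximum principle. -/
lemma Q_eq_V (hπ : ∀ s, π s ∈ stdSimplex ℝ A) (z : S × A) :
    M.Q π z = M.runCost π z + M.γ * ∑ s', M.P z.1 z.2 s' * M.V π s' := by
  have h : M.Q π = fun z => M.runCost π z + M.γ * ∑ s', M.P z.1 z.2 s' * M.V π s' := by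
    refine eq_of_discounted_eq (pairMat_mem hπ) M.γ_pos.le M.γ_lt_one (Q_eq hπ) fun z => ?_
    rw [sum_pairMat_mul]
    congr 2
    refine Finset.sum_congr rfl fun s' _ => ?_
    congr 1
    rw [V_eq hπ s', sum_stateMat_mul, Finset.mul_sum, ← Finset.sum_add_distrib]
    exact Finset.sum_congr rfl fun a _ => by ring
  exact congrFun h z

lemma V_eq_sum_Q (hπ : ∀ s, π s ∈ stdSimplex ℝ A) (s : S) :
    M.V π s = ∑ a, π s a * M.Q π (s, a) := by
  rw [V_eq hπ s, sum_stateMat_mul, Finset.mul_sum, ← Finset.sum_add_distrib]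
  exact Finset.sum_congr rfl fun a _ => by rw [Q_eq_V hπ]; ring

lemma abs_runCost_le {cbar hbar : ℝ} (hc : ∀ s a, |M.c s a| ≤ cbar)
    (hh : ∀ s, ∀ p ∈ M.dom s, |M.h s p| ≤ hbar) (hπ : M.Feasible π) (z : S × A) :
    |M.runCost π z| ≤ cbar + hbar :=
  (abs_add_le _ _).trans (add_le_add (hc _ _) (hh _ _ (hπ _)))

lemma norm2_Q_le {cbar hbar : ℝ} (hc : ∀ s a, |M.c s a| ≤ cbar)
    (hh : ∀ s, ∀ p ∈ M.dom s, |M.h s p| ≤ hbar) (hπ : M.Feasible π) :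
    norm2 (M.Q π) ≤ M.thetaBar cbar hbar := by
  have h := fun z => abs_discSum_le (pairMat_mem (M := M) hπ.simplex) M.γ_pos.le M.γ_lt_one
    (abs_runCost_le hc hh hπ) z
  have h2 := norm2_le_of_abs_le ((abs_nonneg _).trans (h (Classical.arbitrary _))) h
  rw [Fintype.card_prod, Nat.cast_mul] at h2
  exact h2

/-- The Bellman residual is `(I - γ P^π) (θ - Q^π)`. -/
lemma sub_bellman (hπ : ∀ s, π s ∈ stdSimplex ℝ A) (θ : S × A → ℝ) (z : S × A) :
    (θ - M.bellman π θ) z =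
      (θ - M.Q π) z - M.γ * ∑ z', M.pairMat π z z' * (θ - M.Q π) z' := by
  simp only [Pi.sub_apply, mul_sub, Finset.sum_sub_distrib, bellman]
  rw [← sum_pairMat_mul]
  have e : ∀ z, M.runCost π z + M.γ * ∑ z', M.pairMat π z z' * M.Q π z' = M.Q π z :=
    fun z => (Q_eq hπ z).symm
  linarith [e z]

end RegMDP

/-! ### Inequalities for the Kullback-Leibler divergence. -/

section KL

/-- The Hellinger lower bound, from `log x ≤ x - 1` at `x = √q / √p` and `log (p / q) = -2 log x`.
-/
lemma sq_sqrt_sub_le_klTerm {p q : ℝ} (hp : 0 ≤ p) (hq : 0 < q) :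
    (√p - √q) ^ 2 ≤ p * Real.log (p / q) - p + q := by
  rcases hp.eq_or_lt with rfl | hp
  · simp [Real.sq_sqrt hq.le]
  · have hsp := Real.sqrt_pos.2 hp
    have hsq := Real.sqrt_pos.2 hq
    have h1 := Real.log_le_sub_one_of_pos (div_pos hsq hsp)
    have h2 : Real.log (p / q) = -2 * Real.log (√q / √p) := by
      rw [Real.log_div hp.ne' hq.ne', Real.log_div hsq.ne' hsp.ne', Real.log_sqrt hp.le,
        Real.log_sqrt hq.le]
      ring
    have h3 : p * (√q / √p) = √p * √q := by
      rw [mul_div_assoc', div_eq_iff hsp.ne']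
      nlinarith [Real.sq_sqrt hp.le]
    rw [h2]
    nlinarith [mul_le_mul_of_nonneg_left h1 hp.le, Real.sq_sqrt hp.le, Real.sq_sqrt hq.le]

lemma sq_sub_le_klTerm {p q : ℝ} (hp : 0 ≤ p) (hp1 : p ≤ 1) (hq : 0 < q) (hq1 : q ≤ 1) :
    (p - q) ^ 2 / 4 ≤ p * Real.log (p / q) - p + q := by
  refine le_trans ?_ (sq_sqrt_sub_le_klTerm hp hq)
  have e : (p - q) ^ 2 = (√p - √q) ^ 2 * (√p + √q) ^ 2 := by
    rw [← mul_pow]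
    congr 1
    nlinarith [Real.sq_sqrt hp, Real.sq_sqrt hq.le]
  have h : (√p + √q) ^ 2 ≤ 4 := by
    have := Real.sqrt_le_one.2 hp1
    have := Real.sqrt_le_one.2 hq1
    have := Real.sqrt_nonneg p
    have := Real.sqrt_nonneg q
    nlinarith
  rw [e]
  nlinarith [mul_le_mul_of_nonneg_left h (sq_nonneg (√p - √q))]

variable {A : Type*} [Fintype A] {p q r : A → ℝ}

lemma stdSimplex_apply_le_one (hp : p ∈ stdSimplex ℝ A) (a : A) : p a ≤ 1 := by
  rw [← hp.2]
  exact Finset.single_le_sum (fun i _ => hp.1 i) (Finset.mem_univ a)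

/-- A weak form of Pinsker's inequality. Its constant is the one for which the divergence absorbs
the quadratic term of Young's inequality in `gap_prox_le`. -/
lemma sum_sq_sub_le_klDist (hp : p ∈ stdSimplex ℝ A) (hq : q ∈ stdSimplex ℝ A)
    (hq0 : ∀ a, 0 < q a) : ∑ a, (p a - q a) ^ 2 ≤ 4 * klDist p q := by
  have h : ∑ a, (p a - q a) ^ 2 / 4 ≤ ∑ a, (p a * Real.log (p a / q a) - p a + q a) :=
    Finset.sum_le_sum fun a _ => sq_sub_le_klTerm (hp.1 a) (stdSimplex_apply_le_one hp a) (hq0 a)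
      (stdSimplex_apply_le_one hq a)
  rw [Finset.sum_add_distrib, Finset.sum_sub_distrib, hp.2, hq.2, ← Finset.sum_div] at h
  unfold klDist
  linarith

lemma klDist_nonneg (hp : p ∈ stdSimplex ℝ A) (hq : q ∈ stdSimplex ℝ A)
    (hq0 : ∀ a, 0 < q a) : 0 ≤ klDist p q := by
  have := sum_sq_sub_le_klDist hp hq hq0
  have := Finset.sum_nonneg (s := Finset.univ) fun a _ => sq_nonneg (p a - q a)
  linarith

/-- The chi-square bound. It shows that the divergence from a positive point is of second order
along a segment leaving that point. -/
lemma klDist_le_sum_sq_div (hp : p ∈ stdSimplex ℝ A) (hq : q ∈ stdSimplex ℝ A)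
    (hq0 : ∀ a, 0 < q a) : klDist p q ≤ ∑ a, (p a - q a) ^ 2 / q a := by
  have h : klDist p q ≤ ∑ a, ((p a - q a) ^ 2 / q a + (p a - q a)) := by
    refine Finset.sum_le_sum fun a _ => ?_
    have e : (p a - q a) ^ 2 / q a + (p a - q a) = p a * (p a / q a - 1) := by
      field_simp [(hq0 a).ne']
      ring
    rw [e]
    rcases (hp.1 a).eq_or_lt with h0 | h0
    · simp [← h0]
    · exact mul_le_mul_of_nonneg_left (Real.log_le_sub_one_of_pos (div_pos h0 (hq0 a))) h0.le
  rw [Finset.sum_add_distrib, Finset.sum_sub_distrib, hp.2, hq.2] at h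
  linarith

lemma klDist_eq_add (hp : ∀ a, 0 ≤ p a) (hq : ∀ a, 0 < q a) (hr : ∀ a, 0 < r a) :
    klDist p r = klDist p q + ∑ a, p a * Real.log (q a / r a) := by
  unfold klDist
  rw [← Finset.sum_add_distrib]
  refine Finset.sum_congr rfl fun a _ => ?_
  rcases (hp a).eq_or_lt with h0 | h0
  · simp [← h0]
  · rw [Real.log_div h0.ne' (hr a).ne', Real.log_div h0.ne' (hq a).ne',
      Real.log_div (hq a).ne' (hr a).ne']
    ring

/-- The Bregman three-point identity: up to a constant vector, `log (q / r)` is the gradient of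
`klDist · r` at `q`. -/
lemma klDist_sub_klDist (hp : ∀ a, 0 ≤ p a) (hq : ∀ a, 0 < q a) (hr : ∀ a, 0 < r a) :
    klDist p r - klDist q r = klDist p q + ∑ a, Real.log (q a / r a) * (p a - q a) := by
  rw [klDist_eq_add hp hq hr]
  have e : klDist q r = ∑ a, q a * Real.log (q a / r a) := rfl
  rw [e, add_sub_assoc, ← Finset.sum_sub_distrib]
  congr 1
  exact Finset.sum_congr rfl fun a _ => by ring

lemma klDist_uniform_le [Nonempty A] (hp : p ∈ stdSimplex ℝ A) :
    klDist p (fun _ => 1 / (Fintype.card A : ℝ)) ≤ Real.log (Fintype.card A) := by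
  have hn : (0 : ℝ) < Fintype.card A := by exact_mod_cast Fintype.card_pos
  calc klDist p (fun _ => 1 / (Fintype.card A : ℝ))
      ≤ ∑ a, p a * Real.log (Fintype.card A) := by
        refine Finset.sum_le_sum fun a _ => ?_
        rcases (hp.1 a).eq_or_lt with h0 | h0
        · simp [← h0]
        · refine mul_le_mul_of_nonneg_left (Real.log_le_log (by positivity) ?_) h0.le
          rw [div_div_eq_mul_div, div_one]
          nlinarith [stdSimplex_apply_le_one hp a]
    _ = _ := by rw [← Finset.sum_mul, hp.2, one_mul]

end KL

/-! ### One step of inexact policy mirror descent. -/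

namespace RegMDP

variable {S A : Type*} [Fintype S] [Fintype A] [DecidableEq S] [DecidableEq A]
  {M : RegMDP S A} {π πp πs : Policy S A} {η μ : ℝ} {G : S × A → ℝ}

/-- First-order optimality of the prox-mapping at a strictly positive minimizer. -/
lemma IsProx.optimality (h : M.IsProx η G π πp) (hη : 0 ≤ η) (s : S) (hπ : ∀ a, 0 < π s a)
    (hp : ∀ a, 0 < πp s a) {q : A → ℝ} (hq : q ∈ M.dom s) :
    0 ≤ η * (∑ a, G (s, a) * (q a - πp s a) + M.h s q - M.h s (πp s))
      + ∑ a, Real.log (πp s a / π s a) * (q a - πp s a) := by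
  obtain ⟨hd, hmin⟩ := h s
  set c := ∑ a, (q a - πp s a) ^ 2 / πp s a with hc
  set L := ∑ a, Real.log (πp s a / π s a) * (q a - πp s a) with hL
  set X := η * (∑ a, G (s, a) * (q a - πp s a) + M.h s q - M.h s (πp s)) + L with hX
  -- Compare the minimizer with the point at parameter `t` of the segment towards `q`. The
  -- divergence changes by `t L` plus at most `t² c`, convexity bounds `h`, and division by `t`
  -- leaves this inequality.
  have key : ∀ t : ℝ, 0 < t → t ≤ 1 → 0 ≤ X + t * c := by
    intro t h0 h1
    set pt : A → ℝ := (1 - t) • πp s + t • q with hpt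
    have hpt' : ∀ a, pt a = (1 - t) * πp s a + t * q a := fun a => by simp [hpt]
    have hmem : pt ∈ M.dom s :=
      (M.h_convex s).1 hd hq (by linarith) h0.le (by ring)
    have hconv : M.h s pt ≤ (1 - t) * M.h s (πp s) + t * M.h s q := by
      simpa using (M.h_convex s).2 hd hq (by linarith : 0 ≤ 1 - t) h0.le (by ring)
    have hm : η * (∑ a, G (s, a) * πp s a + M.h s (πp s)) + klDist (πp s) (π s)
        ≤ η * (∑ a, G (s, a) * pt a + M.h s pt) + klDist pt (π s) := hmin hmem
    have hkl := klDist_sub_klDist (p := pt) (q := πp s) (r := π s)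
      (M.dom_subset s hmem).1 hp hπ
    have hkl2 := klDist_le_sum_sq_div (M.dom_subset s hmem) (M.dom_subset s hd) hp
    have e1 : ∑ a, Real.log (πp s a / π s a) * (pt a - πp s a) = t * L := by
      rw [hL, Finset.mul_sum]
      exact Finset.sum_congr rfl fun a _ => by rw [hpt']; ring
    have e2 : ∑ a, (pt a - πp s a) ^ 2 / πp s a = t ^ 2 * c := by
      rw [hc, Finset.mul_sum]
      exact Finset.sum_congr rfl fun a _ => by rw [hpt']; ring
    have e3 : ∑ a, G (s, a) * pt a - ∑ a, G (s, a) * πp s a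
        = t * ∑ a, G (s, a) * (q a - πp s a) := by
      rw [Finset.mul_sum, ← Finset.sum_sub_distrib]
      exact Finset.sum_congr rfl fun a _ => by rw [hpt']; ring
    have h3 := mul_le_mul_of_nonneg_left hconv hη
    have h4 : 0 ≤ t * (X + t * c) := by
      rw [e1] at hkl
      rw [e2] at hkl2
      have e4 : t * (X + t * c) = η * (t * ∑ a, G (s, a) * (q a - πp s a))
          + η * ((1 - t) * M.h s (πp s) + t * M.h s q) - η * M.h s (πp s)
          + t * L + t ^ 2 * c := by rw [hX]; ring
      rw [e4, ← e3]
      linarith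
    exact nonneg_of_mul_nonneg_right h4 h0
  have hc0 : 0 ≤ c := Finset.sum_nonneg fun a _ => div_nonneg (sq_nonneg _) (hp a).le
  by_contra hneg
  rw [not_le] at hneg
  have h1 := key 1 one_pos le_rfl
  have hcpos : 0 < c := by linarith
  -- This `t` turns `X + t c` into `X / 2 < 0`. It is admissible because `h1` gives `-X ≤ c`.
  have h2 := key (-X / (2 * c)) (div_pos (by linarith) (by linarith))
    (by rw [div_le_one (by linarith)]; linarith)
  have e : -X / (2 * c) * c = -X / 2 := by field_simp
  rw [e] at h2
  linarith

/-- The three-point inequality for the prox-mapping. -/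
lemma IsProx.three_point (h : M.IsProx η G π πp) (hsc : M.StronglyConvex μ) (hη : 0 < η) (s : S)
    (hπ : ∀ a, 0 < π s a) (hp : ∀ a, 0 < πp s a) {q : A → ℝ} (hq : q ∈ M.dom s) :
    η * (∑ a, G (s, a) * πp s a + M.h s (πp s)) + klDist (πp s) (π s)
        + (1 + η * μ) * klDist q (πp s)
      ≤ η * (∑ a, G (s, a) * q a + M.h s q) + klDist q (π s) := by
  -- The subgradient of `h` selected by stationarity: `η (G + g) + log (πp / π) = 0`.
  set g : A → ℝ := fun a => - G (s, a) - Real.log (πp s a / π s a) / η with hg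
  have eg : ∀ q : A → ℝ, η * ∑ a, g a * (q a - πp s a)
      = - (η * ∑ a, G (s, a) * (q a - πp s a))
        - ∑ a, Real.log (πp s a / π s a) * (q a - πp s a) := by
    intro q
    simp only [Finset.mul_sum, ← Finset.sum_neg_distrib, ← Finset.sum_sub_distrib]
    refine Finset.sum_congr rfl fun a _ => ?_
    simp only [hg]
    field_simp
  have hsub : M.IsSubgradient s (πp s) g := by
    intro q hq
    have h1 := h.optimality hη.le s hπ hp hq
    have h2 := eg q
    refine le_of_mul_le_mul_left ?_ hη
    linarith
  have h1 := mul_le_mul_of_nonneg_left (hsc s (πp s) (h s).1 hp g hsub q hq) hη.le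
  have h2 := klDist_sub_klDist (M.dom_subset s hq).1 hp hπ
  have h3 := eg q
  have h4 : ∑ a, G (s, a) * (q a - πp s a)
      = ∑ a, G (s, a) * q a - ∑ a, G (s, a) * πp s a := by
    rw [← Finset.sum_sub_distrib]
    exact Finset.sum_congr rfl fun a _ => by ring
  rw [h4] at h3
  linarith

/-- The prox-mapping is single-valued on strictly positive policies. -/
lemma IsProx.unique {πp' : Policy S A} (h : M.IsProx η G π πp) (h' : M.IsProx η G π πp')
    (hsc : M.StronglyConvex μ) (hμ : 0 < μ) (hη : 0 < η)
    (hπ : ∀ s a, 0 < π s a) (hp : ∀ s a, 0 < πp s a) : πp' = πp := by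
  funext s
  -- Both points are minimal, so the surplus `(1 + η μ) KL` in the three-point inequality cannot be
  -- positive.
  have h1 := h.three_point hsc hη s (hπ s) (hp s) (h' s).1
  have h2 := (h' s).2 (h s).1
  simp only [Set.mem_ofPred_eq] at h2
  have hsx := M.dom_subset s (h s).1
  have hsx' := M.dom_subset s (h' s).1
  have h3 := sum_sq_sub_le_klDist hsx' hsx (hp s)
  have h4 : klDist (πp' s) (πp s) ≤ 0 := by
    by_contra hc
    rw [not_le] at hc
    nlinarith [mul_pos (by positivity : 0 < 1 + η * μ) hc]
  have h5 : ∑ a, (πp' s a - πp s a) ^ 2 = 0 :=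
    le_antisymm (by linarith) (Finset.sum_nonneg fun _ _ => sq_nonneg _)
  funext a
  have := (Finset.sum_eq_zero_iff_of_nonneg (fun _ _ => sq_nonneg _)).1 h5 a (Finset.mem_univ a)
  nlinarith [sq_eq_zero_iff.1 this]

lemma IsProx.feasible (h : M.IsProx η G π πp) : M.Feasible πp := fun s => (h s).1

variable [Nonempty S] [Nonempty A]

/-- The advantage of `πp` over `π` in terms of the state-value functions. -/
lemma advantage_eq (hπ : M.Feasible π) (hp : M.Feasible πp) (s : S) :
    ∑ a, M.Q π (s, a) * (πp s a - π s a) + M.h s (πp s) - M.h s (π s)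
      = M.V πp s - M.γ * ∑ s', M.stateMat πp s s' * M.V πp s'
        + M.γ * ∑ s', M.stateMat πp s s' * M.V π s' - M.V π s := by
  have a1 : ∑ a, M.Q π (s, a) * (πp s a - π s a) = ∑ a, πp s a * M.Q π (s, a) - M.V π s := by
    rw [V_eq_sum_Q hπ.simplex, ← Finset.sum_sub_distrib]
    exact Finset.sum_congr rfl fun _ _ => by ring
  have hsum : ∀ x : ℝ, x = ∑ a, πp s a * x := fun x => by
    rw [← Finset.sum_mul, (hp.simplex s).2, one_mul]
  have a2 : ∑ a, πp s a * M.Q π (s, a) = ∑ a, πp s a * M.c s a + M.h s (π s)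
      + M.γ * ∑ s', M.stateMat πp s s' * M.V π s' := by
    rw [sum_stateMat_mul, hsum (M.h s (π s)), Finset.mul_sum, ← Finset.sum_add_distrib,
      ← Finset.sum_add_distrib]
    refine Finset.sum_congr rfl fun a _ => ?_
    rw [Q_eq_V hπ.simplex, runCost]
    ring
  have a3 : M.V πp s = ∑ a, πp s a * M.c s a + M.h s (πp s)
      + M.γ * ∑ s', M.stateMat πp s s' * M.V πp s' := by
    rw [V_eq hp.simplex s, hsum (M.h s (πp s)), ← Finset.sum_add_distrib]
    congr 1
    refine Finset.sum_congr rfl fun a _ => ?_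
    rw [runCost]
    ring
  rw [a1, a2]
  linarith

/-- The performance difference identity at the stationary distribution of `πs`. -/
lemma performance_difference {ν : S → ℝ} (hν : M.IsStationary πs ν) (hπ : M.Feasible π)
    (hs : M.Feasible πs) :
    ∑ s, ν s * (∑ a, M.Q π (s, a) * (πs s a - π s a) + M.h s (πs s) - M.h s (π s))
      = -(1 - M.γ) * (M.f ν π - M.f ν πs) := by
  have hinv : ∀ x : S → ℝ, ∑ s, ν s * ∑ s', M.stateMat πs s s' * x s' = ∑ s, ν s * x s := by
    intro x
    simp only [Finset.mul_sum]
    rw [Finset.sum_comm]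
    refine Finset.sum_congr rfl fun s' _ => ?_
    have := congrFun hν.2 s'
    simp only [Matrix.vecMul, dotProduct] at this
    rw [← this, Finset.sum_mul]
    exact Finset.sum_congr rfl fun _ _ => by ring
  have hl : ∀ x : S → ℝ, ∑ s, ν s * (M.γ * x s) = M.γ * ∑ s, ν s * x s := fun x => by
    rw [Finset.mul_sum]
    exact Finset.sum_congr rfl fun _ _ => by ring
  simp_rw [advantage_eq hπ hs, mul_sub, mul_add, mul_sub, Finset.sum_sub_distrib,
    Finset.sum_add_distrib, Finset.sum_sub_distrib, hl, hinv, f]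
  ring

/-- The decrease of the value function in one policy mirror descent step. -/
lemma V_sub_le (hπ : M.Feasible π) (hp : M.Feasible πp) {b : ℝ}
    (h : ∀ s, ∑ a, M.Q π (s, a) * (πp s a - π s a) + M.h s (πp s) - M.h s (π s) ≤ b) (s : S) :
    M.V πp s - M.V π s ≤ ∑ a, M.Q π (s, a) * (πp s a - π s a) + M.h s (πp s) - M.h s (π s)
      + M.γ * (b / (1 - M.γ)) := by
  have e1 : ∀ s, M.V πp s - M.V π s
      = ∑ a, M.Q π (s, a) * (πp s a - π s a) + M.h s (πp s) - M.h s (π s)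
        + M.γ * ∑ s', M.stateMat πp s s' * (M.V πp s' - M.V π s') := by
    intro s
    rw [advantage_eq hπ hp]
    simp only [mul_sub, Finset.sum_sub_distrib]
    ring
  -- The difference `u` of the value functions solves `u = advantage + γ P u`. The advantage at the
  -- current state is kept exactly, and only the future part is estimated through `b`.
  have hK := stateMat_mem (M := M) hp.simplex
  have hbd := le_of_discounted_le hK M.γ_pos.le M.γ_lt_one
    (u := fun s => M.V πp s - M.V π s) (b := b) (fun s => by
      have := e1 s
      have := h s
      linarith)
  rw [e1 s]
  have := mul_le_mul_of_nonneg_left (stochastic_sum_le hK hbd s) M.γ_pos.le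
  linarith

/-- One step of inexact policy mirror descent with the step size `(1 - γ) / (γ μ)`. -/
lemma gap_prox_le {ν : S → ℝ} (hν : M.IsStationary πs ν) (hs : M.Feasible πs)
    (hπ : M.Feasible π) (hμ : 0 < μ) (hsc : M.StronglyConvex μ)
    (h : M.IsProx ((1 - M.γ) / (M.γ * μ)) G π πp)
    (hπ0 : ∀ s a, 0 < π s a) (hp0 : ∀ s a, 0 < πp s a) :
    M.gap μ ν πs πp ≤ M.gap μ ν πs π * M.γ + 1 / (M.γ * μ) * norm2 (G - M.Q π) ^ 2
      + ∑ s, ∑ a, (G - M.Q π) (s, a) * (ν s * (πs s a - π s a)) := by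
  have hγ := M.γ_pos
  have hγ1 : 0 < 1 - M.γ := by linarith [M.γ_lt_one]
  set η := (1 - M.γ) / (M.γ * μ) with hηdef
  have hη : 0 < η := by positivity
  have hp : M.Feasible πp := h.feasible
  set δ := G - M.Q π with hδ
  have hG : ∀ z, G z = M.Q π z + δ z := fun z => by simp [hδ]
  have hδs : ∀ s, ∑ a, δ (s, a) ^ 2 ≤ norm2 δ ^ 2 := by
    intro s
    rw [norm2_sq, Fintype.sum_prod_type]
    exact Finset.single_le_sum (f := fun s => ∑ a, δ (s, a) ^ 2)
      (fun _ _ => Finset.sum_nonneg fun _ _ => sq_nonneg _) (Finset.mem_univ s)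
  -- Young's inequality with weights `1/4` and `η²`. The first part is absorbed by the divergence.
  have hcross : ∀ s, η * -∑ a, δ (s, a) * (πp s a - π s a)
      ≤ klDist (πp s) (π s) + η * (η * norm2 δ ^ 2) := by
    intro s
    have h1 := sum_sq_sub_le_klDist (hp.simplex s) (hπ.simplex s) (hπ0 s)
    have h2 : ∀ a, η * -(δ (s, a) * (πp s a - π s a))
        ≤ (πp s a - π s a) ^ 2 / 4 + η ^ 2 * δ (s, a) ^ 2 := fun a => by
      nlinarith [sq_nonneg ((πp s a - π s a) / 2 + η * δ (s, a))]
    have h3 := Finset.sum_le_sum (s := Finset.univ) fun a _ => h2 a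
    rw [Finset.sum_add_distrib, ← Finset.mul_sum, ← Finset.mul_sum, Finset.sum_neg_distrib,
      ← Finset.sum_div] at h3
    nlinarith [mul_le_mul_of_nonneg_left (hδs s) (sq_nonneg η)]
  -- The three-point inequality at the old policy itself. With an exact estimate the advantage would
  -- be nonpositive; the error costs `η ‖δ‖²`.
  have hb : ∀ s, ∑ a, M.Q π (s, a) * (πp s a - π s a) + M.h s (πp s) - M.h s (π s)
      ≤ η * norm2 δ ^ 2 := by
    intro s
    have h1 := h.three_point hsc hη s (hπ0 s) (hp0 s) (hπ s)
    have h2 : klDist (π s) (π s) = 0 := by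
      simp [klDist, div_self (hπ0 s _).ne']
    have h3 := klDist_nonneg (hπ.simplex s) (hp.simplex s) (hp0 s)
    have h4 := hcross s
    have h5 : ∑ a, M.Q π (s, a) * (πp s a - π s a) = ∑ a, G (s, a) * πp s a
        - ∑ a, G (s, a) * π s a - ∑ a, δ (s, a) * (πp s a - π s a) := by
      simp only [← Finset.sum_sub_distrib]
      exact Finset.sum_congr rfl fun a _ => by rw [hG]; ring
    have h6 := mul_nonneg (by positivity : 0 ≤ 1 + η * μ) h3
    refine le_of_mul_le_mul_left ?_ hη
    rw [h5]
    linarith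
  have hstep : ∀ s, M.V πp s - M.V π s ≤
      (∑ a, M.Q π (s, a) * (πs s a - π s a) + M.h s (πs s) - M.h s (π s))
      + (M.γ * μ / (1 - M.γ) * klDist (πs s) (π s) - μ / (1 - M.γ) * klDist (πs s) (πp s))
      + 1 / (M.γ * μ) * norm2 δ ^ 2 + ∑ a, δ (s, a) * (πs s a - π s a) := by
    intro s
    have h0 := V_sub_le hπ hp hb s
    have h1 := h.three_point hsc hη s (hπ0 s) (hp0 s) (hs s)
    have h4 := hcross s
    have h5 : ∑ a, M.Q π (s, a) * (πp s a - π s a) = ∑ a, M.Q π (s, a) * (πs s a - π s a)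
        + ∑ a, G (s, a) * πp s a - ∑ a, G (s, a) * πs s a
        - ∑ a, δ (s, a) * (πp s a - π s a) + ∑ a, δ (s, a) * (πs s a - π s a) := by
      simp only [← Finset.sum_sub_distrib, ← Finset.sum_add_distrib]
      exact Finset.sum_congr rfl fun a _ => by rw [hG]; ring
    -- Here the choice of `η` matters: `1 + η μ = 1 / γ`, so the coefficients of the old and new
    -- divergence have ratio `γ`. The two error terms `η + γ η / (1 - γ)` add up to `1 / (γ μ)`.
    have e1 : M.γ * μ / (1 - M.γ) = 1 / η := by rw [hηdef]; field_simp
    have e2 : μ / (1 - M.γ) = (1 + η * μ) / η := by rw [hηdef]; field_simp; ring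
    have e3 : 1 / (M.γ * μ) * norm2 δ ^ 2
        = η * norm2 δ ^ 2 + M.γ * (η * norm2 δ ^ 2 / (1 - M.γ)) := by
      rw [hηdef]; field_simp; ring
    rw [e1, e2, e3]
    refine h0.trans ?_
    rw [h5]
    have h6 : ∑ a, G (s, a) * πp s a - ∑ a, G (s, a) * πs s a
        - ∑ a, δ (s, a) * (πp s a - π s a) + M.h s (πp s) - M.h s (πs s)
        ≤ 1 / η * klDist (πs s) (π s) - (1 + η * μ) / η * klDist (πs s) (πp s)
          + η * norm2 δ ^ 2 := by
      refine le_of_mul_le_mul_left ?_ hη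
      have e4 : η * (1 / η * klDist (πs s) (π s) - (1 + η * μ) / η * klDist (πs s) (πp s)
          + η * norm2 δ ^ 2) = klDist (πs s) (π s) - (1 + η * μ) * klDist (πs s) (πp s)
          + η * (η * norm2 δ ^ 2) := by field_simp
      rw [e4]
      linarith
    linarith
  have hsum := Finset.sum_le_sum (s := Finset.univ) fun s _ =>
    mul_le_mul_of_nonneg_left (hstep s) (hν.1.1 s)
  simp only [mul_add, mul_sub, Finset.sum_add_distrib, Finset.sum_sub_distrib] at hsum
  have hpd := performance_difference hν hπ hs
  simp only [mul_add, mul_sub, Finset.sum_add_distrib, Finset.sum_sub_distrib] at hpd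
  rw [hpd] at hsum
  have e5 : ∑ s, ν s * (1 / (M.γ * μ) * norm2 δ ^ 2) = 1 / (M.γ * μ) * norm2 δ ^ 2 := by
    rw [← Finset.sum_mul, hν.1.2, one_mul]
  have e6 : ∀ (c : ℝ) (p : Policy S A), ∑ s, ν s * (c * klDist (πs s) (p s))
      = c * M.dist ν p πs := by
    intro c p
    rw [dist, Finset.mul_sum]
    exact Finset.sum_congr rfl fun _ _ => by ring
  have e7 : ∑ s, ∑ a, δ (s, a) * (ν s * (πs s a - π s a))
      = ∑ s, ν s * ∑ a, δ (s, a) * πs s a - ∑ s, ν s * ∑ a, δ (s, a) * π s a := by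
    rw [← Finset.sum_sub_distrib]
    refine Finset.sum_congr rfl fun s _ => ?_
    rw [Finset.mul_sum, Finset.mul_sum, ← Finset.sum_sub_distrib]
    exact Finset.sum_congr rfl fun _ _ => by ring
  rw [e5, e6, e6] at hsum
  simp only [gap]
  have e8 : ∀ p, ∑ s, ν s * M.V p s = M.f ν p := fun _ => rfl
  rw [e8, e8] at hsum
  rw [e7]
  have e9 : M.γ * μ / (1 - M.γ) = μ / (1 - M.γ) * M.γ := by ring
  rw [e9] at hsum
  linarith

end RegMDP

/-! ### Stationary distributions and geometric mixing. -/

section Stochastic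

variable {ι : Type*} [Fintype ι] [DecidableEq ι] {K : Matrix ι ι ℝ}

/-- The constant vector shows that `K - 1` is singular, so it also has a left null vector `v`. Then
`|v| ≤ |v| K` entrywise while both sides have the same total, hence `|v|` is stationary. -/
lemma exists_stationary [Nonempty ι] (hK : K ∈ Matrix.rowStochastic ℝ ι) :
    ∃ ν ∈ stdSimplex ℝ ι, Matrix.vecMul ν K = ν := by
  have h1 : ∃ v ≠ 0, Matrix.mulVec (K - 1) v = 0 :=
    ⟨1, one_ne_zero, by rw [Matrix.sub_mulVec, hK.2, Matrix.one_mulVec, sub_self]⟩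
  obtain ⟨v, hv0, hv⟩ :=
    Matrix.exists_vecMul_eq_zero_iff.2 (Matrix.exists_mulVec_eq_zero_iff.1 h1)
  rw [Matrix.vecMul_sub, Matrix.vecMul_one, sub_eq_zero] at hv
  have hle : ∀ j, |v j| ≤ ∑ i, |v i| * K i j := by
    intro j
    have := congrFun hv j
    simp only [Matrix.vecMul, dotProduct] at this
    calc |v j| = |∑ i, v i * K i j| := by rw [this]
      _ ≤ ∑ i, |v i * K i j| := Finset.abs_sum_le_sum_abs _ _
      _ = _ := Finset.sum_congr rfl fun i _ => by rw [abs_mul, abs_of_nonneg (hK.1 i j)]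
  have hsum : ∑ j, |v j| = ∑ j, ∑ i, |v i| * K i j := by
    rw [Finset.sum_comm]
    simp only [← Finset.mul_sum, Matrix.sum_row_of_mem_rowStochastic hK, mul_one]
  have heq : ∀ j, |v j| = ∑ i, |v i| * K i j := fun j =>
    (Finset.sum_eq_sum_iff_of_le fun j _ => hle j).1 hsum j (Finset.mem_univ j)
  have hpos : 0 < ∑ j, |v j| := by
    obtain ⟨i, hi⟩ := Function.ne_iff.1 hv0
    exact Finset.sum_pos' (fun _ _ => abs_nonneg _) ⟨i, Finset.mem_univ i, abs_pos.2 hi⟩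
  refine ⟨fun i => |v i| / ∑ j, |v j|, ⟨fun i => by positivity, ?_⟩, ?_⟩
  · rw [← Finset.sum_div, div_self hpos.ne']
  · funext j
    simp only [Matrix.vecMul, dotProduct]
    rw [heq j, Finset.sum_div]
    exact Finset.sum_congr rfl fun i _ => by ring

lemma stationary_pow {ν : ι → ℝ} (hν : Matrix.vecMul ν K = ν) (t : ℕ) :
    Matrix.vecMul ν (K ^ t) = ν := by
  induction t with
  | zero => simp
  | succ t ih => rw [pow_succ, ← Matrix.vecMul_vecMul, ih, hν]

lemma stationary_sum {ν : ι → ℝ} (hν : Matrix.vecMul ν K = ν) (x : ι → ℝ) :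
    ∑ i, ν i * ∑ j, K i j * x j = ∑ i, ν i * x i := by
  simp only [Finset.mul_sum]
  rw [Finset.sum_comm]
  refine Finset.sum_congr rfl fun j _ => ?_
  have := congrFun hν j
  simp only [Matrix.vecMul, dotProduct] at this
  rw [← this, Finset.sum_mul]
  exact Finset.sum_congr rfl fun _ _ => by ring

lemma le_stationary {ν : ι → ℝ} (hν0 : ν ∈ stdSimplex ℝ ι) (hν : Matrix.vecMul ν K = ν) {m : ℕ}
    {δ : ℝ} (hδ : ∀ i j, δ ≤ (K ^ m) i j) (j : ι) : δ ≤ ν j := by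
  have := congrFun (stationary_pow hν m) j
  simp only [Matrix.vecMul, dotProduct] at this
  rw [← this]
  calc δ = ∑ i, ν i * δ := by rw [← Finset.sum_mul, hν0.2, one_mul]
    _ ≤ _ := Finset.sum_le_sum fun i _ => mul_le_mul_of_nonneg_left (hδ i j) (hν0.1 i)

/-- Contraction of the oscillation by a stochastic matrix with entries bounded below. -/
lemma stochastic_osc_le [Nonempty ι] (hK : K ∈ Matrix.rowStochastic ℝ ι) {δ : ℝ}
    (hδ1 : δ ≤ 1) (hδ : ∀ i j, δ ≤ K i j) {g : ι → ℝ} {c : ℝ}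
    (hg : ∀ i j, g i - g j ≤ c) (i j : ι) :
    ∑ l, K i l * g l - ∑ l, K j l * g l ≤ (1 - δ) * c := by
  obtain ⟨b, hb⟩ := Finite.exists_max g
  obtain ⟨a, ha⟩ := Finite.exists_min g
  -- Row `i` gives mass at least `δ` to a minimizer of `g`, so its average lies at least `δ (g b - g
  -- a)` below the maximum. The average over row `j` is at least the minimum.
  have h1 : δ * (g b - g a) ≤ ∑ l, K i l * (g b - g l) :=
    (mul_le_mul_of_nonneg_right (hδ i a) (by linarith [hb a])).trans
      (Finset.single_le_sum (f := fun l => K i l * (g b - g l))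
        (fun l _ => mul_nonneg (hK.1 i l) (by linarith [hb l])) (Finset.mem_univ a))
  simp only [mul_sub, Finset.sum_sub_distrib] at h1
  rw [← Finset.sum_mul, Matrix.sum_row_of_mem_rowStochastic hK] at h1
  have h2 := stochastic_sum_le hK (r := fun l => - g l) (b := - g a)
    (fun l => by linarith [ha l]) j
  simp only [mul_neg, Finset.sum_neg_distrib] at h2
  nlinarith [mul_le_mul_of_nonneg_left (hg b a) (by linarith : 0 ≤ 1 - δ)]

/-- Each factor `K ^ m` contracts the oscillation of a column by `1 - δ`. The remaining `r` steps
start from oscillation at most one. -/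
lemma stochastic_pow_osc_le [Nonempty ι] (hK : K ∈ Matrix.rowStochastic ℝ ι) {δ : ℝ}
    (hδ1 : δ ≤ 1) {m : ℕ} (hδ : ∀ i j, δ ≤ (K ^ m) i j) (q r : ℕ) (i i' j : ι) :
    (K ^ (m * q + r)) i j - (K ^ (m * q + r)) i' j ≤ (1 - δ) ^ q := by
  induction q generalizing i i' with
  | zero =>
    have h1 := Matrix.le_one_of_mem_rowStochastic (pow_mem hK r) (i := i) (j := j)
    have h2 := (pow_mem hK r).1 i' j
    simp only [mul_zero, zero_add, pow_zero]
    linarith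
  | succ q ih =>
    have e : m * (q + 1) + r = m + (m * q + r) := by ring
    rw [e, pow_add, Matrix.mul_apply, Matrix.mul_apply, pow_succ']
    exact stochastic_osc_le (pow_mem hK m) hδ1 hδ (fun a b => ih a b) i i'

/-- By stationarity `ν j` is an average of the column `j` of `K ^ t`, so it differs from each entry
by at most the oscillation of that column. -/
lemma abs_stochastic_pow_sub_le [Nonempty ι] (hK : K ∈ Matrix.rowStochastic ℝ ι) {δ : ℝ}
    (hδ1 : δ ≤ 1) {m : ℕ} (hδ : ∀ i j, δ ≤ (K ^ m) i j) {ν : ι → ℝ} (hν0 : ν ∈ stdSimplex ℝ ι)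
    (hν : Matrix.vecMul ν K = ν) (t : ℕ) (i j : ι) :
    |ν j - (K ^ t) i j| ≤ (1 - δ) ^ (t / m) := by
  have hosc : ∀ i i', (K ^ t) i j - (K ^ t) i' j ≤ (1 - δ) ^ (t / m) := fun i i' => by
    have := stochastic_pow_osc_le hK hδ1 hδ (t / m) (t % m) i i' j
    rwa [Nat.div_add_mod] at this
  have h := congrFun (stationary_pow hν t) j
  simp only [Matrix.vecMul, dotProduct] at h
  have e : ν j - (K ^ t) i j = ∑ l, ν l * ((K ^ t) l j - (K ^ t) i j) := by
    simp only [mul_sub, Finset.sum_sub_distrib]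
    rw [h, ← Finset.sum_mul, hν0.2, one_mul]
  rw [e]
  calc |∑ l, ν l * ((K ^ t) l j - (K ^ t) i j)|
      ≤ ∑ l, |ν l * ((K ^ t) l j - (K ^ t) i j)| := Finset.abs_sum_le_sum_abs _ _
    _ ≤ ∑ l, ν l * (1 - δ) ^ (t / m) := by
        refine Finset.sum_le_sum fun l _ => ?_
        rw [abs_mul, abs_of_nonneg (hν0.1 l)]
        refine mul_le_mul_of_nonneg_left (abs_le.2 ⟨?_, hosc l i⟩) (hν0.1 l)
        linarith [hosc i l]
    _ = _ := by rw [← Finset.sum_mul, hν0.2, one_mul]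

/-- Take `ρ = 1 - δ / m`. Bernoulli's inequality gives `1 - δ ≤ ρ ^ m`, and `C = ρ ^ (-m)` pays for
the incomplete last block. -/
lemma exists_geometric_bound {δ : ℝ} (h0 : 0 < δ) (h1 : δ < 1) {m : ℕ} (hm : 0 < m) :
    ∃ C ρ : ℝ, 0 < C ∧ 0 < ρ ∧ ρ < 1 ∧ ∀ t : ℕ, (1 - δ) ^ (t / m) ≤ C * ρ ^ t := by
  have hm' : (1 : ℝ) ≤ m := by exact_mod_cast hm
  have hdm : δ / m ≤ δ := div_le_self h0.le hm'
  have hdm0 : 0 < δ / m := by positivity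
  set ρ := 1 - δ / m with hρ
  have hρ0 : 0 < ρ := by linarith
  have hρ1 : ρ < 1 := by linarith
  have hb : 1 - δ ≤ ρ ^ m := by
    have := one_add_mul_le_pow (a := -(δ / m)) (by linarith) m
    have e : (m : ℝ) * -(δ / m) = -δ := by field_simp
    rw [e] at this
    rw [hρ, sub_eq_add_neg, sub_eq_add_neg]
    exact this
  refine ⟨(ρ ^ m)⁻¹, ρ, by positivity, hρ0, hρ1, fun t => ?_⟩
  rw [inv_mul_eq_div, le_div_iff₀ (by positivity)]
  calc (1 - δ) ^ (t / m) * ρ ^ m ≤ (ρ ^ m) ^ (t / m) * ρ ^ (t % m) :=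
        mul_le_mul (pow_le_pow_left₀ (by linarith) hb _)
          (pow_le_pow_of_le_one hρ0.le hρ1.le (Nat.mod_lt t hm).le) (by positivity)
          (by positivity)
    _ = ρ ^ t := by rw [← pow_mul, ← pow_add, Nat.div_add_mod]

/-- Entrywise domination of nonnegative matrices passes to powers. This transfers the positivity of
one chain to a whole class of policies with a uniform bound. -/
lemma pow_mul_pow_apply_le {B : Matrix ι ι ℝ} {c : ℝ} (hc : 0 ≤ c) (hB : ∀ i j, 0 ≤ B i j)
    (h : ∀ i j, c * B i j ≤ K i j) (m : ℕ) (i j : ι) :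
    0 ≤ (B ^ m) i j ∧ c ^ m * (B ^ m) i j ≤ (K ^ m) i j := by
  induction m generalizing i with
  | zero => simp [Matrix.one_apply]; split_ifs <;> norm_num
  | succ m ih =>
    rw [pow_succ' B, pow_succ' K, Matrix.mul_apply, Matrix.mul_apply, Finset.mul_sum]
    refine ⟨Finset.sum_nonneg fun l _ => mul_nonneg (hB i l) (ih l).1,
      Finset.sum_le_sum fun l _ => ?_⟩
    calc c ^ (m + 1) * (B i l * (B ^ m) l j) = (c * B i l) * (c ^ m * (B ^ m) l j) := by ring
      _ ≤ _ := mul_le_mul (h i l) (ih l).2 (mul_nonneg (by positivity) (ih l).1)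
        ((mul_nonneg hc (hB i l)).trans (h i l))

lemma le_minEig_diagonal [Nonempty ι] {w : ι → ℝ} {b : ℝ} (h : ∀ i, b ≤ w i) :
    b ≤ minEig (Matrix.diagonal w) := by
  rw [minEig, spectrum_diagonal]
  refine le_csInf (Set.range_nonempty _) ?_
  rintro _ ⟨i, rfl⟩
  exact h i

lemma maxEig_diagonal_le [Nonempty ι] {w : ι → ℝ} {b : ℝ} (h : ∀ i, w i ≤ b) :
    maxEig (Matrix.diagonal w) ≤ b := by
  rw [maxEig, spectrum_diagonal]
  refine csSup_le (Set.range_nonempty _) ?_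
  rintro _ ⟨i, rfl⟩
  exact h i

lemma minEig_diagonal_le {w : ι → ℝ} (i : ι) : minEig (Matrix.diagonal w) ≤ w i := by
  rw [minEig, spectrum_diagonal]
  exact csInf_le (Set.finite_range w).bddBelow ⟨i, rfl⟩

end Stochastic

/-! ### Existence of valid constants. -/

namespace RegMDP

variable {S A : Type*} [Fintype S] [Fintype A] [DecidableEq S] [DecidableEq A]
  [Nonempty S] [Nonempty A] {M : RegMDP S A} {π : Policy S A}

lemma statDist_isStationary (hπ : ∀ s, π s ∈ stdSimplex ℝ A) :
    M.IsStationary π (M.statDist π) := by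
  have h : ∃ ν, M.IsStationary π ν := exists_stationary (stateMat_mem hπ)
  rw [statDist, dif_pos h]
  exact h.choose_spec

/-- The stationary weight of a state-action pair, the diagonal of `M.weight π`. -/
noncomputable def pairDist (M : RegMDP S A) (π : Policy S A) (z : S × A) : ℝ :=
  M.statDist π z.1 * π z.1 z.2

lemma weight_eq : M.weight π = Matrix.diagonal (M.pairDist π) := rfl

lemma pairDist_mem (hπ : ∀ s, π s ∈ stdSimplex ℝ A) :
    M.pairDist π ∈ stdSimplex ℝ (S × A) := by
  have h := statDist_isStationary (M := M) hπ
  refine ⟨fun z => mul_nonneg (h.1.1 _) ((hπ _).1 _), ?_⟩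
  simp only [pairDist, Fintype.sum_prod_type, ← Finset.mul_sum, (hπ _).2, mul_one]
  exact h.1.2

lemma pairDist_stationary (hπ : ∀ s, π s ∈ stdSimplex ℝ A) :
    Matrix.vecMul (M.pairDist π) (M.pairMat π) = M.pairDist π := by
  funext z
  have h := congrFun (statDist_isStationary (M := M) hπ).2 z.1
  simp only [Matrix.vecMul, dotProduct, stateMat, Matrix.of_apply, pairDist, pairMat,
    Fintype.sum_prod_type] at h ⊢
  rw [← h, Finset.sum_mul]
  refine Finset.sum_congr rfl fun s _ => ?_
  rw [Finset.mul_sum, Finset.sum_mul]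
  exact Finset.sum_congr rfl fun a _ => by ring

/-- A step of the pair chain is a move of the state followed by a draw of the action. Regrouping
leaves `m` full steps of the state chain between the first move and the last draw. -/
lemma pairMat_pow_succ (m : ℕ) (z z' : S × A) :
    (M.pairMat π ^ (m + 1)) z z'
      = ∑ s, M.P z.1 z.2 s * ((M.stateMat π ^ m) s z'.1 * π z'.1 z'.2) := by
  induction m generalizing z with
  | zero => simp [pairMat, Matrix.one_apply]
  | succ m ih =>
    rw [pow_succ', Matrix.mul_apply, sum_pairMat_mul]
    refine Finset.sum_congr rfl fun s _ => ?_
    congr 1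
    rw [pow_succ' (M.stateMat π), Matrix.mul_apply]
    simp only [ih]
    rw [Finset.sum_mul]
    simp only [mul_assoc]
    rw [sum_stateMat_mul]

/-- Compare with `opF_apply`: the same Bellman residual is weighted by a row of a power of the pair
matrix instead of the stationary distribution. The bias of `opFtilde` is therefore a question of
mixing only. -/
lemma meanOpFtilde_apply (hπ : ∀ s, π s ∈ stdSimplex ℝ A) (θ : S × A → ℝ) (α : ℕ)
    (z₀ z : S × A) :
    M.meanOpFtilde π θ α z₀ z = (M.pairMat π ^ (α - 1)) z₀ z * (θ - M.bellman π θ) z := by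
  simp only [meanOpFtilde, opFtilde, Finset.sum_apply, Pi.smul_apply, smul_eq_mul]
  rw [Finset.sum_eq_single z]
  · congr 1
    simp only [Pi.single_eq_same, mul_sub, Finset.sum_sub_distrib, ← Finset.sum_mul,
      Matrix.sum_row_of_mem_rowStochastic (pairMat_mem hπ), Pi.sub_apply, bellman,
      ← sum_pairMat_mul, one_mul]
    rw [Finset.mul_sum, ← sub_sub]
    congr 1
    exact Finset.sum_congr rfl fun _ _ => by ring
  · intro y _ hy
    simp [Pi.single_eq_of_ne' hy]
  · simp

lemma opF_apply (θ : S × A → ℝ) (z : S × A) :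
    M.opF π θ z = M.pairDist π z * (θ - M.bellman π θ) z := by
  rw [opF, weight_eq, Matrix.mulVec_diagonal]

lemma abs_sub_bellman_le (hπ : ∀ s, π s ∈ stdSimplex ℝ A) (θ : S × A → ℝ) (z : S × A) :
    |(θ - M.bellman π θ) z| ≤ 2 * norm2 (θ - M.Q π) := by
  rw [sub_bellman hπ]
  have h1 := abs_apply_le_norm2 (θ - M.Q π) z
  have h2 := abs_stochastic_sum_le (pairMat_mem (M := M) hπ) (abs_apply_le_norm2 (θ - M.Q π)) z
  refine (abs_sub _ _).trans ?_
  rw [abs_mul, abs_of_pos M.γ_pos]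
  nlinarith [M.γ_lt_one, M.γ_pos, norm2_nonneg (θ - M.Q π)]

/-- Existence of valid constants for a uniformly positive class of ergodic policies. -/
theorem exists_validConst {cbar hbar : ℝ} (hc : ∀ s a, |M.c s a| ≤ cbar)
    (hh : ∀ s, ∀ p ∈ M.dom s, |M.h s p| ≤ hbar) {Pol : Set (Policy S A)}
    (hfeas : ∀ π ∈ Pol, M.Feasible π) {πlow : ℝ} (hlow : 0 < πlow)
    (hrand : ∀ π ∈ Pol, ∀ s a, πlow ≤ π s a)
    (herg : ∀ π ∈ Pol, (M.stateMat π).IsPrimitive) : ∃ k : CTDConst, M.ValidConst Pol k := by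
  have hγ1 : 0 < 1 - M.γ := by linarith [M.γ_lt_one]
  rcases Pol.eq_empty_or_nonempty with rfl | ⟨π₀, h0⟩
  · exact ⟨⟨1, 1, 1, 1 / 2, 1⟩, by constructor <;> norm_num⟩
  -- One policy suffices: all probabilities are at least `πlow`, so every state matrix of the class
  -- dominates `πlow` times that of `π₀`. The exponent `m` and the bound `δ₀` thus serve the whole
  -- class.
  obtain ⟨m, hm, hpos⟩ := (herg π₀ h0).exists_pos_pow
  obtain ⟨⟨i₀, j₀⟩, hmin⟩ := Finite.exists_min fun p : S × S => (M.stateMat π₀ ^ m) p.1 p.2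
  set δ₀ := πlow ^ m * (M.stateMat π₀ ^ m) i₀ j₀ with hδ₀
  have hδ₀pos : 0 < δ₀ := mul_pos (by positivity) (hpos _ _)
  have hstate : ∀ π ∈ Pol, ∀ s s', δ₀ ≤ (M.stateMat π ^ m) s s' := by
    intro π hπ s s'
    refine le_trans ?_ (pow_mul_pow_apply_le (B := M.stateMat π₀) hlow.le
      (stateMat_mem (hfeas π₀ h0).simplex).1 (fun i j => ?_) m s s').2
    · exact mul_le_mul_of_nonneg_left (hmin (s, s')) (by positivity)
    · simp only [stateMat, Matrix.of_apply, Finset.mul_sum, ← mul_assoc]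
      refine Finset.sum_le_sum fun a _ => mul_le_mul_of_nonneg_right ?_ (M.P_nonneg _ _ _)
      calc πlow * π₀ i a ≤ πlow * 1 := mul_le_mul_of_nonneg_left
            (stdSimplex_apply_le_one ((hfeas π₀ h0).simplex i) a) hlow.le
        _ ≤ π i a := by rw [mul_one]; exact hrand π hπ i a
  -- The cap at `1/2` keeps the contraction factor `1 - δ` positive.
  set δ := min (δ₀ * πlow) (1 / 2) with hδ
  have hδpos : 0 < δ := lt_min (by positivity) (by norm_num)
  have hδlt : δ < 1 := (min_le_right _ _).trans_lt (by norm_num)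
  have hpair : ∀ π ∈ Pol, ∀ z z', δ ≤ (M.pairMat π ^ (m + 1)) z z' := by
    intro π hπ z z'
    rw [pairMat_pow_succ]
    calc δ ≤ ∑ s, M.P z.1 z.2 s * (δ₀ * πlow) := by
          rw [← Finset.sum_mul, M.P_sum, one_mul]; exact min_le_left _ _
      _ ≤ _ := Finset.sum_le_sum fun s _ => mul_le_mul_of_nonneg_left
          (mul_le_mul (hstate π hπ _ _) (hrand π hπ _ _) hlow.le
            (hδ₀pos.le.trans (hstate π hπ _ _))) (M.P_nonneg _ _ _)
  obtain ⟨C, ρ, hC, hρ0, hρ1, hgeo⟩ := exists_geometric_bound hδpos hδlt (Nat.succ_pos m)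
  have hn : (0 : ℝ) < Fintype.card (S × A) := by exact_mod_cast Fintype.card_pos
  -- In the mixing constant, the square root passes from the maximum norm to the Euclidean norm, `2`
  -- bounds the Bellman residual, and `C / ρ` accounts for the exponent `α - 1`.
  refine ⟨⟨(1 - M.γ) * δ, 1 - M.γ, Real.sqrt (Fintype.card (S × A)) * 2 * (C / ρ), ρ,
    M.thetaBar cbar hbar⟩, mul_pos hγ1 hδpos, fun π hπ => ?_, fun π hπ => ?_, by positivity,
    hρ0, hρ1, fun π hπ θ z₀ α hα => ?_, fun π hπ => norm2_Q_le hc hh (hfeas π hπ)⟩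
  · refine mul_le_mul_of_nonneg_left (le_minEig_diagonal fun z => ?_) hγ1.le
    exact le_stationary (pairDist_mem (hfeas π hπ).simplex)
      (pairDist_stationary (hfeas π hπ).simplex) (hpair π hπ) z
  · refine mul_le_of_le_one_right hγ1.le (maxEig_diagonal_le fun z => ?_)
    exact stdSimplex_apply_le_one (pairDist_mem (hfeas π hπ).simplex) z
  · have hs := (hfeas π hπ).simplex
    have hx := norm2_nonneg (θ - M.Q π)
    refine (norm2_le_of_abs_le (b := C * ρ ^ (α - 1) * (2 * norm2 (θ - M.Q π)))
      (by positivity) fun z => ?_).trans (le_of_eq ?_)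
    · rw [Pi.sub_apply, opF_apply, meanOpFtilde_apply hs, ← sub_mul, abs_mul]
      exact mul_le_mul ((abs_stochastic_pow_sub_le (pairMat_mem hs) hδlt.le (hpair π hπ)
        (pairDist_mem hs) (pairDist_stationary hs) (α - 1) z₀ z).trans (hgeo _))
        (abs_sub_bellman_le hs θ z) (abs_nonneg _) (by positivity)
    · obtain ⟨b, rfl⟩ := Nat.exists_eq_add_of_le' hα
      simp only [Nat.add_sub_cancel, pow_succ]
      field_simp

end RegMDP

/-! ### The conditional mean of one temporal difference step. -/

namespace RegMDP

variable {S A : Type*} [Fintype S] [Fintype A] [DecidableEq S] [DecidableEq A]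
  [Nonempty S] [Nonempty A] {M : RegMDP S A} {π : Policy S A} {Pol : Set (Policy S A)}
  {k : CTDConst}

/-- The linear part `diag(w) (I - γ P^π)` of the operator `F^π`. -/
noncomputable def linF (M : RegMDP S A) (π : Policy S A) (x : S × A → ℝ) (z : S × A) : ℝ :=
  M.pairDist π z * (x z - M.γ * ∑ z', M.pairMat π z z' * x z')

/-- The adjoint of `linF`. -/
noncomputable def adjF (M : RegMDP S A) (π : Policy S A) (v : S × A → ℝ) (z : S × A) : ℝ :=
  M.pairDist π z * v z - M.γ * ∑ z', M.pairMat π z' z * (M.pairDist π z' * v z')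

lemma opF_eq_linF (hπ : ∀ s, π s ∈ stdSimplex ℝ A) (θ : S × A → ℝ) :
    M.opF π θ = M.linF π (θ - M.Q π) := by
  funext z
  rw [opF_apply, sub_bellman hπ, linF]

lemma sum_linF_mul (x v : S × A → ℝ) :
    ∑ z, M.linF π x z * v z = ∑ z, x z * M.adjF π v z := by
  simp only [linF, adjF, mul_sub, sub_mul, Finset.sum_sub_distrib, Finset.mul_sum, Finset.sum_mul]
  rw [Finset.sum_comm (f := fun z z' => M.pairDist π z * (M.γ * (M.pairMat π z z' * x z')) * v z)]
  congr 1
  · exact Finset.sum_congr rfl fun _ _ => by ring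
  · exact Finset.sum_congr rfl fun _ _ => Finset.sum_congr rfl fun _ _ => by ring

lemma ValidConst.lamMin_le_pairDist (hk : M.ValidConst Pol k) (hπ : π ∈ Pol) (z : S × A) :
    k.lamMin ≤ (1 - M.γ) * M.pairDist π z :=
  (hk.lamMin_le π hπ).trans (mul_le_mul_of_nonneg_left (minEig_diagonal_le z)
    (by linarith [M.γ_lt_one]))

/-- By Jensen's inequality and stationarity, the transition operator is nonexpansive in the norm
weighted by `pairDist`. -/
lemma sum_pairDist_sq_le (hs : ∀ s, π s ∈ stdSimplex ℝ A) (x : S × A → ℝ) :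
    ∑ z, M.pairDist π z * (∑ z', M.pairMat π z z' * x z') ^ 2
      ≤ ∑ z, M.pairDist π z * x z ^ 2 := by
  rw [← stationary_sum (pairDist_stationary hs) fun z => x z ^ 2]
  exact Finset.sum_le_sum fun z _ => mul_le_mul_of_nonneg_left
    (sq_stochastic_sum_le (pairMat_mem hs) x z) ((pairDist_mem hs).1 z)

/-- In the weighted inner product `⟨x, P x⟩ ≤ ‖x‖²`, so the quadratic form is at least `(1 - γ)`
times the weighted square, and `lamMin` bounds the weights times `1 - γ` from below. -/
lemma strong_monotone_linF (hk : M.ValidConst Pol k) (hπ : π ∈ Pol)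
    (hs : ∀ s, π s ∈ stdSimplex ℝ A) (x : S × A → ℝ) :
    k.lamMin * norm2 x ^ 2 ≤ ∑ z, M.linF π x z * x z := by
  have h1 := sum_pairDist_sq_le (M := M) hs x
  have h2 : ∑ z, ((1 - M.γ / 2) * (M.pairDist π z * x z ^ 2)
      - M.γ / 2 * (M.pairDist π z * (∑ z', M.pairMat π z z' * x z') ^ 2))
      ≤ ∑ z, M.linF π x z * x z := by
    refine Finset.sum_le_sum fun z _ => ?_
    rw [linF]
    nlinarith [mul_nonneg (mul_nonneg M.γ_pos.le ((pairDist_mem (M := M) hs).1 z))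
      (sq_nonneg (x z - ∑ z', M.pairMat π z z' * x z'))]
  rw [Finset.sum_sub_distrib, ← Finset.mul_sum, ← Finset.mul_sum] at h2
  have h3 : k.lamMin * norm2 x ^ 2 ≤ (1 - M.γ) * ∑ z, M.pairDist π z * x z ^ 2 := by
    rw [norm2_sq, Finset.mul_sum, Finset.mul_sum]
    refine Finset.sum_le_sum fun z _ => ?_
    rw [← mul_assoc]
    exact mul_le_mul_of_nonneg_right (hk.lamMin_le_pairDist hπ z) (sq_nonneg _)
  nlinarith [M.γ_pos]

lemma norm2_linF_le (hs : ∀ s, π s ∈ stdSimplex ℝ A) (x : S × A → ℝ) :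
    norm2 (M.linF π x) ≤ 2 * norm2 x := by
  have hx := norm2_nonneg x
  rw [norm2_le_iff (by positivity), mul_pow, norm2_sq]
  have h1 := sum_pairDist_sq_le (M := M) hs x
  have hw := (pairDist_mem (M := M) hs).1
  have hw1 := stdSimplex_apply_le_one (pairDist_mem (M := M) hs)
  calc ∑ z, M.linF π x z ^ 2
      ≤ ∑ z, (2 * (M.pairDist π z * x z ^ 2)
        + 2 * (M.pairDist π z * (∑ z', M.pairMat π z z' * x z') ^ 2)) := by
        refine Finset.sum_le_sum fun z _ => ?_
        rw [linF]
        set y := ∑ z', M.pairMat π z z' * x z'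
        have a1 : (x z - M.γ * y) ^ 2 ≤ 2 * x z ^ 2 + 2 * y ^ 2 := by
          have : M.γ ^ 2 ≤ 1 := pow_le_one₀ M.γ_pos.le M.γ_lt_one.le
          nlinarith [sq_nonneg (x z + M.γ * y), mul_le_mul_of_nonneg_right this (sq_nonneg y)]
        have a2 : M.pairDist π z ^ 2 ≤ M.pairDist π z := by nlinarith [hw z, hw1 z]
        rw [mul_pow]
        nlinarith [mul_le_mul a2 a1 (sq_nonneg _) (hw z)]
    _ ≤ 4 * ∑ z, M.pairDist π z * x z ^ 2 := by
        rw [Finset.sum_add_distrib, ← Finset.mul_sum, ← Finset.mul_sum]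
        linarith
    _ ≤ 4 * ∑ z, x z ^ 2 := by
        refine mul_le_mul_of_nonneg_left (Finset.sum_le_sum fun z _ => ?_) (by norm_num)
        exact mul_le_of_le_one_left (sq_nonneg _) (hw1 z)
    _ = _ := by norm_num

/-- An operator and its adjoint have the same norm: test the duality with `adjF π v` itself. -/
lemma norm2_adjF_le (hs : ∀ s, π s ∈ stdSimplex ℝ A) (v : S × A → ℝ) :
    norm2 (M.adjF π v) ≤ 2 * norm2 v := by
  have h1 : norm2 (M.adjF π v) ^ 2 ≤ 2 * norm2 v * norm2 (M.adjF π v) := by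
    calc norm2 (M.adjF π v) ^ 2 = ∑ z, M.adjF π v z * M.adjF π v z := by
          rw [norm2_sq]; exact Finset.sum_congr rfl fun _ _ => sq _
      _ = ∑ z, M.linF π (M.adjF π v) z * v z := (sum_linF_mul _ _).symm
      _ ≤ norm2 (M.linF π (M.adjF π v)) * norm2 v := sum_mul_le_norm2 _ _
      _ ≤ 2 * norm2 (M.adjF π v) * norm2 v :=
          mul_le_mul_of_nonneg_right (norm2_linF_le hs _) (norm2_nonneg v)
      _ = _ := by ring
  rcases (norm2_nonneg (M.adjF π v)).eq_or_lt with h | h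
  · rw [← h]; have := norm2_nonneg v; positivity
  · nlinarith

/-- The contraction of one dual step. The adjoint has the quadratic form of `linF`, which yields `-2
β lamMin`. The quadratic term `4 β²` is at most `β lamMin / 8` by the restriction on `β`. -/
lemma norm2_sub_adjF_sq_le (hk : M.ValidConst Pol k) (hπ : π ∈ Pol)
    (hs : ∀ s, π s ∈ stdSimplex ℝ A) {β : ℝ} (hβ0 : 0 ≤ β) (hβ : 32 * (1 + M.γ) ^ 2 * β ≤ k.lamMin)
    (v : S × A → ℝ) :
    norm2 (v - β • M.adjF π v) ^ 2 ≤ (1 - 3 / 2 * (β * k.lamMin)) * norm2 v ^ 2 := by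
  have h1 := strong_monotone_linF hk hπ hs v
  rw [sum_linF_mul] at h1
  have h2 := pow_le_pow_left₀ (norm2_nonneg _) (norm2_adjF_le (M := M) hs v) 2
  have e : norm2 (v - β • M.adjF π v) ^ 2 = norm2 v ^ 2 - 2 * β * ∑ z, v z * M.adjF π v z
      + β ^ 2 * norm2 (M.adjF π v) ^ 2 := by
    simp only [norm2_sq, Finset.mul_sum, ← Finset.sum_sub_distrib, ← Finset.sum_add_distrib]
    exact Finset.sum_congr rfl fun z _ => by
      simp only [Pi.sub_apply, Pi.smul_apply, smul_eq_mul]; ring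
  rw [e]
  have h3 : 32 * β ≤ k.lamMin := by
    have : 1 ≤ (1 + M.γ) ^ 2 := by nlinarith [M.γ_pos]
    nlinarith [mul_le_mul_of_nonneg_right this hβ0]
  nlinarith [mul_le_mul_of_nonneg_left h1 hβ0, mul_le_mul_of_nonneg_left h2 (sq_nonneg β),
    mul_le_mul_of_nonneg_right (mul_le_mul_of_nonneg_left h3 hβ0) (sq_nonneg (norm2 v))]

/-- The expectation of a function of the last of `α ≥ 1` transitions started at `z₀`. -/
noncomputable def blockMean (M : RegMDP S A) (π : Policy S A) (α : ℕ) (z₀ : S × A)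
    (G : S × A → S × A → ℝ) : ℝ :=
  ∑ z, (M.pairMat π ^ (α - 1)) z₀ z * ∑ z', M.pairMat π z z' * G z z'

lemma blockMean_mono (hs : ∀ s, π s ∈ stdSimplex ℝ A) (α : ℕ) (z₀ : S × A)
    {G H : S × A → S × A → ℝ}
    (h : ∀ z, ∑ z', M.pairMat π z z' * G z z' ≤ ∑ z', M.pairMat π z z' * H z z') :
    M.blockMean π α z₀ G ≤ M.blockMean π α z₀ H :=
  Finset.sum_le_sum fun z _ =>
    mul_le_mul_of_nonneg_left (h z) ((pow_mem (pairMat_mem hs) _).1 z₀ z)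

lemma blockMean_const (hs : ∀ s, π s ∈ stdSimplex ℝ A) (α : ℕ) (z₀ : S × A) (c : ℝ) :
    M.blockMean π α z₀ (fun _ _ => c) = c := by
  simp only [blockMean, ← Finset.sum_mul, Matrix.sum_row_of_mem_rowStochastic (pairMat_mem hs),
    Matrix.sum_row_of_mem_rowStochastic (pow_mem (pairMat_mem hs) _), one_mul]

lemma blockMean_add (α : ℕ) (z₀ : S × A) (G H : S × A → S × A → ℝ) :
    M.blockMean π α z₀ (fun z z' => G z z' + H z z')
      = M.blockMean π α z₀ G + M.blockMean π α z₀ H := by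
  simp only [blockMean, mul_add, Finset.sum_add_distrib]

lemma blockMean_const_mul (α : ℕ) (z₀ : S × A) (c : ℝ) (G : S × A → S × A → ℝ) :
    M.blockMean π α z₀ (fun z z' => c * G z z') = c * M.blockMean π α z₀ G := by
  simp only [blockMean, Finset.mul_sum]
  exact Finset.sum_congr rfl fun _ _ => Finset.sum_congr rfl fun _ _ => by ring

lemma blockMean_opFtilde (θ v : S × A → ℝ) (α : ℕ) (z₀ : S × A) :
    M.blockMean π α z₀ (fun z z' => ∑ i, M.opFtilde π θ z z' i * v i)
      = ∑ i, M.meanOpFtilde π θ α z₀ i * v i := by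
  simp only [blockMean, meanOpFtilde, Finset.sum_apply, Pi.smul_apply, smul_eq_mul,
    Finset.sum_mul, Finset.mul_sum]
  rw [Finset.sum_comm (s := Finset.univ (α := S × A))]
  conv_rhs => rw [Finset.sum_comm]
  rw [Finset.sum_comm]
  refine Finset.sum_congr rfl fun z _ => ?_
  rw [Finset.sum_comm]
  exact Finset.sum_congr rfl fun _ _ => Finset.sum_congr rfl fun _ _ => by ring

lemma abs_bias_le (hk : M.ValidConst Pol k) (hπ : π ∈ Pol) (hs : ∀ s, π s ∈ stdSimplex ℝ A)
    {α : ℕ} (hα : 1 ≤ α) (z₀ : S × A) (θ v : S × A → ℝ) :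
    |∑ z, (θ - M.Q π) z * M.adjF π v z
      - M.blockMean π α z₀ (fun z z' => ∑ i, M.opFtilde π θ z z' i * v i)|
      ≤ k.C * k.ρ ^ α * norm2 (θ - M.Q π) * norm2 v := by
  rw [blockMean_opFtilde, ← sum_linF_mul, ← opF_eq_linF hs, ← Finset.sum_sub_distrib]
  have := abs_sum_mul_le_norm2 (M.opF π θ - M.meanOpFtilde π θ α z₀) v
  simp only [Pi.sub_apply, sub_mul] at this
  exact this.trans (mul_le_mul_of_nonneg_right (hk.mixing π hπ θ z₀ α hα) (norm2_nonneg v))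

/-- The conditional mean of one step of conditional temporal difference. -/
lemma blockMean_step_le (hk : M.ValidConst Pol k) (hπ : π ∈ Pol)
    (hs : ∀ s, π s ∈ stdSimplex ℝ A) {α : ℕ} (hα : 1 ≤ α) {β : ℝ} (hβ : 0 ≤ β) (z₀ : S × A)
    (θ v : S × A → ℝ) :
    M.blockMean π α z₀ (fun z z' => ∑ i, (θ - β • M.opFtilde π θ z z' - M.Q π) i * v i)
      ≤ ∑ i, (θ - M.Q π) i * (v - β • M.adjF π v) i
        + β * (k.C * k.ρ ^ α) * norm2 (θ - M.Q π) * norm2 v := by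
  have h := (abs_le.1 (abs_bias_le hk hπ hs hα z₀ θ v)).2
  have e : (fun z z' => ∑ i, (θ - β • M.opFtilde π θ z z' - M.Q π) i * v i)
      = fun z z' => ∑ i, (θ - M.Q π) i * v i
        + -β * ∑ i, M.opFtilde π θ z z' i * v i := by
    funext z z'
    rw [Finset.mul_sum, ← Finset.sum_add_distrib]
    exact Finset.sum_congr rfl fun i _ => by
      simp only [Pi.sub_apply, Pi.smul_apply, smul_eq_mul]; ring
  have e2 : ∑ i, (θ - M.Q π) i * (v - β • M.adjF π v) i
      = ∑ i, (θ - M.Q π) i * v i - β * ∑ i, (θ - M.Q π) i * M.adjF π v i := by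
    rw [Finset.mul_sum, ← Finset.sum_sub_distrib]
    exact Finset.sum_congr rfl fun i _ => by
      simp only [Pi.sub_apply, Pi.smul_apply, smul_eq_mul]; ring
  rw [e, blockMean_add, blockMean_const hs, blockMean_const_mul, e2]
  nlinarith [mul_le_mul_of_nonneg_left h hβ]

/-- The mean squared error after one step of conditional temporal difference. -/
lemma blockMean_sq_step_le (hk : M.ValidConst Pol k) (hπ : π ∈ Pol)
    (hs : ∀ s, π s ∈ stdSimplex ℝ A) {α : ℕ} (hα : 1 ≤ α)
    (hα2 : k.C * k.ρ ^ α ≤ k.lamMin / 9) {β : ℝ} (hβ0 : 0 ≤ β)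
    (hβ : 32 * (1 + M.γ) ^ 2 * β ≤ k.lamMin) (z₀ : S × A) (θ : S × A → ℝ) :
    M.blockMean π α z₀ (fun z z' => norm2 (θ - β • M.opFtilde π θ z z' - M.Q π) ^ 2)
      ≤ (1 - 3 / 2 * (β * k.lamMin)) * norm2 (θ - M.Q π) ^ 2 + 2 * β ^ 2 * k.B ^ 2 := by
  set x := θ - M.Q π with hx
  have hγ := M.γ_pos
  have hγ1 := M.γ_lt_one
  set d : S × A → S × A → ℝ := fun z z' => θ z - M.runCost π z - M.γ * θ z' with hd
  have e : (fun z z' => norm2 (θ - β • M.opFtilde π θ z z' - M.Q π) ^ 2)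
      = fun z z' => (norm2 x ^ 2 + -(2 * β) * ∑ i, M.opFtilde π θ z z' i * x i)
        + β ^ 2 * d z z' ^ 2 := by
    funext z z'
    have e0 : d z z' ^ 2 = ∑ i, M.opFtilde π θ z z' i ^ 2 := by
      rw [Finset.sum_eq_single z (fun b _ hb => by simp [opFtilde, Pi.single_eq_of_ne hb])
        (by simp)]
      simp [opFtilde, hd]
    rw [e0, norm2_sq, norm2_sq, Finset.mul_sum, Finset.mul_sum, ← Finset.sum_add_distrib,
      ← Finset.sum_add_distrib]
    exact Finset.sum_congr rfl fun i _ => by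
      simp only [hx, Pi.sub_apply, Pi.smul_apply, smul_eq_mul]; ring
  -- The Bellman equation removes the running cost and splits the temporal difference into a part
  -- linear in the error and the fluctuation of `Q` around its conditional mean `m`. The variance of
  -- the latter is at most `B²`.
  have hvar : M.blockMean π α z₀ (fun z z' => d z z' ^ 2)
      ≤ 2 * (1 + M.γ) ^ 2 * norm2 x ^ 2 + 2 * k.B ^ 2 := by
    rw [← blockMean_const (M := M) hs α z₀ (2 * (1 + M.γ) ^ 2 * norm2 x ^ 2 + 2 * k.B ^ 2)]
    refine blockMean_mono hs α z₀ fun z => ?_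
    set m := ∑ z', M.pairMat π z z' * M.Q π z' with hm
    have hpt : ∀ z', d z z' ^ 2 ≤ 2 * (1 + M.γ) ^ 2 * norm2 x ^ 2
        + 2 * (M.Q π z' ^ 2 - 2 * m * M.Q π z' + m ^ 2) := by
      intro z'
      have h1 : d z z' = (x z - M.γ * x z') + M.γ * (m - M.Q π z') := by
        have := Q_eq (M := M) hs z
        simp only [hd, hx, Pi.sub_apply]
        rw [← hm] at this
        linarith
      have h2 : |x z - M.γ * x z'| ≤ (1 + M.γ) * norm2 x := by
        refine (abs_sub _ _).trans ?_
        rw [abs_mul, abs_of_pos hγ]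
        nlinarith [abs_apply_le_norm2 x z, abs_apply_le_norm2 x z']
      have h3 := sq_le_sq' (by linarith [(abs_le.1 h2).1]) (abs_le.1 h2).2
      have h4 : M.γ ^ 2 ≤ 1 := pow_le_one₀ hγ.le hγ1.le
      rw [h1]
      nlinarith [sq_nonneg ((x z - M.γ * x z') - M.γ * (m - M.Q π z')),
        mul_le_mul_of_nonneg_right h4 (sq_nonneg (m - M.Q π z'))]
    have hrow := Matrix.sum_row_of_mem_rowStochastic (pairMat_mem (M := M) hs) z
    have hQ : ∑ z', M.pairMat π z z' * M.Q π z' ^ 2 ≤ k.B ^ 2 := by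
      calc ∑ z', M.pairMat π z z' * M.Q π z' ^ 2 ≤ ∑ z', 1 * M.Q π z' ^ 2 :=
            Finset.sum_le_sum fun z' _ => mul_le_mul_of_nonneg_right
              (Matrix.le_one_of_mem_rowStochastic (pairMat_mem hs)) (sq_nonneg _)
        _ = norm2 (M.Q π) ^ 2 := by rw [norm2_sq]; simp
        _ ≤ k.B ^ 2 := pow_le_pow_left₀ (norm2_nonneg _) (hk.norm_le π hπ) 2
    have h5 := Finset.sum_le_sum (s := Finset.univ) fun z' _ =>
      mul_le_mul_of_nonneg_left (hpt z') ((pairMat_mem (M := M) hs).1 z z')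
    refine h5.trans ?_
    have e1 : ∑ z', M.pairMat π z z' * (2 * (1 + M.γ) ^ 2 * norm2 x ^ 2
        + 2 * (M.Q π z' ^ 2 - 2 * m * M.Q π z' + m ^ 2))
        = (2 * (1 + M.γ) ^ 2 * norm2 x ^ 2 + 2 * m ^ 2) * ∑ z', M.pairMat π z z'
          + 2 * ∑ z', M.pairMat π z z' * M.Q π z' ^ 2
          - 4 * m * ∑ z', M.pairMat π z z' * M.Q π z' := by
      simp only [Finset.mul_sum, ← Finset.sum_sub_distrib, ← Finset.sum_add_distrib]
      exact Finset.sum_congr rfl fun _ _ => by ring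
    rw [e1, ← hm, ← Finset.sum_mul, hrow]
    nlinarith [sq_nonneg m]
  have hb := (abs_le.1 (abs_bias_le hk hπ hs hα z₀ θ x)).2
  rw [← hx, ← sum_linF_mul] at hb
  have hmono := strong_monotone_linF hk hπ hs x
  have hn := norm2_nonneg x
  rw [e, blockMean_add, blockMean_add, blockMean_const hs, blockMean_const_mul,
    blockMean_const_mul]
  -- The mixing bias costs one ninth of the monotonicity. The remaining `16/9`, less `1/16` for the
  -- quadratic term, still exceeds `3/2`.
  have h6 : (k.lamMin - k.lamMin / 9) * norm2 x ^ 2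
      ≤ M.blockMean π α z₀ (fun z z' => ∑ i, M.opFtilde π θ z z' i * x i) := by
    nlinarith [mul_le_mul_of_nonneg_right hα2 (sq_nonneg (norm2 x))]
  have h7 := mul_le_mul_of_nonneg_left h6 hβ0
  have h8 := mul_le_mul_of_nonneg_left hvar (sq_nonneg β)
  have h9 := mul_le_mul_of_nonneg_right (mul_le_mul_of_nonneg_left hβ hβ0) (sq_nonneg (norm2 x))
  have h10 := mul_nonneg (mul_nonneg hβ0 hk.lamMin_pos.le) (sq_nonneg (norm2 x))
  nlinarith

end RegMDP

/-! ### Functions of finitely many coordinates of the trajectory. -/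

section Path

variable {S A : Type*} [Fintype S] [Fintype A] [DecidableEq S] [DecidableEq A]
  {Ω : Type*} {mΩ : MeasurableSpace Ω} {Pr : Measure Ω}
  {Z : ℕ → Ω → S × A} {n : ℕ}

lemma history_le (hZ : ∀ n, @Measurable Ω (S × A) _ ⊤ (Z n)) (n : ℕ) :
    RegMDP.history Z n ≤ mΩ :=
  iSup₂_le fun i _ => (hZ i).comap_le

/-- Such a function factors through a finite type, so it is measurable and bounded without any
further assumption. -/
lemma measurable_history_of_dependsOn {G : (ℕ → S × A) → ℝ} (hG : DependsOn G (Set.Iic n)) :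
    Measurable[RegMDP.history Z n] fun ω => G fun i => Z i ω := by
  let _ : MeasurableSpace (S × A) := ⊤
  have : DiscreteMeasurableSpace (S × A) := ⟨fun _ => trivial⟩
  obtain ⟨g, rfl⟩ := (dependsOn_iff_exists_comp).1 hG
  have hg : Measurable g := measurable_of_finite g
  refine @Measurable.comp Ω _ ℝ (RegMDP.history Z n) _ _ g _ hg
    (@measurable_pi_lambda _ _ _ (RegMDP.history Z n) _ _ fun i => ?_)
  refine Measurable.mono (comap_measurable (Z i.1)) ?_ le_rfl
  exact le_iSup₂_of_le (f := fun i (_ : i ∈ Finset.range (n + 1)) =>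
    MeasurableSpace.comap (Z i) ⊤) i.1
    (Finset.mem_range.2 (Nat.lt_succ_of_le i.2)) le_rfl

lemma exists_bound_of_dependsOn [Nonempty S] [Nonempty A] {G : (ℕ → S × A) → ℝ}
    (hG : DependsOn G (Set.Iic n)) : ∃ C, ∀ p, ‖G p‖ ≤ C := by
  obtain ⟨g, rfl⟩ := (dependsOn_iff_exists_comp).1 hG
  obtain ⟨m, hm⟩ := Finite.exists_max fun q => ‖g q‖
  exact ⟨‖g m‖, fun p => hm _⟩

variable [Nonempty S] [Nonempty A] [IsProbabilityMeasure Pr]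

lemma integrable_of_dependsOn (hZ : ∀ n, @Measurable Ω (S × A) _ ⊤ (Z n))
    {G : (ℕ → S × A) → ℝ} (hG : DependsOn G (Set.Iic n)) :
    Integrable (fun ω => G fun i => Z i ω) Pr := by
  obtain ⟨C, hC⟩ := exists_bound_of_dependsOn hG
  exact Integrable.of_bound
    ((measurable_history_of_dependsOn hG).mono (history_le hZ n) le_rfl).aestronglyMeasurable
    C (Filter.Eventually.of_forall fun ω => hC _)

/-- The Markov property integrated against a function of the past. -/
lemma integral_mul_indicator_eq (hZ : ∀ n, @Measurable Ω (S × A) _ ⊤ (Z n))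
    {G κ : (ℕ → S × A) → ℝ} (hG : DependsOn G (Set.Iic n)) {z : S × A}
    (hκ : Pr⟦Z (n + 1) ⁻¹' {z} | RegMDP.history Z n⟧ =ᵐ[Pr] fun ω => κ fun i => Z i ω) :
    ∫ ω, G (fun i => Z i ω) * (if Z (n + 1) ω = z then 1 else 0) ∂Pr
      = ∫ ω, G (fun i => Z i ω) * κ (fun i => Z i ω) ∂Pr := by
  obtain ⟨C, hC⟩ := exists_bound_of_dependsOn hG
  have hm := history_le hZ n
  have hset : MeasurableSet (Z (n + 1) ⁻¹' {z}) := hZ (n + 1) trivial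
  have hint : Integrable ((Z (n + 1) ⁻¹' {z}).indicator fun _ => (1 : ℝ)) Pr :=
    (integrable_const _).indicator hset
  have h1 := condExp_stronglyMeasurable_mul_of_bound hm (μ := Pr)
    (measurable_history_of_dependsOn (Z := Z) hG).stronglyMeasurable hint C
    (Filter.Eventually.of_forall fun ω => hC _)
  have h2 : ∀ ω, (if Z (n + 1) ω = z then (1 : ℝ) else 0)
      = (Z (n + 1) ⁻¹' {z}).indicator (fun _ => (1 : ℝ)) ω := fun ω => by
    by_cases hz : Z (n + 1) ω = z
    · rw [if_pos hz, Set.indicator_of_mem (by exact hz)]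
    · rw [if_neg hz, Set.indicator_of_notMem (by exact hz)]
  simp only [h2]
  calc ∫ ω, G (fun i => Z i ω) * (Z (n + 1) ⁻¹' {z}).indicator (fun _ => (1 : ℝ)) ω ∂Pr
      = ∫ ω, (Pr[(fun ω => G fun i => Z i ω) * (Z (n + 1) ⁻¹' {z}).indicator
          (fun _ => (1 : ℝ)) | RegMDP.history Z n]) ω ∂Pr := (integral_condExp hm).symm
    _ = _ := by
        refine integral_congr_ae ?_
        filter_upwards [h1, hκ] with ω hω1 hω2
        rw [hω1, Pi.mul_apply]
        congr 1

end Path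

/-! ### Integration along the trajectory, block by block. -/

namespace RegMDP

variable {S A : Type*} [Fintype S] [Fintype A] [DecidableEq S] [DecidableEq A]
  {M : RegMDP S A} {Ω : Type*} {mΩ : MeasurableSpace Ω} {Pr : Measure Ω}
  {Z : ℕ → Ω → S × A} {Φ : (ℕ → S × A) → Policy S A} {n₀ n₁ : ℕ}

/-- From time `n₀` to time `n₁` the trajectory `Z` follows the policy `Φ`, which is a function
of the trajectory up to time `n₀`. -/
structure Follows (M : RegMDP S A) {Ω : Type*} {mΩ : MeasurableSpace Ω} (Pr : Measure Ω)
    (Z : ℕ → Ω → S × A) (Φ : (ℕ → S × A) → Policy S A) (n₀ n₁ : ℕ) : Prop where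
  meas : ∀ n, @Measurable Ω (S × A) _ ⊤ (Z n)
  past : DependsOn Φ (Set.Iic n₀)
  markov : ∀ n, n₀ ≤ n → n < n₁ → ∀ z' : S × A, Pr⟦Z (n + 1) ⁻¹' {z'} | history Z n⟧ =ᵐ[Pr]
    fun ω => M.pairMat (Φ fun i => Z i ω) (Z n ω) z'

variable [Nonempty S] [Nonempty A] [IsProbabilityMeasure Pr]

/-- Splitting by the value of the next pair freezes the first argument of `G`. What remains is a
function of the past times an indicator, to which the Markov property applies. -/
lemma Follows.integral_step (h : M.Follows Pr Z Φ n₀ n₁) {n : ℕ} (h0 : n₀ ≤ n) (h1 : n < n₁)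
    {G : S × A → (ℕ → S × A) → ℝ} (hG : ∀ z, DependsOn (G z) (Set.Iic n)) :
    ∫ ω, G (Z (n + 1) ω) (fun i => Z i ω) ∂Pr
      = ∫ ω, ∑ z, M.pairMat (Φ fun i => Z i ω) (Z n ω) z * G z (fun i => Z i ω) ∂Pr := by
  have e1 : ∀ ω, G (Z (n + 1) ω) (fun i => Z i ω)
      = ∑ z, G z (fun i => Z i ω) * (if Z (n + 1) ω = z then 1 else 0) := fun ω => by simp
  have hd : ∀ z, DependsOn (fun p : ℕ → S × A => if p (n + 1) = z then (1 : ℝ) else 0)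
      (Set.Iic (n + 1)) := fun z p q hpq => by
    simp only [hpq (n + 1) (Set.mem_Iic.2 le_rfl)]
  have hK : ∀ z, DependsOn (fun p : ℕ → S × A => M.pairMat (Φ p) (p n) z) (Set.Iic n) :=
    fun z p q hpq => by
      simp only [hpq n (Set.mem_Iic.2 le_rfl), h.past fun i hi => hpq i (le_trans hi h0)]
  simp only [e1]
  rw [integral_finsetSum, integral_finsetSum]
  · refine Finset.sum_congr rfl fun z _ => ?_
    rw [integral_mul_indicator_eq (κ := fun p => M.pairMat (Φ p) (p n) z) h.meas (hG z)
      (h.markov n h0 h1 z)]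
    exact integral_congr_ae (Filter.Eventually.of_forall fun ω => mul_comm _ _)
  · intro z _
    exact integrable_of_dependsOn (n := n) (G := fun p => M.pairMat (Φ p) (p n) z * G z p) h.meas
      fun p q hpq => by simp only [hK z hpq, hG z hpq]
  · intro z _
    refine integrable_of_dependsOn (n := n + 1)
      (G := fun p => G z p * if p (n + 1) = z then (1 : ℝ) else 0) h.meas fun p q hpq => ?_
    simp only [hd z hpq, hG z fun i hi => hpq i (le_trans hi (Nat.le_succ n))]

/-- The last transition is integrated out first and absorbed into `G`. The policy is fixed at time
`n₀`, so the transition matrices multiply to a power. -/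
lemma Follows.integral_steps (h : M.Follows Pr Z Φ n₀ n₁) {n m : ℕ} (h0 : n₀ ≤ n)
    (h1 : n + m ≤ n₁) {G : S × A → (ℕ → S × A) → ℝ} (hG : ∀ z, DependsOn (G z) (Set.Iic n)) :
    ∫ ω, G (Z (n + m) ω) (fun i => Z i ω) ∂Pr
      = ∫ ω, ∑ z, (M.pairMat (Φ fun i => Z i ω) ^ m) (Z n ω) z * G z (fun i => Z i ω) ∂Pr := by
  induction m generalizing G with
  | zero => simp [Matrix.one_apply]
  | succ m ih =>
    rw [← add_assoc, h.integral_step (n := n + m) (by omega) (by omega)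
      (fun z p q hpq => hG z fun i hi => hpq i (le_trans hi (Nat.le_add_right n m)))]
    rw [ih (G := fun z p => ∑ z', M.pairMat (Φ p) z z' * G z' p) (by omega) (fun z p q hpq => by
      simp only [hG _ hpq, h.past fun i hi => hpq i (le_trans hi h0)])]
    refine integral_congr_ae (Filter.Eventually.of_forall fun ω => ?_)
    simp only [pow_succ, Matrix.mul_apply, Finset.sum_mul, Finset.mul_sum]
    rw [Finset.sum_comm]
    exact Finset.sum_congr rfl fun _ _ => Finset.sum_congr rfl fun _ _ => by ring

lemma Follows.integral_block (h : M.Follows Pr Z Φ n₀ n₁) {n α : ℕ} (hα : 1 ≤ α) (h0 : n₀ ≤ n)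
    (h1 : n + α ≤ n₁) {G : S × A → S × A → (ℕ → S × A) → ℝ}
    (hG : ∀ z z', DependsOn (G z z') (Set.Iic n)) :
    ∫ ω, G (Z (n + α - 1) ω) (Z (n + α) ω) (fun i => Z i ω) ∂Pr
      = ∫ ω, M.blockMean (Φ fun i => Z i ω) α (Z n ω) (fun z z' => G z z' fun i => Z i ω) ∂Pr := by
  obtain ⟨b, rfl⟩ := Nat.exists_eq_add_of_le' hα
  simp only [← add_assoc, Nat.add_sub_cancel]
  rw [h.integral_step (n := n + b) (G := fun z' p => G (p (n + b)) z' p) (by omega) (by omega)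
    (fun z p q hpq => by
      simp only [hpq (n + b) (Set.mem_Iic.2 le_rfl)]
      exact hG _ _ fun i hi => hpq i (le_trans hi (Nat.le_add_right n b)))]
  rw [h.integral_steps (n := n) (m := b)
    (G := fun z p => ∑ z', M.pairMat (Φ p) z z' * G z z' p) h0 (by omega) (fun z p q hpq => by
      simp only [hG _ _ hpq, h.past fun i hi => hpq i (le_trans hi h0)])]
  rfl

lemma ctd_congr (π : Policy S A) {α : ℕ} (β : ℕ → ℝ) (n₀ t : ℕ) {p q : ℕ → S × A}
    (h : ∀ i ≤ n₀ + t * α, p i = q i) : M.ctd π α β p n₀ t = M.ctd π α β q n₀ t := by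
  induction t with
  | zero => rfl
  | succ t ih =>
    have hle : t * α ≤ (t + 1) * α := Nat.mul_le_mul_right α (Nat.le_succ t)
    rw [ctd, ctd, ih fun i hi => h i (by omega), h _ le_rfl, h _ (Nat.sub_le _ _)]

lemma dependsOn_ctd (hΦ : DependsOn Φ (Set.Iic n₀)) (α : ℕ) (β : ℕ → ℝ) (t : ℕ) :
    DependsOn (fun p => M.ctd (Φ p) α β p n₀ t) (Set.Iic (n₀ + t * α)) := fun p q h => by
  simp only
  rw [hΦ fun i hi => h i (le_trans hi (Nat.le_add_right _ _)),
    ctd_congr _ _ _ _ fun i hi => h i hi]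

/-- The error of the conditional temporal difference iterate. -/
noncomputable def ctdErr (M : RegMDP S A) (Φ : (ℕ → S × A) → Policy S A) (α : ℕ) (β : ℕ → ℝ)
    (n₀ t : ℕ) (p : ℕ → S × A) : S × A → ℝ :=
  M.ctd (Φ p) α β p n₀ t - M.Q (Φ p)

lemma dependsOn_ctdErr (hΦ : DependsOn Φ (Set.Iic n₀)) (α : ℕ) (β : ℕ → ℝ) (t : ℕ) :
    DependsOn (M.ctdErr Φ α β n₀ t) (Set.Iic (n₀ + t * α)) := fun p q h => by
  have h1 := dependsOn_ctd (M := M) hΦ α β t h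
  simp only at h1
  rw [ctdErr, ctdErr, h1, hΦ fun i hi => h i (le_trans hi (Nat.le_add_right _ _))]

variable {Pol : Set (Policy S A)} {k : CTDConst}

/-- The block of step `t + 1` begins at time `n₀ + t α`, when the current iterate is already
determined. The estimate of the conditional mean can thus be integrated pathwise. -/
lemma Follows.integral_sq_step_le (h : M.Follows Pr Z Φ n₀ n₁) (hk : M.ValidConst Pol k)
    (hΦ : ∀ p, Φ p ∈ Pol) (hfeas : ∀ π ∈ Pol, M.Feasible π) {α : ℕ} (hα : 1 ≤ α)
    (hα2 : k.C * k.ρ ^ α ≤ k.lamMin / 9) {β : ℕ → ℝ} {t : ℕ} (hβ0 : 0 ≤ β (t + 1))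
    (hβ : 32 * (1 + M.γ) ^ 2 * β (t + 1) ≤ k.lamMin) (ht : n₀ + (t + 1) * α ≤ n₁) :
    ∫ ω, norm2 (M.ctdErr Φ α β n₀ (t + 1) fun i => Z i ω) ^ 2 ∂Pr
      ≤ (1 - 3 / 2 * (β (t + 1) * k.lamMin))
        * ∫ ω, norm2 (M.ctdErr Φ α β n₀ t fun i => Z i ω) ^ 2 ∂Pr
        + 2 * β (t + 1) ^ 2 * k.B ^ 2 := by
  have hadd : n₀ + (t + 1) * α = n₀ + t * α + α := by ring
  have hd := dependsOn_ctd (M := M) h.past α β t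
  have hd' := dependsOn_ctdErr (M := M) h.past α β t
  have hblock := h.integral_block (n := n₀ + t * α) hα (Nat.le_add_right _ _) (hadd ▸ ht)
    (G := fun z z' p => norm2 (M.ctd (Φ p) α β p n₀ t
      - β (t + 1) • M.opFtilde (Φ p) (M.ctd (Φ p) α β p n₀ t) z z' - M.Q (Φ p)) ^ 2)
    (fun z z' p q hpq => by
      have h1 := fun π => ctd_congr (M := M) (α := α) π β n₀ t hpq
      simp only [h1, h.past fun i hi => hpq i (le_trans hi (Nat.le_add_right _ _))])
  have e : ∀ ω, norm2 (M.ctdErr Φ α β n₀ (t + 1) fun i => Z i ω) ^ 2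
      = norm2 (M.ctd (Φ fun i => Z i ω) α β (fun i => Z i ω) n₀ t
        - β (t + 1) • M.opFtilde (Φ fun i => Z i ω)
          (M.ctd (Φ fun i => Z i ω) α β (fun i => Z i ω) n₀ t)
          (Z (n₀ + t * α + α - 1) ω) (Z (n₀ + t * α + α) ω) - M.Q (Φ fun i => Z i ω)) ^ 2 := by
    intro ω
    rw [ctdErr, ctd, hadd]
  simp only [e]
  rw [hblock]
  have hsq : DependsOn (fun p => norm2 (M.ctdErr Φ α β n₀ t p) ^ 2) (Set.Iic (n₀ + t * α)) :=
    fun p q hpq => by simp only [hd' hpq]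
  have hI := integrable_of_dependsOn (Pr := Pr) h.meas hsq
  rw [← integral_const_mul]
  calc _ ≤ ∫ ω, ((1 - 3 / 2 * (β (t + 1) * k.lamMin))
          * norm2 (M.ctdErr Φ α β n₀ t fun i => Z i ω) ^ 2 + 2 * β (t + 1) ^ 2 * k.B ^ 2) ∂Pr := by
        refine integral_mono ?_ ((hI.const_mul _).add (integrable_const _)) fun ω =>
          blockMean_sq_step_le hk (hΦ _) (hfeas _ (hΦ _)).simplex hα hα2 hβ0 hβ _ _
        refine integrable_of_dependsOn (n := n₀ + t * α) (G := fun p => M.blockMean (Φ p) α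
          (p (n₀ + t * α)) fun z z' => norm2 (M.ctd (Φ p) α β p n₀ t
          - β (t + 1) • M.opFtilde (Φ p) (M.ctd (Φ p) α β p n₀ t) z z' - M.Q (Φ p)) ^ 2) h.meas
          fun p q hpq => ?_
        have h1 := fun π => ctd_congr (M := M) (α := α) π β n₀ t hpq
        simp only [h1, h.past fun i hi => hpq i (le_trans hi (Nat.le_add_right _ _)),
          hpq (n₀ + t * α) (Set.mem_Iic.2 le_rfl)]
    _ = _ := by
        rw [integral_add (hI.const_mul _) (integrable_const _)]
        simp

/-- One step of the duality argument. The new test vector `V - β F* V` again depends only on the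
past up to `n₀`, so the estimate can be iterated, and the error norm enters only through its mean.
-/
lemma Follows.integral_inner_step_le (h : M.Follows Pr Z Φ n₀ n₁) (hk : M.ValidConst Pol k)
    (hΦ : ∀ p, Φ p ∈ Pol) (hfeas : ∀ π ∈ Pol, M.Feasible π) {α : ℕ} (hα : 1 ≤ α)
    {β : ℕ → ℝ} {t : ℕ} (hβ0 : 0 ≤ β (t + 1)) (ht : n₀ + (t + 1) * α ≤ n₁)
    {V : (ℕ → S × A) → S × A → ℝ} (hV : DependsOn V (Set.Iic n₀)) {c : ℝ}
    (hc : ∀ p, norm2 (V p) ≤ c) :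
    ∫ ω, ∑ i, (M.ctdErr Φ α β n₀ (t + 1) fun i => Z i ω) i * V (fun i => Z i ω) i ∂Pr
      ≤ ∫ ω, ∑ i, (M.ctdErr Φ α β n₀ t fun i => Z i ω) i
          * (V (fun i => Z i ω) - β (t + 1) • M.adjF (Φ fun i => Z i ω) (V fun i => Z i ω)) i ∂Pr
        + β (t + 1) * (k.C * k.ρ ^ α) * c
          * ∫ ω, norm2 (M.ctdErr Φ α β n₀ t fun i => Z i ω) ∂Pr := by
  have hadd : n₀ + (t + 1) * α = n₀ + t * α + α := by ring
  have hd := dependsOn_ctd (M := M) h.past α β t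
  have hd' := dependsOn_ctdErr (M := M) h.past α β t
  have hblock := h.integral_block (n := n₀ + t * α) hα (Nat.le_add_right _ _) (hadd ▸ ht)
    (G := fun z z' p => ∑ i, (M.ctd (Φ p) α β p n₀ t
      - β (t + 1) • M.opFtilde (Φ p) (M.ctd (Φ p) α β p n₀ t) z z' - M.Q (Φ p)) i * V p i)
    (fun z z' p q hpq => by
      have h1 := fun π => ctd_congr (M := M) (α := α) π β n₀ t hpq
      simp only [h1, h.past fun i hi => hpq i (le_trans hi (Nat.le_add_right _ _)),
        hV fun i hi => hpq i (le_trans hi (Nat.le_add_right _ _))])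
  have e : ∀ ω, ∑ i, (M.ctdErr Φ α β n₀ (t + 1) fun i => Z i ω) i * V (fun i => Z i ω) i
      = ∑ i, (M.ctd (Φ fun i => Z i ω) α β (fun i => Z i ω) n₀ t
        - β (t + 1) • M.opFtilde (Φ fun i => Z i ω)
          (M.ctd (Φ fun i => Z i ω) α β (fun i => Z i ω) n₀ t)
          (Z (n₀ + t * α + α - 1) ω) (Z (n₀ + t * α + α) ω) - M.Q (Φ fun i => Z i ω)) i
          * V (fun i => Z i ω) i := by
    intro ω
    rw [ctdErr, ctd, hadd]
  simp only [e]
  rw [hblock]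
  have hC := mul_nonneg hβ0 (mul_nonneg hk.C_pos.le (pow_nonneg hk.ρ_pos.le α))
  have hI1 : Integrable (fun ω => norm2 (M.ctdErr Φ α β n₀ t fun i => Z i ω)) Pr :=
    integrable_of_dependsOn (n := n₀ + t * α) (G := fun p => norm2 (M.ctdErr Φ α β n₀ t p)) h.meas
      fun p q hpq => by simp only [hd' hpq]
  have hI2 : Integrable (fun ω => ∑ i, (M.ctdErr Φ α β n₀ t fun i => Z i ω) i
      * (V (fun i => Z i ω) - β (t + 1) • M.adjF (Φ fun i => Z i ω) (V fun i => Z i ω)) i) Pr :=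
    integrable_of_dependsOn (n := n₀ + t * α) (G := fun p => ∑ i, M.ctdErr Φ α β n₀ t p i
      * (V p - β (t + 1) • M.adjF (Φ p) (V p)) i) h.meas
      fun p q hpq => by
        simp only [hd' hpq, h.past fun i hi => hpq i (le_trans hi (Nat.le_add_right _ _)),
        hV fun i hi => hpq i (le_trans hi (Nat.le_add_right _ _))]
  rw [← integral_const_mul, ← integral_add hI2 (hI1.const_mul _)]
  refine integral_mono ?_ (hI2.add (hI1.const_mul _)) fun ω => ?_
  · refine integrable_of_dependsOn (n := n₀ + t * α) (G := fun p => M.blockMean (Φ p) α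
      (p (n₀ + t * α)) fun z z' => ∑ i, (M.ctd (Φ p) α β p n₀ t
      - β (t + 1) • M.opFtilde (Φ p) (M.ctd (Φ p) α β p n₀ t) z z' - M.Q (Φ p)) i * V p i) h.meas
      fun p q hpq => ?_
    have h1 := fun π => ctd_congr (M := M) (α := α) π β n₀ t hpq
    simp only [h1, h.past fun i hi => hpq i (le_trans hi (Nat.le_add_right _ _)),
      hpq (n₀ + t * α) (Set.mem_Iic.2 le_rfl),
      hV fun i hi => hpq i (le_trans hi (Nat.le_add_right _ _))]
  · refine (blockMean_step_le hk (hΦ _) (hfeas _ (hΦ _)).simplex hα hβ0 _ _ _).trans ?_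
    simp only [ctdErr]
    refine add_le_add le_rfl ?_
    have := mul_le_mul_of_nonneg_left (hc fun i => Z i ω)
      (mul_nonneg hC (norm2_nonneg (M.ctdErr Φ α β n₀ t fun i => Z i ω)))
    rw [ctdErr] at this
    linarith

end RegMDP

/-! ### Scalar recursions for the error. -/

section Recursion

/-- With `τ = t + t₀`, the weight satisfies `τ (τ - 1) (1 - 3/τ) = (τ - 1) (τ - 3) ≤ (τ - 1) (τ -
2)`. The weighted sequence therefore grows by at most `D` per step. -/
lemma weighted_recursion_le {a : ℕ → ℝ} {t₀ D : ℝ} (ht₀ : 64 ≤ t₀) (hD : 0 ≤ D) {T : ℕ}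
    (ha : ∀ t, 0 ≤ a t)
    (h : ∀ t < T, a (t + 1) ≤ (1 - 3 / (t + t₀)) * a t + D / (t + t₀) ^ 2) :
    ∀ t ≤ T, (t + t₀ - 1) * (t + t₀ - 2) * a t ≤ (t₀ - 1) * (t₀ - 2) * a 0 + D * t := by
  intro t
  induction t with
  | zero => intro _; simp
  | succ t ih =>
    intro ht
    have h1 := ih (by omega)
    have h2 := h t (by omega)
    have hτ : (64 : ℝ) ≤ t + t₀ := by have : (0 : ℝ) ≤ t := by positivity
                                      linarith
    set τ : ℝ := t + t₀ with hτdef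
    have e : ((t + 1 : ℕ) : ℝ) + t₀ = τ + 1 := by push_cast; ring
    rw [e]
    have h3 : τ * (τ - 1) * a (t + 1) ≤ (τ - 1) * (τ - 3) * a t + D * ((τ - 1) / τ) := by
      have := mul_le_mul_of_nonneg_left h2 (by nlinarith : 0 ≤ τ * (τ - 1))
      refine this.trans (le_of_eq ?_)
      have : τ ≠ 0 := by linarith
      field_simp
    have h4 : (τ - 1) / τ ≤ 1 := by rw [div_le_one (by linarith)]; linarith
    have h5 := mul_le_mul_of_nonneg_left h4 hD
    have h6 : (τ - 1) * (τ - 3) * a t ≤ (τ - 1) * (τ - 2) * a t :=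
      mul_le_mul_of_nonneg_right (by nlinarith) (ha t)
    push_cast
    calc (τ + 1 - 1) * (τ + 1 - 2) * a (t + 1) = τ * (τ - 1) * a (t + 1) := by ring
      _ ≤ _ := by linarith

/-- The level `R` is invariant, since `D ≤ 3 t₀ R ≤ 3 τ R` makes the noise at most the contraction
`(3/τ) R`. -/
lemma bounded_recursion_le {a : ℕ → ℝ} {t₀ D R : ℝ} (ht₀ : 64 ≤ t₀) (hR : D ≤ 3 * t₀ * R)
    (hR0 : 0 ≤ R) {T : ℕ} (h0 : a 0 ≤ R)
    (h : ∀ t < T, a (t + 1) ≤ (1 - 3 / (t + t₀)) * a t + D / (t + t₀) ^ 2) :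
    ∀ t ≤ T, a t ≤ R := by
  intro t
  induction t with
  | zero => intro _; exact h0
  | succ t ih =>
    intro ht
    have h1 := ih (by omega)
    refine (h t (by omega)).trans ?_
    have hτ : t₀ ≤ t + t₀ := by have : (0 : ℝ) ≤ t := by positivity
                                linarith
    set τ : ℝ := t + t₀
    have h2 : 3 / τ ≤ 1 := by rw [div_le_one (by linarith)]; linarith
    have h3 : D / τ ^ 2 ≤ 3 / τ * R := by
      rw [div_mul_eq_mul_div, div_le_div_iff₀ (by nlinarith) (by linarith)]
      nlinarith [mul_le_mul_of_nonneg_right hτ hR0]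
    nlinarith [mul_le_mul_of_nonneg_left h1 (by linarith : 0 ≤ 1 - 3 / τ)]

/-- The decay factor `∏_{i < t} √(1 - 3 / (i + t₀))`. -/
noncomputable def decay (t₀ : ℝ) : ℕ → ℝ
  | 0 => 1
  | t + 1 => √(1 - 3 / (t + t₀)) * decay t₀ t

lemma decay_nonneg (t₀ : ℝ) (t : ℕ) : 0 ≤ decay t₀ t := by
  induction t with
  | zero => exact zero_le_one
  | succ t ih => exact mul_nonneg (Real.sqrt_nonneg _) ih

/-- The product of `(τ - 3) / τ` telescopes to a quotient of three consecutive factors. Thus `decay`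
is of order `(t₀ / t)^(3/2)`. -/
lemma decay_sq {t₀ : ℝ} (ht₀ : 64 ≤ t₀) (t : ℕ) :
    decay t₀ t ^ 2 * ((t + t₀ - 1) * (t + t₀ - 2) * (t + t₀ - 3))
      = (t₀ - 1) * (t₀ - 2) * (t₀ - 3) := by
  induction t with
  | zero => simp [decay]
  | succ t ih =>
    have hτ : (64 : ℝ) ≤ t + t₀ := by have : (0 : ℝ) ≤ t := by positivity
                                      linarith
    rw [← ih, decay, mul_pow, Real.sq_sqrt (by
      rw [sub_nonneg, div_le_one (by linarith)]; linarith)]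
    push_cast
    have : (t : ℝ) + t₀ ≠ 0 := by linarith
    field_simp
    ring

lemma decay_sq_mul_le {t₀ : ℝ} (ht₀ : 64 ≤ t₀) (t : ℕ) : decay t₀ t ^ 2 * t ^ 3 ≤ t₀ ^ 3 := by
  have ht : (0 : ℝ) ≤ t := by positivity
  calc decay t₀ t ^ 2 * t ^ 3
      ≤ decay t₀ t ^ 2 * ((t + t₀ - 1) * (t + t₀ - 2) * (t + t₀ - 3)) := by
        refine mul_le_mul_of_nonneg_left ?_ (sq_nonneg _)
        calc (t : ℝ) ^ 3 = t * t * t := by ring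
          _ ≤ _ := by
              refine mul_le_mul (mul_le_mul ?_ ?_ ht ?_) ?_ ht (mul_nonneg ?_ ?_) <;> linarith
    _ = (t₀ - 1) * (t₀ - 2) * (t₀ - 3) := decay_sq ht₀ t
    _ ≤ t₀ * t₀ * t₀ := by
        refine mul_le_mul (mul_le_mul ?_ ?_ ?_ ?_) ?_ ?_ (mul_nonneg ?_ ?_) <;> linarith
    _ = _ := by ring

lemma sqrt_one_sub_le {u : ℝ} (h1 : u ≤ 1) : √(1 - u) ≤ 1 - u / 2 := by
  rw [Real.sqrt_le_left (by linarith)]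
  nlinarith [sq_nonneg u]

lemma sq_integral_le {Ω : Type*} {mΩ : MeasurableSpace Ω} {Pr : Measure Ω}
    [IsProbabilityMeasure Pr] {X : Ω → ℝ} (h1 : Integrable X Pr)
    (h2 : Integrable (fun ω => X ω ^ 2) Pr) : (∫ ω, X ω ∂Pr) ^ 2 ≤ ∫ ω, X ω ^ 2 ∂Pr := by
  set m := ∫ ω, X ω ∂Pr with hm
  have h0 : 0 ≤ ∫ ω, (X ω - m) ^ 2 ∂Pr := integral_nonneg fun _ => sq_nonneg _
  have e : ∀ ω, (X ω - m) ^ 2 = X ω ^ 2 - 2 * m * X ω + m ^ 2 := fun ω => by ring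
  have h3 : Integrable (fun ω => X ω ^ 2 - 2 * m * X ω) Pr := h2.sub (h1.const_mul _)
  simp only [e] at h0
  rw [integral_add h3 (integrable_const _), integral_sub h2 (h1.const_mul _),
    integral_const_mul, ← hm] at h0
  simp only [integral_const, probReal_univ, one_smul] at h0
  nlinarith

end Recursion

/-! ### Variance and bias of conditional temporal difference. -/

namespace RegMDP

variable {S A : Type*} [Fintype S] [Fintype A] [DecidableEq S] [DecidableEq A]
  [Nonempty S] [Nonempty A]
  {M : RegMDP S A} {Ω : Type*} {mΩ : MeasurableSpace Ω} {Pr : Measure Ω} [IsProbabilityMeasure Pr]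
  {Z : ℕ → Ω → S × A} {Φ : (ℕ → S × A) → Policy S A} {n₀ n₁ : ℕ}
  {Pol : Set (Policy S A)} {k : CTDConst} {cbar hbar : ℝ} {π : Policy S A}

lemma le_tZero_mul (hk : M.ValidConst Pol k) :
    64 * (1 + M.γ) ^ 2 ≤ M.tZero k * k.lamMin ^ 2 := by
  have := hk.lamMin_pos
  rw [tZero, div_mul_cancel₀ _ (by positivity)]
  have := le_max_right (k.lamMax ^ 2) (8 * (1 + M.γ) ^ 2)
  linarith

lemma ValidConst.lamMin_le_one (hk : M.ValidConst Pol k) (hπ : π ∈ Pol)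
    (hs : ∀ s, π s ∈ stdSimplex ℝ A) : k.lamMin ≤ 1 := by
  have h := hk.lamMin_le_pairDist hπ (Classical.arbitrary (S × A))
  have h1 := stdSimplex_apply_le_one (pairDist_mem (M := M) hs) (Classical.arbitrary (S × A))
  have h0 := (pairDist_mem (M := M) hs).1 (Classical.arbitrary (S × A))
  nlinarith [M.γ_pos, M.γ_lt_one]

lemma le_tZero (hk : M.ValidConst Pol k) (hπ : π ∈ Pol)
    (hs : ∀ s, π s ∈ stdSimplex ℝ A) : 64 ≤ M.tZero k := by
  have h1 := le_tZero_mul hk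
  have h2 := hk.lamMin_le_one hπ hs
  have h3 := hk.lamMin_pos
  have h4 : k.lamMin ^ 2 ≤ 1 := pow_le_one₀ h3.le h2
  have h5 : 0 ≤ M.tZero k := by unfold tZero; positivity
  nlinarith [M.γ_pos, mul_le_mul_of_nonneg_left h4 h5]

lemma stepSize_succ (t : ℕ) : M.stepSize k (t + 1) = 2 / (k.lamMin * (t + M.tZero k)) := by
  rw [stepSize]; push_cast; congr 2; ring

lemma stepSize_nonneg (hk : M.ValidConst Pol k) (hπ : π ∈ Pol)
    (hs : ∀ s, π s ∈ stdSimplex ℝ A) (t : ℕ) : 0 ≤ M.stepSize k (t + 1) := by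
  rw [stepSize_succ]
  have := le_tZero hk hπ hs
  have := hk.lamMin_pos
  positivity

lemma stepSize_mul (hk : M.ValidConst Pol k) (hπ : π ∈ Pol)
    (hs : ∀ s, π s ∈ stdSimplex ℝ A) (t : ℕ) :
    3 / 2 * (M.stepSize k (t + 1) * k.lamMin) = 3 / (t + M.tZero k) := by
  rw [stepSize_succ]
  have h1 := le_tZero hk hπ hs
  have h2 := hk.lamMin_pos
  have : (t : ℝ) + M.tZero k ≠ 0 := by positivity
  field_simp

lemma stepSize_le (hk : M.ValidConst Pol k) (hπ : π ∈ Pol)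
    (hs : ∀ s, π s ∈ stdSimplex ℝ A) (t : ℕ) :
    32 * (1 + M.γ) ^ 2 * M.stepSize k (t + 1) ≤ k.lamMin := by
  have h1 := le_tZero hk hπ hs
  have h2 := hk.lamMin_pos
  have h3 := le_tZero_mul hk
  have ht : (0 : ℝ) ≤ t := by positivity
  rw [stepSize_succ, mul_div_assoc', div_le_iff₀ (by positivity)]
  nlinarith [mul_nonneg ht (sq_nonneg k.lamMin)]

lemma Follows.integral_norm2_ctdErr_le (h : M.Follows Pr Z Φ n₀ n₁) {α : ℕ} {β : ℕ → ℝ} {t : ℕ}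
    {R : ℝ} (hR : ∫ ω, norm2 (M.ctdErr Φ α β n₀ t fun i => Z i ω) ^ 2 ∂Pr ≤ R) :
    ∫ ω, norm2 (M.ctdErr Φ α β n₀ t fun i => Z i ω) ∂Pr ≤ √R := by
  have hd' := dependsOn_ctdErr (M := M) h.past α β t
  have hI1 : Integrable (fun ω => norm2 (M.ctdErr Φ α β n₀ t fun i => Z i ω)) Pr :=
    integrable_of_dependsOn (n := n₀ + t * α) (G := fun p => norm2 (M.ctdErr Φ α β n₀ t p)) h.meas
      fun p q hpq => by simp only [hd' hpq]
  have hI2 : Integrable (fun ω => norm2 (M.ctdErr Φ α β n₀ t fun i => Z i ω) ^ 2) Pr :=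
    integrable_of_dependsOn (n := n₀ + t * α) (G := fun p => norm2 (M.ctdErr Φ α β n₀ t p) ^ 2)
      h.meas fun p q hpq => by simp only [hd' hpq]
  exact Real.le_sqrt_of_sq_le ((sq_integral_le hI1 hI2).trans hR)

/-- The mean squared error of conditional temporal difference. -/
lemma Follows.sq_recursion (h : M.Follows Pr Z Φ n₀ n₁) (hk : M.ValidConst Pol k)
    (hΦ : ∀ p, Φ p ∈ Pol) (hfeas : ∀ π ∈ Pol, M.Feasible π) {α : ℕ} (hα : 1 ≤ α)
    (hα2 : k.C * k.ρ ^ α ≤ k.lamMin / 9) {T : ℕ} (hT : n₀ + T * α ≤ n₁) :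
    ∀ t < T, ∫ ω, norm2 (M.ctdErr Φ α (M.stepSize k) n₀ (t + 1) fun i => Z i ω) ^ 2 ∂Pr
      ≤ (1 - 3 / (t + M.tZero k))
        * ∫ ω, norm2 (M.ctdErr Φ α (M.stepSize k) n₀ t fun i => Z i ω) ^ 2 ∂Pr
        + 8 * k.B ^ 2 / k.lamMin ^ 2 / (t + M.tZero k) ^ 2 := by
  intro t ht
  have hp := hΦ fun _ => Classical.arbitrary _
  have hs := (hfeas _ hp).simplex
  have h1 := h.integral_sq_step_le hk hΦ hfeas hα hα2 (stepSize_nonneg hk hp hs t)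
    (stepSize_le hk hp hs t)
    (le_trans (Nat.add_le_add_left (Nat.mul_le_mul_right α ht) n₀) hT)
  rw [stepSize_mul hk hp hs] at h1
  refine h1.trans (le_of_eq ?_)
  congr 1
  rw [stepSize_succ]
  have h2 := le_tZero hk hp hs
  have h3 := hk.lamMin_pos
  have : (t : ℝ) + M.tZero k ≠ 0 := by positivity
  field_simp
  ring

lemma ctdErr_zero_sq_le {b : ℝ} (α : ℕ) (β : ℕ → ℝ) (p : ℕ → S × A)
    (h : norm2 (M.Q (Φ p)) ≤ b) : norm2 (M.ctdErr Φ α β n₀ 0 p) ≤ b := by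
  rw [ctdErr, ctd, zero_sub, norm2_neg]
  exact h

/-- The bias of conditional temporal difference. -/
lemma Follows.integral_inner_le (h : M.Follows Pr Z Φ n₀ n₁) (hk : M.ValidConst Pol k)
    (hΦ : ∀ p, Φ p ∈ Pol) (hfeas : ∀ π ∈ Pol, M.Feasible π) {α : ℕ} (hα : 1 ≤ α)
    {T : ℕ} (hT : n₀ + T * α ≤ n₁) {R b : ℝ} (hR0 : 0 ≤ R) (hb : ∀ π ∈ Pol, norm2 (M.Q π) ≤ b)
    (hR : ∀ t ≤ T, ∫ ω, norm2 (M.ctdErr Φ α (M.stepSize k) n₀ t fun i => Z i ω) ∂Pr ≤ R) :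
    ∀ t ≤ T, ∀ (V : (ℕ → S × A) → S × A → ℝ) (c : ℝ), DependsOn V (Set.Iic n₀) →
      (∀ p, norm2 (V p) ≤ c) →
      ∫ ω, ∑ i, (M.ctdErr Φ α (M.stepSize k) n₀ t fun i => Z i ω) i * V (fun i => Z i ω) i ∂Pr
        ≤ c * (decay (M.tZero k) t * b + 4 / 3 * (k.C * k.ρ ^ α * R / k.lamMin)) := by
  have hp := hΦ fun _ => Classical.arbitrary _
  have hs := (hfeas _ hp).simplex
  have ht0 := le_tZero hk hp hs
  have hΛ := hk.lamMin_pos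
  have hC := mul_nonneg hk.C_pos.le (pow_nonneg hk.ρ_pos.le α)
  have hb0 : 0 ≤ b := (norm2_nonneg _).trans (hb _ hp)
  have hr : 0 ≤ k.C * k.ρ ^ α * R / k.lamMin := by positivity
  intro t
  -- The test vector and its bound stay universally quantified, because each step replaces `V` by `V
  -- - β F* V` and `c` by `√(1 - 3/τ) c`.
  induction t with
  | zero =>
    intro _ V c hV hc
    have hc0 : 0 ≤ c := (norm2_nonneg _).trans (hc fun _ => Classical.arbitrary _)
    have hpt : ∀ p, ∑ i, (M.ctdErr Φ α (M.stepSize k) n₀ 0 p) i * V p i ≤ c * b := fun p =>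
      (sum_mul_le_norm2 _ _).trans (by
        rw [mul_comm c]
        exact mul_le_mul (ctdErr_zero_sq_le α _ p (hb _ (hΦ p))) (hc p) (norm2_nonneg _) hb0)
    calc _ ≤ ∫ _ω, c * b ∂Pr := by
          refine integral_mono ?_ (integrable_const _) fun ω => hpt _
          refine integrable_of_dependsOn (n := n₀) (G := fun p => ∑ i,
            (M.ctdErr Φ α (M.stepSize k) n₀ 0 p) i * V p i) h.meas fun p q hpq => ?_
          have := dependsOn_ctdErr (M := M) h.past α (M.stepSize k) 0
          rw [zero_mul, add_zero] at this
          simp only [this hpq, hV hpq]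
      _ = c * b := by simp
      _ ≤ _ := by
          refine mul_le_mul_of_nonneg_left ?_ hc0
          simp only [decay, one_mul]
          linarith
  | succ t ih =>
    intro ht V c hV hc
    have hc0 : 0 ≤ c := (norm2_nonneg _).trans (hc fun _ => Classical.arbitrary _)
    have hβ0 := stepSize_nonneg hk hp hs t
    have hstep := h.integral_inner_step_le hk hΦ hfeas hα (β := M.stepSize k) hβ0
      (le_trans (Nat.add_le_add_left (Nat.mul_le_mul_right α ht) n₀) hT) hV hc
    have hτ : 64 ≤ (t : ℝ) + M.tZero k := by
      have : (0 : ℝ) ≤ t := by positivity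
      linarith
    set τ : ℝ := t + M.tZero k with hτdef
    have h3τ : 3 / τ ≤ 1 := by rw [div_le_one (by linarith)]; linarith
    have ihV := ih (by omega)
      (fun p => V p - M.stepSize k (t + 1) • M.adjF (Φ p) (V p)) (√(1 - 3 / τ) * c)
      (fun p q hpq => by simp only [hV hpq, h.past hpq])
      (fun p => by
        refine Real.le_sqrt_of_sq_le (norm2_sub_adjF_sq_le hk (hΦ p) (hfeas _ (hΦ p)).simplex
          hβ0 (stepSize_le hk hp hs t) (V p)) |>.trans ?_
        rw [stepSize_mul hk hp hs, Real.sqrt_mul (by linarith), Real.sqrt_sq (norm2_nonneg _)]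
        exact mul_le_mul_of_nonneg_left (hc p) (Real.sqrt_nonneg _))
    have hRt := hR t (by omega)
    have hβ : M.stepSize k (t + 1) * (k.C * k.ρ ^ α) * c * R
        = c * (2 / τ * (k.C * k.ρ ^ α * R / k.lamMin)) := by
      rw [stepSize_succ, ← hτdef]
      have : τ ≠ 0 := by linarith
      field_simp
    have h4 := mul_le_mul_of_nonneg_left hRt
      (mul_nonneg (mul_nonneg hβ0 hC) hc0)
    rw [hβ] at h4
    set r := k.C * k.ρ ^ α * R / k.lamMin
    refine hstep.trans ((add_le_add ihV h4).trans ?_)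
    rw [decay, ← hτdef]
    -- The constant `4/3` is the fixed point of the bias: `(1 - 3/(2τ)) (4/3) r + (2/τ) r = (4/3)
    -- r`.
    have h5 := sqrt_one_sub_le h3τ
    have h6 := mul_le_mul_of_nonneg_right h5 (mul_nonneg hc0 hr)
    have e : 2 / τ = 2 / 3 * (3 / τ) := by ring
    rw [e]
    nlinarith

end RegMDP

/-! ### The epoch recursion. -/

section Sequences

lemma pow_le_of_logb_le {ρ y : ℝ} (hρ0 : 0 < ρ) (hρ1 : ρ < 1) (hy : 0 < y) {α : ℕ}
    (h : Real.logb ρ y ≤ α) : ρ ^ α ≤ y := by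
  rw [← Real.rpow_natCast]
  calc ρ ^ (α : ℝ) ≤ ρ ^ Real.logb ρ y := Real.rpow_le_rpow_of_exponent_ge hρ0 hρ1.le h
    _ = y := Real.rpow_logb hρ0 hρ1.ne hy

/-- Linear decay, by a factor two in each epoch of length `l`, of a perturbed contraction. -/
lemma epoch_recursion_le {X : ℕ → ℝ} {γ Δ : ℝ} (h0 : 0 ≤ γ) (h1 : γ ≤ 1) (hΔ : 0 ≤ Δ) {l : ℕ}
    (hl : γ ^ l ≤ 1 / 4) (hX0 : X 0 ≤ Δ)
    (h : ∀ j, X (j + 1) ≤ γ * X j + (1 - γ) * (Δ / 4) * (1 / 2) ^ (j / l)) (j : ℕ) :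
    X j ≤ (1 / 2) ^ (j / l) * Δ := by
  have hl0 : 0 < l := by
    rcases Nat.eq_zero_or_pos l with rfl | hl0
    · norm_num at hl
    · exact hl0
  -- Within an epoch the perturbation is constant, so the affine recursion is solved exactly. Its
  -- fixed point is one quarter of the initial level.
  have inner : ∀ q, X (l * q) ≤ (1 / 2) ^ q * Δ → ∀ i ≤ l,
      X (l * q + i) ≤ (1 / 2) ^ q * Δ * (γ ^ i + (1 - γ ^ i) / 4) := by
    intro q hq i
    induction i with
    | zero => intro _; simpa using hq
    | succ i ih =>
      intro hi
      have h2 := h (l * q + i)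
      have e : (l * q + i) / l = q := by
        rw [Nat.mul_add_div hl0, Nat.div_eq_of_lt (by omega), add_zero]
      rw [e] at h2
      refine h2.trans ?_
      have h3 := mul_le_mul_of_nonneg_left (ih (by omega)) h0
      refine (add_le_add h3 le_rfl).trans (le_of_eq ?_)
      ring
  have outer : ∀ q, X (l * q) ≤ (1 / 2) ^ q * Δ := by
    intro q
    induction q with
    | zero => simpa using hX0
    | succ q ih =>
      refine (inner q ih l le_rfl).trans ?_
      have h2 : 0 ≤ (1 / 2 : ℝ) ^ q * Δ := by positivity
      rw [pow_succ]
      -- With `γ ^ l ≤ 1/4` the factor is at most `1/4 + 3/16 = 7/16`.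
      nlinarith [mul_le_mul_of_nonneg_left hl h2]
  have h3 := inner (j / l) (outer _) (j % l) (Nat.mod_lt j hl0).le
  rw [Nat.div_add_mod] at h3
  refine h3.trans (mul_le_of_le_one_right (by positivity) ?_)
  have : γ ^ (j % l) ≤ 1 := pow_le_one₀ h0 h1
  linarith

end Sequences

/-! ### Accuracy of the evaluation in one iteration. -/

namespace RegMDP

variable {S A : Type*} [Fintype S] [Fintype A] [DecidableEq S] [DecidableEq A]
  [Nonempty S] [Nonempty A]
  {M : RegMDP S A} {Ω : Type*} {mΩ : MeasurableSpace Ω} {Pr : Measure Ω} [IsProbabilityMeasure Pr]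
  {Z : ℕ → Ω → S × A} {Φ : (ℕ → S × A) → Policy S A} {n₀ n₁ : ℕ}
  {Pol : Set (Policy S A)} {k : CTDConst} {cbar hbar : ℝ} {π : Policy S A}

lemma logb_quarter_pos (M : RegMDP S A) : 0 < Real.logb M.γ (1 / 4) :=
  Real.logb_pos_of_base_lt_one M.γ_pos M.γ_lt_one (by norm_num) (by norm_num)

lemma epochLen_pos (M : RegMDP S A) : 0 < M.epochLen := Nat.ceil_pos.2 M.logb_quarter_pos

lemma pow_epochLen_le (M : RegMDP S A) : M.γ ^ M.epochLen ≤ 1 / 4 :=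
  pow_le_of_logb_le M.γ_pos M.γ_lt_one (by norm_num) (Nat.le_ceil _)

lemma Rsq_nonneg : 0 ≤ M.Rsq cbar hbar k := by unfold Rsq; positivity

lemma sq_B_le_Rsq : k.B ^ 2 ≤ M.Rsq cbar hbar k := by
  have : 0 ≤ 3 * (k.B ^ 2 + 2 * (cbar + hbar) ^ 2) / (4 * (1 + M.γ) ^ 2) := by positivity
  unfold Rsq
  nlinarith [sq_nonneg k.B]

lemma sq_B_le_sigmaFsq : k.B ^ 2 ≤ M.sigmaFsq cbar hbar k := by
  have := mul_nonneg (by positivity : 0 ≤ 4 * (1 + M.γ) ^ 2)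
    (Rsq_nonneg (M := M) (cbar := cbar) (hbar := hbar) (k := k))
  unfold sigmaFsq
  nlinarith [sq_nonneg (cbar + hbar)]

lemma one_le_skip (j : ℕ) : 1 ≤ M.skip cbar hbar k j := le_max_left _ _

lemma pow_skip_le (hk : M.ValidConst Pol k) (j : ℕ) :
    k.C * k.ρ ^ M.skip cbar hbar k j ≤ k.lamMin / 9 := by
  have h : Real.logb k.ρ (k.lamMin / (9 * k.C)) ≤ M.skip cbar hbar k j :=
    ((le_max_right _ _).trans (Nat.le_ceil _)).trans (Nat.cast_le.2 (le_max_right _ _))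
  have hC := hk.C_pos
  have hΛ := hk.lamMin_pos
  have := mul_le_mul_of_nonneg_left
    (pow_le_of_logb_le hk.ρ_pos hk.ρ_lt_one (by positivity) h) hC.le
  refine this.trans (le_of_eq ?_)
  field_simp

lemma pow_skip_le_sq (hk : M.ValidConst Pol k) (hR : 0 < M.Rsq cbar hbar k) (j : ℕ) :
    k.C * k.ρ ^ M.skip cbar hbar k j * M.Rsq cbar hbar k
      ≤ k.lamMin / 24 / (2 ^ (j / M.epochLen + 2)) ^ 2 := by
  have hC := hk.C_pos
  have hΛ := hk.lamMin_pos
  have h : 2 * ((j / M.epochLen : ℕ) + 2 : ℝ) * Real.logb k.ρ (1 / 2)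
      + Real.logb k.ρ (k.lamMin / (24 * k.C * M.Rsq cbar hbar k)) ≤ M.skip cbar hbar k j :=
    (((le_max_left _ _).trans (le_max_left _ _)).trans (Nat.le_ceil _)).trans
      (Nat.cast_le.2 (le_max_right _ _))
  set q := j / M.epochLen
  have e : 2 * ((q : ℕ) + 2 : ℝ) * Real.logb k.ρ (1 / 2)
      + Real.logb k.ρ (k.lamMin / (24 * k.C * M.Rsq cbar hbar k))
      = Real.logb k.ρ ((1 / 2) ^ (2 * (q + 2)) * (k.lamMin / (24 * k.C * M.Rsq cbar hbar k))) := by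
    rw [Real.logb_mul (by positivity) (by positivity), Real.logb_pow]
    push_cast
    ring
  rw [e] at h
  have h2 := mul_le_mul_of_nonneg_left
    (pow_le_of_logb_le hk.ρ_pos hk.ρ_lt_one (by positivity) h) (mul_pos hC hR).le
  calc _ = k.C * M.Rsq cbar hbar k * k.ρ ^ M.skip cbar hbar k j := by ring
    _ ≤ _ := h2
    _ = _ := by
        rw [← pow_mul, mul_comm (q + 2) 2, one_div, inv_pow]
        field_simp

/-- The square of `y √R²`, with `y = C ρ^α`, is `y · (y R²)`. The bounds `lamMin / 9` and `lamMin /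
(24 N²)` for the two factors multiply to `lamMin² / (216 N²)`, and `√216 ≥ 40/3`. -/
lemma bias_const_le (hk : M.ValidConst Pol k) (j : ℕ) :
    4 / 3 * (k.C * k.ρ ^ M.skip cbar hbar k j * √(M.Rsq cbar hbar k) / k.lamMin)
      ≤ 1 / 10 / 2 ^ (j / M.epochLen + 2) := by
  have hC := hk.C_pos
  have hΛ := hk.lamMin_pos
  rcases (Rsq_nonneg (M := M) (cbar := cbar) (hbar := hbar) (k := k)).eq_or_lt with hR | hR
  · rw [← hR, Real.sqrt_zero, mul_zero, zero_div, mul_zero]; positivity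
  have h1 := pow_skip_le (cbar := cbar) (hbar := hbar) hk j
  have h2 := pow_skip_le_sq hk hR j
  set N : ℝ := 2 ^ (j / M.epochLen + 2)
  have hN : 0 < N := by positivity
  set y := k.C * k.ρ ^ M.skip cbar hbar k j with hy
  have hy0 : 0 ≤ y := by have := hk.ρ_pos; positivity
  have h3 : (y * √(M.Rsq cbar hbar k)) ^ 2 ≤ k.lamMin ^ 2 / 216 / N ^ 2 := by
    rw [mul_pow, Real.sq_sqrt hR.le]
    calc y ^ 2 * M.Rsq cbar hbar k = y * (y * M.Rsq cbar hbar k) := by ring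
      _ ≤ k.lamMin / 9 * (k.lamMin / 24 / N ^ 2) := mul_le_mul h1 h2 (by positivity) (by positivity)
      _ = _ := by ring
  have h4 : y * √(M.Rsq cbar hbar k) ≤ 3 / 40 * k.lamMin / N := by
    refine le_of_sq_le_sq (h3.trans ?_) (by positivity)
    rw [div_pow, mul_pow]
    gcongr
    nlinarith [sq_nonneg k.lamMin]
  calc _ ≤ 4 / 3 * (3 / 40 * k.lamMin / N / k.lamMin) := by gcongr
    _ = _ := by field_simp; norm_num

lemma thetaBar_nonneg (hc : ∀ s a, |M.c s a| ≤ cbar)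
    (hh : ∀ s, ∀ p ∈ M.dom s, |M.h s p| ≤ hbar) (hπ : M.Feasible π) : 0 ≤ M.thetaBar cbar hbar :=
  (norm2_nonneg _).trans (norm2_Q_le hc hh hπ)

/-- Conditional temporal difference reaches the accuracy which the iteration `j` needs. -/
lemma Follows.ctd_accuracy (hc : ∀ s a, |M.c s a| ≤ cbar)
    (hh : ∀ s, ∀ p ∈ M.dom s, |M.h s p| ≤ hbar) (j : ℕ) (h : M.Follows Pr Z Φ n₀ n₁) (hk : M.ValidConst Pol k)
    (hΦ : ∀ p, Φ p ∈ Pol) (hfeas : ∀ π ∈ Pol, M.Feasible π)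
    (hT : n₀ + M.numSteps cbar hbar k j * M.skip cbar hbar k j ≤ n₁) :
    ∫ ω, norm2 (M.ctdErr Φ (M.skip cbar hbar k j) (M.stepSize k) n₀
        (M.numSteps cbar hbar k j) fun i => Z i ω) ^ 2 ∂Pr
        ≤ 7 / 12 / 2 ^ (j / M.epochLen + 2) ∧
    ∀ (V : (ℕ → S × A) → S × A → ℝ) (c : ℝ), DependsOn V (Set.Iic n₀) →
      (∀ p, norm2 (V p) ≤ c) →
      ∫ ω, ∑ i, (M.ctdErr Φ (M.skip cbar hbar k j) (M.stepSize k) n₀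
        (M.numSteps cbar hbar k j) fun i => Z i ω) i * V (fun i => Z i ω) i ∂Pr
        ≤ c * (13 / 30 / 2 ^ (j / M.epochLen + 2)) := by
  have hp := hΦ fun _ => Classical.arbitrary _
  have hs := (hfeas _ hp).simplex
  have ht0 := le_tZero hk hp hs
  have hΛ := hk.lamMin_pos
  have hθ := thetaBar_nonneg hc hh (hfeas _ hp)
  have hQθ : ∀ π ∈ Pol, norm2 (M.Q π) ≤ M.thetaBar cbar hbar :=
    fun π hπ => norm2_Q_le hc hh (hfeas π hπ)
  have hσB := sq_B_le_sigmaFsq (M := M) (cbar := cbar) (hbar := hbar) (k := k)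
  have hσ0 : 0 ≤ M.sigmaFsq cbar hbar k := (sq_nonneg _).trans hσB
  set α := M.skip cbar hbar k j with hα
  set T := M.numSteps cbar hbar k j with hTdef
  set t₀ := M.tZero k with ht₀
  set Θ := M.thetaBar cbar hbar with hΘ
  set N : ℝ := 2 ^ (j / M.epochLen + 2) with hN
  have hN0 : 0 < N := by positivity
  have hTge : t₀ * (3 * Θ * N) ^ (2 / 3 : ℝ) + √(4 * t₀ ^ 2 * Θ ^ 2 * N)
      + 24 * M.sigmaFsq cbar hbar k / k.lamMin ^ 2 * N ≤ T := Nat.le_ceil _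
  have hX1 : 0 ≤ t₀ * (3 * Θ * N) ^ (2 / 3 : ℝ) := by positivity
  have hX2 := Real.sqrt_nonneg (4 * t₀ ^ 2 * Θ ^ 2 * N)
  have hX3 : 0 ≤ 24 * M.sigmaFsq cbar hbar k / k.lamMin ^ 2 * N := by positivity
  have hT0 : (0 : ℝ) ≤ T := by positivity
  -- Each of the three summands of the step number is a lower bound of `T` by itself. Cubing clears
  -- the exponent `2/3`.
  have hT1 : t₀ ^ 3 * (3 * Θ * N) ^ 2 ≤ (T : ℝ) ^ 3 := by
    have := pow_le_pow_left₀ hX1 (by linarith : t₀ * (3 * Θ * N) ^ (2 / 3 : ℝ) ≤ T) 3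
    rw [mul_pow, ← Real.rpow_natCast ((3 * Θ * N) ^ (2 / 3 : ℝ)), ← Real.rpow_mul (by positivity)]
      at this
    norm_num at this
    exact this
  have hT2 : 4 * t₀ ^ 2 * Θ ^ 2 * N ≤ (T : ℝ) ^ 2 :=
    (Real.sqrt_le_left hT0).1 (by linarith)
  have hT3 : 24 * M.sigmaFsq cbar hbar k / k.lamMin ^ 2 * N ≤ T := by linarith
  -- If no step is made, then `θ̄ = 0`. In that case `Q` vanishes and the initial point is exact.
  have hΘ0 : T = 0 → Θ = 0 := by
    intro h0
    rw [h0] at hT2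
    by_contra hne
    have : 0 < 4 * t₀ ^ 2 * Θ ^ 2 * N := by positivity
    norm_num at hT2
    linarith
  have hrec := h.sq_recursion hk hΦ hfeas (one_le_skip (cbar := cbar) (hbar := hbar) j)
    (pow_skip_le hk j) hT
  rw [← hα, ← ht₀] at hrec
  set a : ℕ → ℝ := fun t => ∫ ω, norm2 (M.ctdErr Φ α (M.stepSize k) n₀ t fun i => Z i ω) ^ 2 ∂Pr
    with ha
  have ha0 : ∀ b, (∀ π ∈ Pol, norm2 (M.Q π) ≤ b) → a 0 ≤ b ^ 2 := by
    intro b hb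
    calc a 0 ≤ ∫ _ω, b ^ 2 ∂Pr := by
          refine integral_mono ?_ (integrable_const _) fun ω =>
            pow_le_pow_left₀ (norm2_nonneg _) (ctdErr_zero_sq_le α _ _ (hb _ (hΦ _))) 2
          exact integrable_of_dependsOn (n := n₀ + 0 * α)
            (G := fun p => norm2 (M.ctdErr Φ α (M.stepSize k) n₀ 0 p) ^ 2) h.meas
            fun p q hpq => by simp only [dependsOn_ctdErr (M := M) h.past α _ 0 hpq]
      _ = b ^ 2 := by simp
  have hapos : ∀ t, 0 ≤ a t := fun t => integral_nonneg fun _ => sq_nonneg _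
  have hD0 : 0 ≤ 8 * k.B ^ 2 / k.lamMin ^ 2 := by positivity
  constructor
  · have hw := weighted_recursion_le ht0 hD0 hapos hrec T le_rfl
    have haΘ := ha0 Θ hQθ
    rcases Nat.eq_zero_or_pos T with h0 | hTpos
    · rw [hΘ0 h0] at haΘ
      have : a T ≤ 0 := by rw [h0]; simpa using haΘ
      exact this.trans (by positivity)
    have hTp : (0 : ℝ) < T := by exact_mod_cast hTpos
    change a T ≤ _
    have h1 : (T : ℝ) ^ 2 * a T ≤ t₀ ^ 2 * Θ ^ 2 + 8 * k.B ^ 2 / k.lamMin ^ 2 * T := by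
      have b1 : (T : ℝ) ^ 2 ≤ (T + t₀ - 1) * (T + t₀ - 2) := by nlinarith
      have b2 : (t₀ - 1) * (t₀ - 2) ≤ t₀ ^ 2 := by nlinarith
      have b3 := mul_le_mul_of_nonneg_right b1 (hapos T)
      have b4 := mul_le_mul b2 haΘ (hapos 0) (sq_nonneg _)
      linarith
    have h2 : 8 * k.B ^ 2 / k.lamMin ^ 2 * N ≤ T / 3 := by
      have : k.B ^ 2 / k.lamMin ^ 2 ≤ M.sigmaFsq cbar hbar k / k.lamMin ^ 2 := by gcongr
      have h3 := mul_le_mul_of_nonneg_right this hN0.le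
      have e1 : 8 * k.B ^ 2 / k.lamMin ^ 2 * N = 8 * (k.B ^ 2 / k.lamMin ^ 2 * N) := by ring
      have e2 : 24 * M.sigmaFsq cbar hbar k / k.lamMin ^ 2 * N
        = 24 * (M.sigmaFsq cbar hbar k / k.lamMin ^ 2 * N) := by ring
      rw [e1]
      rw [e2] at hT3
      linarith
    rw [le_div_iff₀ hN0]
    -- Here `7/12 = 1/4 + 1/3`: the initial error is controlled by the second summand of `T`, the
    -- noise by the third.
    have h4 : (T : ℝ) ^ 2 * (a T * N) ≤ (T : ℝ) ^ 2 * (7 / 12) := by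
      have b1 := mul_le_mul_of_nonneg_right h1 hN0.le
      have b2 := mul_le_mul_of_nonneg_right h2 hTp.le
      nlinarith
    exact le_of_mul_le_mul_left h4 (by positivity)
  · intro V c hV hcV
    have hc0 : 0 ≤ c := (norm2_nonneg _).trans (hcV fun _ => Classical.arbitrary _)
    have haR : ∀ t ≤ T, a t ≤ M.Rsq cbar hbar k := by
      refine bounded_recursion_le ht0 ?_ Rsq_nonneg ((ha0 k.B hk.norm_le).trans sq_B_le_Rsq) hrec
      have b1 := le_tZero_mul hk
      have b2 := sq_B_le_Rsq (M := M) (cbar := cbar) (hbar := hbar) (k := k)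
      rw [div_le_iff₀ (by positivity)]
      have b3 : 64 ≤ M.tZero k * k.lamMin ^ 2 := by nlinarith [M.γ_pos]
      have b4 := mul_le_mul b3 b2 (sq_nonneg _) (by linarith)
      nlinarith [sq_nonneg k.B]
    have hb := h.integral_inner_le hk hΦ hfeas (one_le_skip (cbar := cbar) (hbar := hbar) j) hT
      (Real.sqrt_nonneg (M.Rsq cbar hbar k)) hQθ
      (fun t ht => h.integral_norm2_ctdErr_le (haR t ht)) T le_rfl V c hV hcV
    refine hb.trans (mul_le_mul_of_nonneg_left ?_ hc0)
    have h1 := bias_const_le (cbar := cbar) (hbar := hbar) hk j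
    -- The initial bias decays like `(t₀ / T)^(3/2)`, so `hT1` is exactly what is needed. Together
    -- with `1/10` from the mixing bias this gives `13/30`.
    have h2 : decay t₀ T * Θ ≤ 1 / 3 / N := by
      rcases Nat.eq_zero_or_pos T with h0 | hTpos
      · rw [hΘ0 h0, mul_zero]; positivity
      have hTp : (0 : ℝ) < T := by exact_mod_cast hTpos
      have hd := decay_sq_mul_le ht0 T
      have hd0 := decay_nonneg t₀ T
      refine le_of_sq_le_sq ?_ (by positivity)
      have b1 := mul_le_mul_of_nonneg_right hd (sq_nonneg (3 * Θ * N))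
      have b2 : (T : ℝ) ^ 3 * (decay t₀ T * Θ * (3 * N)) ^ 2 ≤ (T : ℝ) ^ 3 * 1 := by nlinarith
      have b3 := le_of_mul_le_mul_left b2 (by positivity)
      rw [div_div, div_pow, le_div_iff₀ (by positivity), ← mul_pow, one_pow]
      exact b3
    calc _ ≤ 1 / 3 / N + 1 / 10 / N := add_le_add h2 h1
      _ = _ := by ring

end RegMDP

/-! ### Policies as functions of the trajectory, and the linear rate. -/

namespace RegMDP

variable {S A : Type*} [Fintype S] [Fintype A] [DecidableEq S] [DecidableEq A]
  [Nonempty S] [Nonempty A]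
  {M : RegMDP S A} {Ω : Type*} {mΩ : MeasurableSpace Ω} {Pr : Measure Ω} [IsProbabilityMeasure Pr]
  {Z : ℕ → Ω → S × A} {Pol : Set (Policy S A)} {k : CTDConst} {μ cbar hbar : ℝ}

open Classical in
/-- A result of the prox-mapping at `π` within the class `Pol`, if there is any, and the uniform
policy otherwise. -/
noncomputable def proxOf (M : RegMDP S A) (η : ℝ) (Pol : Set (Policy S A)) (G : S × A → ℝ)
    (π : Policy S A) : Policy S A :=
  if h : ∃ πp ∈ Pol, M.IsProx η G π πp then h.choose else uniformPolicy S A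

lemma proxOf_mem (h0 : uniformPolicy S A ∈ Pol) (η : ℝ) (G : S × A → ℝ) (π : Policy S A) :
    M.proxOf η Pol G π ∈ Pol := by
  rw [proxOf]
  split_ifs with h
  · exact h.choose_spec.1
  · exact h0

lemma isProx_proxOf {η : ℝ} {G : S × A → ℝ} {π πp : Policy S A} (hp : πp ∈ Pol)
    (h : M.IsProx η G π πp) : M.IsProx η G π (M.proxOf η Pol G π) := by
  have hex : ∃ πp ∈ Pol, M.IsProx η G π πp := ⟨πp, hp, h⟩
  rw [proxOf, dif_pos hex]
  exact hex.choose_spec.2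

/-- The policies of stochastic policy mirror descent as functions of the trajectory, chosen within
the class `Pol`. -/
noncomputable def policyOf (M : RegMDP S A) (μ cbar hbar : ℝ) (k : CTDConst)
    (Pol : Set (Policy S A)) : ℕ → (ℕ → S × A) → Policy S A
  | 0, _ => uniformPolicy S A
  | j + 1, p => M.proxOf ((1 - M.γ) / (M.γ * μ)) Pol
      (M.ctd (M.policyOf μ cbar hbar k Pol j p) (M.skip cbar hbar k j) (M.stepSize k) p
        (M.numSamples cbar hbar k j) (M.numSteps cbar hbar k j))
      (M.policyOf μ cbar hbar k Pol j p)

lemma policyOf_mem (h0 : uniformPolicy S A ∈ Pol) (j : ℕ) (p : ℕ → S × A) :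
    M.policyOf μ cbar hbar k Pol j p ∈ Pol := by
  cases j with
  | zero => exact h0
  | succ j => exact proxOf_mem h0 _ _ _

lemma numSamples_succ (j : ℕ) : M.numSamples cbar hbar k (j + 1)
    = M.numSamples cbar hbar k j + M.numSteps cbar hbar k j * M.skip cbar hbar k j :=
  Finset.sum_range_succ _ _

lemma dependsOn_policyOf (j : ℕ) :
    DependsOn (M.policyOf μ cbar hbar k Pol j) (Set.Iic (M.numSamples cbar hbar k j)) := by
  induction j with
  | zero => exact fun _ _ _ => rfl
  | succ j ih =>
    intro p q hpq
    rw [numSamples_succ] at hpq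
    have h1 : M.policyOf μ cbar hbar k Pol j p = M.policyOf μ cbar hbar k Pol j q :=
      ih fun i hi => hpq i (le_trans hi (Nat.le_add_right _ _))
    rw [policyOf, policyOf, h1, ctd_congr _ _ _ _ hpq]

variable {π : ℕ → Ω → Policy S A} {πlow : ℝ}

lemma IsRun.uniform_mem (hrun : M.IsRun μ cbar hbar k Pr Z π)
    (hPol : ∀ᵐ ω ∂Pr, ∀ j, π j ω ∈ Pol) : uniformPolicy S A ∈ Pol := by
  obtain ⟨ω, hω⟩ := hPol.exists
  rw [← hrun.init ω]
  exact hω 0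

/-- The iterates are arbitrary functions of `ω`. Uniqueness of the prox-mapping on positive policies
identifies them, up to a null set, with functions of a finite part of the trajectory, to which the
integration lemmas apply. -/
lemma IsRun.ae_eq_policyOf (hrun : M.IsRun μ cbar hbar k Pr Z π)
    (hPol : ∀ᵐ ω ∂Pr, ∀ j, π j ω ∈ Pol) (hμ : 0 < μ) (hsc : M.StronglyConvex μ)
    (hlow : 0 < πlow) (hrand : ∀ π ∈ Pol, ∀ s a, πlow ≤ π s a) :
    ∀ᵐ ω ∂Pr, ∀ j, π j ω = M.policyOf μ cbar hbar k Pol j fun i => Z i ω := by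
  have hpos : ∀ π ∈ Pol, ∀ s a, 0 < π s a := fun π hπ s a => hlow.trans_le (hrand π hπ s a)
  have hη : 0 < (1 - M.γ) / (M.γ * μ) :=
    div_pos (by linarith [M.γ_lt_one]) (mul_pos M.γ_pos hμ)
  filter_upwards [hrun.step, hPol] with ω hstep hω j
  induction j with
  | zero => exact hrun.init ω
  | succ j ih =>
    have h1 := hstep j
    have h2 := isProx_proxOf (hω (j + 1)) h1
    rw [policyOf, ← ih]
    exact (h1.unique h2 hsc hμ hη (hpos _ (hω j)) (hpos _ (hω (j + 1)))).symm

lemma IsRun.follows (hrun : M.IsRun μ cbar hbar k Pr Z π)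
    (hae : ∀ᵐ ω ∂Pr, ∀ j, π j ω = M.policyOf μ cbar hbar k Pol j fun i => Z i ω) (j : ℕ) :
    M.Follows Pr Z (M.policyOf μ cbar hbar k Pol j) (M.numSamples cbar hbar k j)
      (M.numSamples cbar hbar k (j + 1)) where
  meas := hrun.meas
  past := dependsOn_policyOf j
  markov n h0 h1 z' := by
    filter_upwards [hrun.markov j n h0 h1 z', hae] with ω hω1 hω2
    rw [hω1, hω2 j]
    rfl

lemma f_le_of_isOptimal {πs π : Policy S A} {ν : S → ℝ} (hopt : M.IsOptimal πs)
    (hν : M.IsStationary πs ν) (hπ : M.Feasible π) : M.f ν πs ≤ M.f ν π :=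
  Finset.sum_le_sum fun s _ => mul_le_mul_of_nonneg_left (hopt.2 π hπ s) (hν.1.1 s)

/-- The error budget of an iteration: `5/2` pays for the bias and `5 / (8 γ μ)` for the mean square.
-/
lemma le_gapConst {πs : Policy S A} {ν : S → ℝ} (hμ : 0 < μ) (hopt : M.IsOptimal πs)
    (hν : M.IsStationary πs ν) (hu : M.Feasible (uniformPolicy S A)) :
    5 / 2 + 5 / (8 * M.γ * μ) ≤ (1 - M.γ) * M.gapConst μ ν πs := by
  have h1 : 0 < 1 - M.γ := by linarith [M.γ_lt_one]
  have h2 := f_le_of_isOptimal hopt hν hu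
  have h3 : 0 ≤ μ * Real.log (Fintype.card A) :=
    mul_nonneg hμ.le (Real.log_nonneg (by exact_mod_cast Fintype.card_pos))
  rw [gapConst, mul_add, ← mul_assoc, mul_one_div_cancel h1.ne', one_mul]
  nlinarith

lemma gap_uniform_le {πs : Policy S A} {ν : S → ℝ} (hμ : 0 < μ) (hopt : M.IsOptimal πs)
    (hν : M.IsStationary πs ν) :
    M.gap μ ν πs (uniformPolicy S A) ≤ M.gapConst μ ν πs := by
  have h1 : 0 < 1 - M.γ := by linarith [M.γ_lt_one]
  have hγ := M.γ_pos
  have h2 : M.dist ν (uniformPolicy S A) πs ≤ Real.log (Fintype.card A) := by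
    calc M.dist ν (uniformPolicy S A) πs ≤ ∑ s, ν s * Real.log (Fintype.card A) :=
          Finset.sum_le_sum fun s _ => mul_le_mul_of_nonneg_left
            (klDist_uniform_le (hopt.1.simplex s)) (hν.1.1 s)
      _ = _ := by rw [← Finset.sum_mul, hν.1.2, one_mul]
  have h3 := mul_le_mul_of_nonneg_left h2 (div_nonneg hμ.le h1.le)
  have h4 : 0 ≤ 1 / (1 - M.γ) * (5 / 2 + 5 / (8 * M.γ * μ)) := by positivity
  rw [gap, gapConst]
  have e : 1 / (1 - M.γ) * (μ * Real.log (Fintype.card A) + 5 / 2 + 5 / (8 * M.γ * μ))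
      = μ / (1 - M.γ) * Real.log (Fintype.card A)
        + 1 / (1 - M.γ) * (5 / 2 + 5 / (8 * M.γ * μ)) := by ring
  rw [e]
  linarith

/-- The only direction in which the bias enters `gap_prox_le`. For the iteration `j` it depends on
the trajectory only through `π j`, hence on the past. -/
lemma norm2_direction_le {πs π : Policy S A} {ν : S → ℝ} (hν : ν ∈ stdSimplex ℝ S)
    (hs : ∀ s, πs s ∈ stdSimplex ℝ A) (hπ : ∀ s, π s ∈ stdSimplex ℝ A) :
    norm2 (fun z : S × A => ν z.1 * (πs z.1 z.2 - π z.1 z.2)) ≤ 2 := by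
  rw [norm2_le_iff (by norm_num), Fintype.sum_prod_type]
  have h1 : ∀ s, ∑ a, (ν s * (πs s a - π s a)) ^ 2 ≤ ν s * 2 := by
    intro s
    have h2 : ∀ a, (ν s * (πs s a - π s a)) ^ 2 ≤ ν s * (πs s a + π s a) := by
      intro a
      have n0 := hν.1 s
      have n1 := stdSimplex_apply_le_one hν s
      have a0 := (hs s).1 a
      have a1 := stdSimplex_apply_le_one (hs s) a
      have b0 := (hπ s).1 a
      have b1 := stdSimplex_apply_le_one (hπ s) a
      rw [mul_pow]
      exact mul_le_mul (by nlinarith) (by nlinarith) (sq_nonneg _) n0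
    refine (Finset.sum_le_sum fun a _ => h2 a).trans (le_of_eq ?_)
    rw [← Finset.mul_sum, Finset.sum_add_distrib, (hs s).2, (hπ s).2]
    norm_num
  refine (Finset.sum_le_sum fun s _ => h1 s).trans ?_
  rw [← Finset.sum_mul, hν.2]
  norm_num

/-- The linear rate of convergence of stochastic policy mirror descent. -/
theorem IsRun.integral_gap_le (hrun : M.IsRun μ cbar hbar k Pr Z π)
    (hPol : ∀ᵐ ω ∂Pr, ∀ j, π j ω ∈ Pol) (hk : M.ValidConst Pol k) (hμ : 0 < μ)
    (hsc : M.StronglyConvex μ) (hc : ∀ s a, |M.c s a| ≤ cbar)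
    (hh : ∀ s, ∀ p ∈ M.dom s, |M.h s p| ≤ hbar) (hfeas : ∀ π ∈ Pol, M.Feasible π)
    (hlow : 0 < πlow) (hrand : ∀ π ∈ Pol, ∀ s a, πlow ≤ π s a)
    {πs : Policy S A} {ν : S → ℝ} (hopt : M.IsOptimal πs) (hν : M.IsStationary πs ν) (j : ℕ) :
    Integrable (fun ω => M.gap μ ν πs (π j ω)) Pr ∧
      ∫ ω, M.gap μ ν πs (π j ω) ∂Pr ≤ (1 / 2) ^ (j / M.epochLen) * M.gapConst μ ν πs := by
  have hu := hrun.uniform_mem hPol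
  have hae := hrun.ae_eq_policyOf hPol hμ hsc hlow hrand
  have hpos : ∀ π ∈ Pol, ∀ s a, 0 < π s a := fun π hπ s a => hlow.trans_le (hrand π hπ s a)
  have hγ := M.γ_pos
  have hγ1 : 0 < 1 - M.γ := by linarith [M.γ_lt_one]
  set Φ := M.policyOf μ cbar hbar k Pol with hΦ
  have hΦm : ∀ j p, Φ j p ∈ Pol := fun j p => policyOf_mem hu j p
  have hI : ∀ j, Integrable (fun ω => M.gap μ ν πs (Φ j fun i => Z i ω)) Pr := fun j =>
    integrable_of_dependsOn (n := M.numSamples cbar hbar k j)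
      (G := fun p => M.gap μ ν πs (Φ j p)) hrun.meas fun p q hpq => by
        simp only [dependsOn_policyOf j hpq, hΦ]
  have hcongr : ∀ j, (fun ω => M.gap μ ν πs (π j ω))
      =ᵐ[Pr] fun ω => M.gap μ ν πs (Φ j fun i => Z i ω) := fun j => by
    filter_upwards [hae] with ω hω
    rw [hω j]
  refine ⟨(hI j).congr (hcongr j).symm, ?_⟩
  rw [integral_congr_ae (hcongr j)]
  have hΔ := le_gapConst hμ hopt hν (hfeas _ hu)
  have hq0 : 0 < 5 / (8 * M.γ * μ) := by positivity
  refine epoch_recursion_le (X := fun j => ∫ ω, M.gap μ ν πs (Φ j fun i => Z i ω) ∂Pr) hγ.le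
    M.γ_lt_one.le (by nlinarith) M.pow_epochLen_le ?_ (fun j => ?_) j
  · simp only [hΦ, policyOf, integral_const, probReal_univ, one_smul]
    exact gap_uniform_le hμ hopt hν
  · have hF := hrun.follows hae j
    obtain ⟨hvar, hbias⟩ := hF.ctd_accuracy hc hh j hk (hΦm j) hfeas (numSamples_succ j).ge
    have hb := hbias (fun p z => ν z.1 * (πs z.1 z.2 - Φ j p z.1 z.2)) 2
      (fun p q hpq => by simp only [hΦ, dependsOn_policyOf j hpq])
      (fun p => norm2_direction_le hν.1 hopt.1.simplex (hfeas _ (hΦm j p)).simplex)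
    set err := M.ctdErr (Φ j) (M.skip cbar hbar k j) (M.stepSize k) (M.numSamples cbar hbar k j)
      (M.numSteps cbar hbar k j) with herr
    have hd : DependsOn err (Set.Iic (M.numSamples cbar hbar k (j + 1))) := by
      rw [numSamples_succ]
      exact dependsOn_ctdErr (dependsOn_policyOf j) _ _ _
    have hI2 : Integrable (fun ω => norm2 (err fun i => Z i ω) ^ 2) Pr :=
      integrable_of_dependsOn (n := M.numSamples cbar hbar k (j + 1))
        (G := fun p => norm2 (err p) ^ 2) hrun.meas fun p q hpq => by simp only [hd hpq]
    have hmono : M.numSamples cbar hbar k j ≤ M.numSamples cbar hbar k (j + 1) := by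
      rw [numSamples_succ]; exact Nat.le_add_right _ _
    have hI3 : Integrable (fun ω => ∑ z, (err fun i => Z i ω) z
        * (ν z.1 * (πs z.1 z.2 - Φ j (fun i => Z i ω) z.1 z.2))) Pr :=
      integrable_of_dependsOn (n := M.numSamples cbar hbar k (j + 1))
        (G := fun p => ∑ z, err p z * (ν z.1 * (πs z.1 z.2 - Φ j p z.1 z.2))) hrun.meas
        fun p q hpq => by
          simp only [hd hpq, hΦ, dependsOn_policyOf j fun i hi => hpq i (le_trans hi hmono)]
    have hstep : ∀ᵐ ω ∂Pr, M.gap μ ν πs (Φ (j + 1) fun i => Z i ω)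
        ≤ M.gap μ ν πs (Φ j fun i => Z i ω) * M.γ
          + 1 / (M.γ * μ) * norm2 (err fun i => Z i ω) ^ 2
          + ∑ z, (err fun i => Z i ω) z
            * (ν z.1 * (πs z.1 z.2 - Φ j (fun i => Z i ω) z.1 z.2)) := by
      filter_upwards [hrun.step, hae] with ω h1 h2
      have h3 := h1 j
      rw [h2 j, h2 (j + 1)] at h3
      have h4 := gap_prox_le hν hopt.1 (hfeas _ (hΦm j _)) hμ hsc h3 (hpos _ (hΦm j _))
        (hpos _ (hΦm (j + 1) _))
      rw [Fintype.sum_prod_type]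
      exact h4
    have hI4 : Integrable (fun ω => M.gap μ ν πs (Φ j fun i => Z i ω) * M.γ
        + 1 / (M.γ * μ) * norm2 (err fun i => Z i ω) ^ 2) Pr :=
      ((hI j).mul_const M.γ).add (hI2.const_mul (1 / (M.γ * μ)))
    have h5 := integral_mono_ae (hI (j + 1)) (hI4.add hI3) hstep
    simp only [Pi.add_apply] at h5
    rw [integral_add hI4 hI3, integral_add ((hI j).mul_const M.γ)
      (hI2.const_mul (1 / (M.γ * μ))), integral_mul_const, integral_const_mul] at h5
    refine h5.trans ?_
    have h6 := mul_le_mul_of_nonneg_left hvar (by positivity : 0 ≤ 1 / (M.γ * μ))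
    -- A quarter of the budget in `hΔ` covers both errors, as `7/30 ≤ 1/4` and `13/60 ≤ 5/8`.
    have e1 : 1 / (M.γ * μ) * (7 / 12 / 2 ^ (j / M.epochLen + 2))
        = 7 / 30 * (5 / (8 * M.γ * μ)) * (1 / 2) ^ (j / M.epochLen) := by
      rw [pow_add, one_div_pow]
      field_simp
      norm_num
    have e2 : (2 : ℝ) * (13 / 30 / 2 ^ (j / M.epochLen + 2))
        = 13 / 60 * (1 / 2) ^ (j / M.epochLen) := by
      rw [pow_add, one_div_pow]
      field_simp
      norm_num
    rw [e1] at h6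
    rw [e2] at hb
    have h7 : 0 < (1 / 2 : ℝ) ^ (j / M.epochLen) := by positivity
    nlinarith [mul_le_mul_of_nonneg_right hΔ h7.le, mul_pos hq0 h7]

end RegMDP

/-! ### Logarithms and geometric sums. -/

section Asymptotics

/-- Logarithms tend to infinity, but slower than any multiple of `1/ε`. The second fact later
absorbs the cost of rounding the step numbers. -/
lemma exists_small_logb (E₀ : ℝ) {c : ℝ} (hc : 0 < c) : ∃ ε₀ : ℝ, 0 < ε₀ ∧ ∀ ε : ℝ, 0 < ε →
    ε ≤ ε₀ → E₀ ≤ Real.logb 2 (1 / ε) ∧ Real.logb 2 (1 / ε) ≤ c / ε := by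
  have h1 : ∀ᶠ x : ℝ in Filter.atTop, E₀ ≤ Real.logb 2 x :=
    (Real.tendsto_logb_atTop (by norm_num)).eventually_ge_atTop E₀
  have h2 : ∀ᶠ x : ℝ in Filter.atTop, ‖Real.log x‖ ≤ c * Real.log 2 * ‖id x‖ :=
    Real.isLittleO_log_id_atTop.def (mul_pos hc (Real.log_pos (by norm_num)))
  obtain ⟨x₀, hx⟩ := Filter.eventually_atTop.1 (h1.and h2)
  refine ⟨1 / max x₀ 1, by positivity, fun ε h0 hε => ?_⟩
  have hpos : 0 < 1 / ε := by positivity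
  have hge : x₀ ≤ 1 / ε := (le_max_left _ 1).trans
    ((le_one_div h0 (by positivity)).1 hε)
  obtain ⟨a, b⟩ := hx _ hge
  refine ⟨a, ?_⟩
  rw [id, Real.norm_eq_abs, Real.norm_eq_abs, abs_of_pos hpos] at b
  rw [Real.logb, div_le_iff₀ (Real.log_pos (by norm_num))]
  have := (le_abs_self _).trans b
  calc Real.log (1 / ε) ≤ c * Real.log 2 * (1 / ε) := this
    _ = _ := by ring

/-- The constant `4` is `1 / (r - 1)` at `r = 5/4`. This `r` lies below `√2`, the growth rate for
the smallest exponent `1/2` in the step numbers. -/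
lemma sum_pow_le {r : ℝ} (hr : 5 / 4 ≤ r) (m : ℕ) :
    ∑ q ∈ Finset.range m, r ^ q ≤ 4 * r ^ m := by
  induction m with
  | zero => norm_num
  | succ m ih =>
    rw [Finset.sum_range_succ, pow_succ]
    have : 0 < r ^ m := by positivity
    nlinarith

lemma sum_range_div {l : ℕ} (hl : 0 < l) (F : ℕ → ℝ) (m : ℕ) :
    ∑ i ∈ Finset.range (l * m), F (i / l) = l * ∑ q ∈ Finset.range m, F q := by
  induction m with
  | zero => simp
  | succ m ih =>
    rw [Nat.mul_succ, Finset.sum_range_add, ih, Finset.sum_range_succ, mul_add]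
    congr 1
    calc ∑ x ∈ Finset.range l, F ((l * m + x) / l) = ∑ _x ∈ Finset.range l, F m := by
          refine Finset.sum_congr rfl fun x hx => ?_
          rw [Nat.mul_add_div hl, Nat.div_eq_of_lt (Finset.mem_range.1 hx), add_zero]
      _ = l * F m := by simp

lemma five_quarters_le_rpow {s : ℝ} (hs : 1 / 2 ≤ s) : 5 / 4 ≤ (2 : ℝ) ^ s := by
  calc (5 / 4 : ℝ) ≤ √2 := Real.le_sqrt_of_sq_le (by norm_num)
    _ = 2 ^ (1 / 2 : ℝ) := Real.sqrt_eq_rpow 2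
    _ ≤ _ := Real.rpow_le_rpow_of_exponent_le (by norm_num) hs

/-- A geometric sum of fractional powers of two, bounded through the last power of two. -/
lemma sum_two_pow_rpow_le {s X : ℝ} (hs : 1 / 2 ≤ s) {m : ℕ}
    (hm : (2 : ℝ) ^ m ≤ X) : ∑ q ∈ Finset.range m, ((2 : ℝ) ^ q) ^ s ≤ 4 * X ^ s := by
  have e : ∀ q : ℕ, ((2 : ℝ) ^ q) ^ s = ((2 : ℝ) ^ s) ^ q := fun q => by
    rw [← Real.rpow_natCast, ← Real.rpow_natCast, ← Real.rpow_mul (by norm_num),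
      ← Real.rpow_mul (by norm_num), mul_comm]
  simp only [e]
  refine (sum_pow_le (five_quarters_le_rpow hs) m).trans ?_
  rw [← e]
  have := Real.rpow_le_rpow (by positivity) hm (by linarith : 0 ≤ s)
  linarith

end Asymptotics

/-! ### Iteration and sample complexity. -/

namespace RegMDP

variable {S A : Type*} [Fintype S] [Fintype A] [DecidableEq S] [DecidableEq A]
  [Nonempty S] [Nonempty A]
  {M : RegMDP S A} {Pol : Set (Policy S A)} {k : CTDConst} {μ cbar hbar : ℝ}

/-- The number of iterations which reaches the accuracy `ε` from the initial gap `Δ`. -/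
noncomputable def numIter (M : RegMDP S A) (Δ ε : ℝ) : ℕ :=
  if Δ ≤ ε then 0 else M.epochLen * ⌈Real.logb 2 (Δ / ε)⌉₊

lemma pow_numIter_mul_le (M : RegMDP S A) (Δ : ℝ) {ε : ℝ} (hε : 0 < ε) :
    (1 / 2) ^ (M.numIter Δ ε / M.epochLen) * Δ ≤ ε := by
  unfold numIter
  split_ifs with h
  · simpa using h
  · rw [Nat.mul_div_cancel_left _ M.epochLen_pos]
    have hΔ : 0 < Δ := hε.trans (not_le.1 h)
    have h1 : Δ / ε ≤ 2 ^ ⌈Real.logb 2 (Δ / ε)⌉₊ := by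
      rw [← Real.rpow_natCast, ← Real.logb_le_iff_le_rpow (by norm_num) (by positivity)]
      exact Nat.le_ceil _
    rw [div_le_iff₀ hε] at h1
    rw [one_div_pow, one_div_mul_eq_div, div_le_iff₀ (by positivity)]
    linarith

lemma sampleRate_nonneg (hμ : 0 < μ) (hθ : 0 ≤ M.thetaBar cbar hbar) {ε : ℝ} (hε : 0 < ε) :
    0 ≤ M.sampleRate μ cbar hbar k ε := by
  have h1 : 0 < 1 - M.γ := by linarith [M.γ_lt_one]
  have h2 : 0 ≤ M.tZero k := by unfold tZero; positivity
  have h3 : 0 ≤ M.sigmaFsq cbar hbar k := (sq_nonneg _).trans sq_B_le_sigmaFsq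
  unfold sampleRate
  positivity

/-- The number of temporal difference steps before rounding, in the epoch `q`. -/
noncomputable def rawSteps (M : RegMDP S A) (cbar hbar : ℝ) (k : CTDConst) (q : ℕ) : ℝ :=
  M.tZero k * (3 * M.thetaBar cbar hbar * 2 ^ (q + 2)) ^ (2 / 3 : ℝ)
    + Real.sqrt (4 * M.tZero k ^ 2 * M.thetaBar cbar hbar ^ 2 * 2 ^ (q + 2))
    + 24 * M.sigmaFsq cbar hbar k / k.lamMin ^ 2 * 2 ^ (q + 2)

lemma numSteps_eq (j : ℕ) :
    M.numSteps cbar hbar k j = ⌈M.rawSteps cbar hbar k (j / M.epochLen)⌉₊ := rfl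

lemma rawSteps_nonneg (hθ : 0 ≤ M.thetaBar cbar hbar) (q : ℕ) :
    0 ≤ M.rawSteps cbar hbar k q := by
  have h2 : 0 ≤ M.tZero k := by unfold tZero; positivity
  have h3 : 0 ≤ M.sigmaFsq cbar hbar k := (sq_nonneg _).trans sq_B_le_sigmaFsq
  unfold rawSteps
  positivity

lemma rawSteps_le (hθ : 0 ≤ M.thetaBar cbar hbar) (q : ℕ) :
    M.rawSteps cbar hbar k q
      ≤ 12 * (M.tZero k * M.thetaBar cbar hbar ^ (2 / 3 : ℝ)) * ((2 : ℝ) ^ q) ^ (2 / 3 : ℝ)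
        + 4 * (M.tZero k * M.thetaBar cbar hbar) * ((2 : ℝ) ^ q) ^ (1 / 2 : ℝ)
        + 96 * (M.sigmaFsq cbar hbar k / k.lamMin ^ 2) * ((2 : ℝ) ^ q) ^ (1 : ℝ) := by
  have h2 : 0 ≤ M.tZero k := by unfold tZero; positivity
  rw [rawSteps]
  set Θ := M.thetaBar cbar hbar
  have e1 : (3 * Θ * 2 ^ (q + 2)) ^ (2 / 3 : ℝ)
      = 12 ^ (2 / 3 : ℝ) * Θ ^ (2 / 3 : ℝ) * ((2 : ℝ) ^ q) ^ (2 / 3 : ℝ) := by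
    rw [← Real.mul_rpow (by norm_num) hθ, ← Real.mul_rpow (by positivity) (by positivity)]
    congr 1
    ring
  have h12 : (12 : ℝ) ^ (2 / 3 : ℝ) ≤ 12 :=
    (Real.rpow_le_rpow_of_exponent_le (by norm_num) (by norm_num)).trans (Real.rpow_one 12).le
  have e2 : √(4 * M.tZero k ^ 2 * Θ ^ 2 * 2 ^ (q + 2))
      = 4 * (M.tZero k * Θ) * ((2 : ℝ) ^ q) ^ (1 / 2 : ℝ) := by
    rw [← Real.sqrt_eq_rpow]
    have : 4 * M.tZero k ^ 2 * Θ ^ 2 * 2 ^ (q + 2) = (4 * (M.tZero k * Θ)) ^ 2 * 2 ^ q := by ring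
    rw [this, Real.sqrt_mul (by positivity), Real.sqrt_sq (by positivity)]
  rw [e1, e2, Real.rpow_one, pow_add]
  have h3 := mul_le_mul_of_nonneg_right h12
    (by positivity : 0 ≤ M.tZero k * Θ ^ (2 / 3 : ℝ) * ((2 : ℝ) ^ q) ^ (2 / 3 : ℝ))
  refine add_le_add (add_le_add ?_ le_rfl) (le_of_eq (by ring))
  calc _ = _ := by ring
    _ ≤ _ := h3
    _ = _ := by ring

lemma mul_rpow_le_div {c κ y s : ℝ} (hc : 0 ≤ c) (hκ : 1 ≤ κ) (hy : 0 < y) (hs1 : s ≤ 1) :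
    c * (κ / y) ^ s ≤ κ * (c / y ^ s) := by
  rw [Real.div_rpow (by linarith) hy.le]
  have h1 : κ ^ s ≤ κ := (Real.rpow_le_rpow_of_exponent_le hκ hs1).trans (Real.rpow_one κ).le
  have h2 : 0 ≤ c / y ^ s := by positivity
  calc c * (κ ^ s / y ^ s) = κ ^ s * (c / y ^ s) := by ring
    _ ≤ _ := mul_le_mul_of_nonneg_right h1 h2

/-- Each of the three powers of `2 ^ q` sums to at most four times its value at `κ / (μ (1 - γ) ε)`.
The largest coefficient, `96`, gives `384`. -/
lemma sum_rawSteps_le (hθ : 0 ≤ M.thetaBar cbar hbar) (hμ : 0 < μ) {κ ε : ℝ} (hκ : 1 ≤ κ)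
    (hε : 0 < ε) {m : ℕ} (hm : (2 : ℝ) ^ m ≤ κ / (μ * (1 - M.γ) * ε)) :
    ∑ q ∈ Finset.range m, M.rawSteps cbar hbar k q ≤ 384 * κ * M.sampleRate μ cbar hbar k ε := by
  have hγ1 : 0 < 1 - M.γ := by linarith [M.γ_lt_one]
  have h2 : 0 ≤ M.tZero k := by unfold tZero; positivity
  have h3 : 0 ≤ M.sigmaFsq cbar hbar k := (sq_nonneg _).trans sq_B_le_sigmaFsq
  have hy : 0 < μ * (1 - M.γ) * ε := by positivity
  have h4 := Finset.sum_le_sum (s := Finset.range m) fun q _ => rawSteps_le (k := k) hθ q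
  rw [Finset.sum_add_distrib, Finset.sum_add_distrib, ← Finset.mul_sum, ← Finset.mul_sum,
    ← Finset.mul_sum] at h4
  refine h4.trans ?_
  set Θ := M.thetaBar cbar hbar
  have c1 : 0 ≤ M.tZero k * Θ ^ (2 / 3 : ℝ) := by positivity
  have c2 : 0 ≤ M.tZero k * Θ := by positivity
  have c3 : 0 ≤ M.sigmaFsq cbar hbar k / k.lamMin ^ 2 := by positivity
  have s1 := mul_le_mul_of_nonneg_left (sum_two_pow_rpow_le (s := 2 / 3) (by norm_num) hm) c1
  have s2 := mul_le_mul_of_nonneg_left (sum_two_pow_rpow_le (s := 1 / 2) (by norm_num) hm) c2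
  have s3 := mul_le_mul_of_nonneg_left (sum_two_pow_rpow_le (s := 1) (by norm_num) hm) c3
  have r1 := mul_rpow_le_div (s := 2 / 3) c1 hκ hy (by norm_num)
  have r2 := mul_rpow_le_div (s := 1 / 2) c2 hκ hy (by norm_num)
  have r3 := mul_rpow_le_div (s := 1) c3 hκ hy le_rfl
  have e : M.sampleRate μ cbar hbar k ε
      = M.tZero k * Θ ^ (2 / 3 : ℝ) / (μ * (1 - M.γ) * ε) ^ (2 / 3 : ℝ)
        + M.tZero k * Θ / (μ * (1 - M.γ) * ε) ^ (1 / 2 : ℝ)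
        + M.sigmaFsq cbar hbar k / k.lamMin ^ 2 / (μ * (1 - M.γ) * ε) ^ (1 : ℝ) := by
    rw [sampleRate, Real.rpow_one, ← Real.sqrt_eq_rpow, div_div]
    congr 2
    ring
  rw [e]
  have p1 : 0 ≤ M.tZero k * Θ ^ (2 / 3 : ℝ) / (μ * (1 - M.γ) * ε) ^ (2 / 3 : ℝ) := by positivity
  have p2 : 0 ≤ M.tZero k * Θ / (μ * (1 - M.γ) * ε) ^ (1 / 2 : ℝ) := by positivity
  nlinarith

lemma skip_le (hk : M.ValidConst Pol k) : ∃ E₀ : ℝ, ∀ E : ℝ, E₀ ≤ E → ∀ j : ℕ,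
    ((j / M.epochLen : ℕ) : ℝ) + 1 ≤ 2 * E →
    (M.skip cbar hbar k j : ℝ) ≤ 5 * (E * Real.logb k.ρ (1 / 2)) := by
  have hL : 0 < Real.logb k.ρ (1 / 2) :=
    Real.logb_pos_of_base_lt_one hk.ρ_pos hk.ρ_lt_one (by norm_num) (by norm_num)
  set L := Real.logb k.ρ (1 / 2) with hLdef
  set Y₁ := Real.logb k.ρ (k.lamMin / (24 * k.C * M.Rsq cbar hbar k))
  set Y₂ := Real.logb k.ρ (k.lamMin / (3 * k.C * M.Rsq cbar hbar k))
  set Y₃ := Real.logb k.ρ (k.lamMin / (9 * k.C))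
  -- For `q + 1 ≤ 2 E` the leading term `2 (q + 2) L` is at most `4 E L + 2 L`. The threshold makes
  -- all remaining terms, and `1` for rounding up, at most `E L`.
  refine ⟨(2 * L + |Y₁| + |Y₂| + |Y₃| + 1) / L, fun E hE j hj => ?_⟩
  rw [div_le_iff₀ hL] at hE
  have a1 := abs_nonneg Y₁
  have a2 := abs_nonneg Y₂
  have a3 := abs_nonneg Y₃
  have b1 := le_abs_self Y₁
  have b2 := le_abs_self Y₂
  have b3 := le_abs_self Y₃
  set q : ℝ := ((j / M.epochLen : ℕ) : ℝ) with hq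
  have hj' := mul_le_mul_of_nonneg_right hj hL.le
  set a := max (max (2 * (q + 2) * L + Y₁) ((q + 2) * L + Y₂)) Y₃ with ha
  have ha' : a ≤ 5 * (E * L) - 1 := by
    refine max_le (max_le ?_ ?_) ?_ <;> nlinarith
  have hceil : (⌈a⌉₊ : ℝ) ≤ 5 * (E * L) := by
    rcases le_or_gt a 0 with h0 | h0
    · rw [Nat.ceil_eq_zero.2 h0, Nat.cast_zero]
      linarith
    · linarith [Nat.ceil_lt_add_one h0.le]
  have e : M.skip cbar hbar k j = max 1 ⌈a⌉₊ := rfl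
  rw [e, Nat.cast_max, Nat.cast_one]
  exact max_le (by linarith) hceil

/-- Rounding up adds at most one, and `1 ≤ log₂ (2κ) · log_γ (1/2)` is equivalent to the lower bound
on `γ`. Without such a bound `log_γ (1/2)` could be arbitrarily small while the epoch length stays
at least one. -/
lemma epochLen_le {κ : ℝ} (hκ : 1 ≤ κ) (h : 1 / (2 * κ) ≤ M.γ) :
    (M.epochLen : ℝ) ≤ (2 + Real.logb 2 (2 * κ)) * Real.logb M.γ (1 / 2) := by
  have hγ := M.γ_pos
  have hlog := Real.log_neg M.γ_pos M.γ_lt_one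
  have h2 : 0 < Real.log 2 := Real.log_pos (by norm_num)
  have h1 : 1 ≤ Real.logb 2 (2 * κ) * Real.logb M.γ (1 / 2) := by
    have h3 := Real.log_le_log (by positivity) h
    rw [one_div, Real.log_inv] at h3
    rw [Real.logb, Real.logb, one_div, Real.log_inv, div_mul_div_comm,
      le_div_iff_of_neg (mul_neg_of_pos_of_neg h2 hlog)]
    nlinarith
  have h4 : Real.logb M.γ (1 / 4) = 2 * Real.logb M.γ (1 / 2) := by
    rw [show (1 / 4 : ℝ) = (1 / 2) ^ 2 by norm_num, Real.logb_pow]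
    norm_num
  have h5 := (Nat.ceil_lt_add_one M.logb_quarter_pos.le).le
  rw [h4] at h5
  have e : M.epochLen = ⌈Real.logb M.γ (1 / 4)⌉₊ := rfl
  rw [e, h4]
  linarith

lemma logb_eq_mul (M : RegMDP S A) {ε : ℝ} :
    Real.logb M.γ ε = Real.logb M.γ (1 / 2) * Real.logb 2 (1 / ε) := by
  have h2 : Real.log 2 ≠ 0 := (Real.log_pos (by norm_num)).ne'
  simp only [Real.logb, one_div, Real.log_inv]
  field_simp

lemma logb_half_pos (M : RegMDP S A) : 0 < Real.logb M.γ (1 / 2) :=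
  Real.logb_pos_of_base_lt_one M.γ_pos M.γ_lt_one (by norm_num) (by norm_num)

/-- The two forms of the logarithmic factor in the sample complexity. -/
lemma exists_log_factor (hk : M.ValidConst Pol k) (X : ℝ) : ∃ E₀ : ℝ, ∀ E : ℝ, E₀ ≤ E →
    0 ≤ E ∧ E * Real.logb k.ρ (1 / 2) ≤ 2 * (E * Real.logb k.ρ (1 / 2) + X) := by
  have hL : 0 < Real.logb k.ρ (1 / 2) :=
    Real.logb_pos_of_base_lt_one hk.ρ_pos hk.ρ_lt_one (by norm_num) (by norm_num)
  refine ⟨2 * |X| / Real.logb k.ρ (1 / 2), fun E hE => ⟨le_trans (by positivity) hE, ?_⟩⟩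
  rw [div_le_iff₀ hL] at hE
  linarith [neg_abs_le X]

lemma logb_half_le (hk : M.ValidConst Pol k)
    (h : 2 * k.lamMin ≤ k.C * M.Rsq cbar hbar k) :
    Real.logb k.ρ (1 / 2) ≤ Real.logb k.ρ (k.lamMin / (k.C * M.Rsq cbar hbar k)) := by
  have hΛ := hk.lamMin_pos
  have hpos : 0 < k.C * M.Rsq cbar hbar k := by linarith
  rw [Real.logb_le_logb_of_base_lt_one hk.ρ_pos hk.ρ_lt_one (by norm_num) (by positivity),
    div_le_div_iff₀ hpos (by norm_num)]
  linarith

/-- The sample complexity of the iterations `0, …, l m - 1`. -/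
lemma numSamples_le (hθ : 0 ≤ M.thetaBar cbar hbar) (hμ : 0 < μ)
    {κ ε E Y : ℝ} (hκ : 1 ≤ κ) (hε : 0 < ε) {m : ℕ} (hm : (2 : ℝ) ^ m ≤ κ / (μ * (1 - M.γ) * ε))
    (hY0 : 0 ≤ Y) (hE : ∀ j < M.epochLen * m, (M.skip cbar hbar k j : ℝ) ≤ Y) (hmE : (m : ℝ) ≤ E)
    (hEσ : 0 < M.sigmaFsq cbar hbar k →
      E ≤ M.sigmaFsq cbar hbar k / (μ * (1 - M.γ) * k.lamMin ^ 2) / ε) :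
    (M.numSamples cbar hbar k (M.epochLen * m) : ℝ)
      ≤ M.epochLen * Y * ((384 * κ + 1) * M.sampleRate μ cbar hbar k ε) := by
  have hγ1 : 0 < 1 - M.γ := by linarith [M.γ_lt_one]
  have h2 : 0 ≤ M.tZero k := by unfold tZero; positivity
  have h3 : 0 ≤ M.sigmaFsq cbar hbar k := (sq_nonneg _).trans sq_B_le_sigmaFsq
  have hrate := sampleRate_nonneg (k := k) hμ hθ hε
  have hl : (0 : ℝ) ≤ M.epochLen := by positivity
  have hT : ∑ q ∈ Finset.range m, (⌈M.rawSteps cbar hbar k q⌉₊ : ℝ)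
      ≤ (384 * κ + 1) * M.sampleRate μ cbar hbar k ε := by
    -- If `σ_F² = 0`, then `c̄ + h̄ = 0` and no steps are made at all, so there is no rounding to
    -- absorb.
    rcases h3.eq_or_lt with h0 | h0
    · have hR : M.Rsq cbar hbar k = 0 := by
        have := mul_nonneg (by positivity : 0 ≤ 4 * (1 + M.γ) ^ 2)
          (Rsq_nonneg (M := M) (cbar := cbar) (hbar := hbar) (k := k))
        unfold sigmaFsq at h0
        have h5 : 4 * (1 + M.γ) ^ 2 * M.Rsq cbar hbar k = 0 := by
          nlinarith [sq_nonneg (cbar + hbar), sq_nonneg k.B]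
        have h6 : 4 * (1 + M.γ) ^ 2 ≠ 0 := by have := M.γ_pos; positivity
        exact (mul_eq_zero.1 h5).resolve_left h6
      have hcb : cbar + hbar = 0 := by
        unfold sigmaFsq at h0
        rw [hR] at h0
        nlinarith [sq_nonneg (cbar + hbar), sq_nonneg k.B]
      have hΘ : M.thetaBar cbar hbar = 0 := by rw [thetaBar, hcb]; simp
      have hraw : ∀ q, M.rawSteps cbar hbar k q = 0 := fun q => by
        rw [rawSteps, hΘ, ← h0]
        norm_num
      simp only [hraw, Nat.ceil_zero, Nat.cast_zero, Finset.sum_const_zero]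
      positivity
    · have h5 : ∑ q ∈ Finset.range m, (⌈M.rawSteps cbar hbar k q⌉₊ : ℝ)
          ≤ ∑ q ∈ Finset.range m, (M.rawSteps cbar hbar k q + 1) :=
        Finset.sum_le_sum fun q _ => (Nat.ceil_lt_add_one (rawSteps_nonneg hθ q)).le
      rw [Finset.sum_add_distrib] at h5
      simp only [Finset.sum_const, Finset.card_range, nsmul_eq_mul, mul_one] at h5
      have h6 := sum_rawSteps_le (k := k) hθ hμ hκ hε hm
      -- Rounding costs at most one step per epoch. These `m` steps are absorbed by the summand of
      -- order `1/ε`, which is positive here.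
      have h7 : (m : ℝ) ≤ M.sampleRate μ cbar hbar k ε := by
        refine (hmE.trans (hEσ h0)).trans ?_
        rw [sampleRate, div_div]
        exact le_add_of_nonneg_left (by positivity)
      linarith
  calc (M.numSamples cbar hbar k (M.epochLen * m) : ℝ)
      = ∑ i ∈ Finset.range (M.epochLen * m),
          (M.numSteps cbar hbar k i : ℝ) * M.skip cbar hbar k i := by
        rw [numSamples]; push_cast; rfl
    _ ≤ ∑ i ∈ Finset.range (M.epochLen * m),
          (fun q => (⌈M.rawSteps cbar hbar k q⌉₊ : ℝ) * Y) (i / M.epochLen) := by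
        refine Finset.sum_le_sum fun i hi => ?_
        rw [numSteps_eq]
        exact mul_le_mul_of_nonneg_left (hE i (Finset.mem_range.1 hi)) (by positivity)
    _ = M.epochLen * Y * ∑ q ∈ Finset.range m, (⌈M.rawSteps cbar hbar k q⌉₊ : ℝ) := by
        rw [sum_range_div M.epochLen_pos (fun q => (⌈M.rawSteps cbar hbar k q⌉₊ : ℝ) * Y) m,
          ← Finset.sum_mul]
        ring
    _ ≤ _ := mul_le_mul_of_nonneg_left hT (by positivity)

/-- The iteration and sample complexity, given `γ ≥ 1 / (2 κ)` and `μ (1 - γ) Δ ≤ κ`. -/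
theorem complexity_le (hk : M.ValidConst Pol k) (hθ : 0 ≤ M.thetaBar cbar hbar) (hμ : 0 < μ)
    {κ Δ : ℝ} (hκ : 1 ≤ κ) (hγκ : 1 / (2 * κ) ≤ M.γ) (hΔ : 0 < Δ)
    (hΔκ : μ * (1 - M.γ) * Δ ≤ κ) : ∃ ε₀ : ℝ, 0 < ε₀ ∧ ∀ ε : ℝ, 0 < ε → ε ≤ ε₀ →
      (M.numIter Δ ε : ℝ) ≤ 2 * (2 + Real.logb 2 (2 * κ)) * Real.logb M.γ ε ∧
      (M.numSamples cbar hbar k (M.numIter Δ ε) : ℝ) ≤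
        5 * (2 + Real.logb 2 (2 * κ)) * (768 * κ + 1) * (Real.logb M.γ (1 / 2) *
          (Real.logb 2 (1 / ε) * Real.logb k.ρ (1 / 2)) * M.sampleRate μ cbar hbar k ε) := by
  have hγ1 : 0 < 1 - M.γ := by linarith [M.γ_lt_one]
  have hΛ := hk.lamMin_pos
  have hL : 0 < Real.logb k.ρ (1 / 2) :=
    Real.logb_pos_of_base_lt_one hk.ρ_pos hk.ρ_lt_one (by norm_num) (by norm_num)
  have hg := M.logb_half_pos
  obtain ⟨E₁, hE₁⟩ := skip_le (cbar := cbar) (hbar := hbar) hk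
  -- For `σ_F² = 0` the value of `c` is irrelevant, and `1` serves as a default.
  obtain ⟨c, hc0, hc⟩ : ∃ c : ℝ, 0 < c ∧ (0 < M.sigmaFsq cbar hbar k →
      2 * c = M.sigmaFsq cbar hbar k / (μ * (1 - M.γ) * k.lamMin ^ 2)) := by
    by_cases h : 0 < M.sigmaFsq cbar hbar k
    · exact ⟨M.sigmaFsq cbar hbar k / (μ * (1 - M.γ) * k.lamMin ^ 2) / 2, by positivity,
        fun _ => by ring⟩
    · exact ⟨1, one_pos, fun h' => absurd h' h⟩
  -- The threshold `log₂ Δ + 1` for `E = log₂ (1/ε)` ensures that the number of epochs is at most `2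
  -- E`.
  obtain ⟨ε₁, hε₁, hsmall⟩ := exists_small_logb (max (max E₁ 1) (Real.logb 2 Δ + 1)) hc0
  refine ⟨min ε₁ (Δ / 2), by positivity, fun ε hε hle => ?_⟩
  obtain ⟨hE, hEc⟩ := hsmall ε hε (hle.trans (min_le_left _ _))
  have hεΔ : ε < Δ := by linarith [hle.trans (min_le_right _ _)]
  set E := Real.logb 2 (1 / ε) with hEdef
  have hEE₁ : E₁ ≤ E := ((le_max_left _ _).trans (le_max_left _ _)).trans hE
  have hE1 : 1 ≤ E := ((le_max_right _ _).trans (le_max_left _ _)).trans hE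
  have hEΔ : Real.logb 2 Δ + 1 ≤ E := (le_max_right _ _).trans hE
  have hJ : M.numIter Δ ε = M.epochLen * ⌈Real.logb 2 (Δ / ε)⌉₊ := if_neg (not_le.2 hεΔ)
  set m := ⌈Real.logb 2 (Δ / ε)⌉₊ with hmdef
  have hlogpos : 0 ≤ Real.logb 2 (Δ / ε) :=
    Real.logb_nonneg (by norm_num) ((one_le_div hε).2 hεΔ.le)
  have hmlt : (m : ℝ) < Real.logb 2 (Δ / ε) + 1 := Nat.ceil_lt_add_one hlogpos
  have hlogadd : Real.logb 2 (Δ / ε) = Real.logb 2 Δ + E := by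
    rw [hEdef, ← Real.logb_mul hΔ.ne' (by positivity)]
    congr 1
    ring
  have hm2E : (m : ℝ) ≤ 2 * E := by linarith
  -- Rounding up the number of epochs costs a factor two, so `κ` becomes `2 κ` and `384 κ` becomes
  -- `768 κ`.
  have h2m : (2 : ℝ) ^ m ≤ 2 * κ / (μ * (1 - M.γ) * ε) := by
    have h1 : (2 : ℝ) ^ m ≤ 2 * (Δ / ε) := by
      rw [← Real.rpow_natCast]
      calc (2 : ℝ) ^ (m : ℝ) ≤ 2 ^ (Real.logb 2 (Δ / ε) + 1) :=
            Real.rpow_le_rpow_of_exponent_le (by norm_num) hmlt.le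
        _ = 2 * (Δ / ε) := by
            rw [Real.rpow_add (by norm_num), Real.rpow_logb (by norm_num) (by norm_num)
              (by positivity), Real.rpow_one, mul_comm]
    refine h1.trans ?_
    rw [mul_div_assoc', div_le_div_iff₀ hε (by positivity)]
    nlinarith [mul_le_mul_of_nonneg_right hΔκ hε.le]
  have hl := epochLen_le hκ hγκ
  have hb : 0 ≤ 2 + Real.logb 2 (2 * κ) := by
    have := Real.logb_nonneg (b := 2) (by norm_num) (by linarith : 1 ≤ 2 * κ)
    linarith
  have hrate := sampleRate_nonneg (k := k) hμ hθ hε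
  rw [hJ]
  constructor
  · rw [Nat.cast_mul, M.logb_eq_mul, ← hEdef]
    calc (M.epochLen : ℝ) * m ≤ (2 + Real.logb 2 (2 * κ)) * Real.logb M.γ (1 / 2) * (2 * E) :=
          mul_le_mul hl hm2E (by positivity) (by positivity)
      _ = _ := by ring
  · have hns := numSamples_le (κ := 2 * κ) (E := 2 * E) (m := m) hθ hμ (by linarith) hε h2m
      (by positivity : 0 ≤ 5 * (E * Real.logb k.ρ (1 / 2))) (fun j hj => by
        refine hE₁ E hEE₁ j (le_trans ?_ hm2E)
        exact_mod_cast Nat.succ_le_of_lt (Nat.div_lt_of_lt_mul hj)) hm2E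
      (fun hσ => by
        rw [← hc hσ]
        calc 2 * E ≤ 2 * (c / ε) := by linarith
          _ = _ := by ring)
    refine hns.trans ?_
    have h5 := mul_le_mul_of_nonneg_right hl
      (by positivity : 0 ≤ 5 * (E * Real.logb k.ρ (1 / 2))
        * ((384 * (2 * κ) + 1) * M.sampleRate μ cbar hbar k ε))
    calc _ = _ := by ring
      _ ≤ _ := h5
      _ = _ := by ring

end RegMDP

/-! ### The main theorem. -/

theorem mainTheorem9 (κ : ℝ) :
    ∃ K : ℝ, 0 < K ∧
      ∀ (S : Type u) (A : Type v) [Fintype S] [Fintype A] [DecidableEq S] [DecidableEq A]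
        [Nonempty S] [Nonempty A] (M : RegMDP S A) (μ cbar hbar : ℝ)
        (_hμ : 0 < μ) (_hsc : M.StronglyConvex μ)
        (_hc : ∀ s a, |M.c s a| ≤ cbar) (_hh : ∀ s, ∀ p ∈ M.dom s, |M.h s p| ≤ hbar)
        -- an optimal policy and a stationary distribution of it
        (πs : Policy S A) (_hopt : M.IsOptimal πs)
        (νs : S → ℝ) (_hνs : M.IsStationary πs νs)
        -- a class of sufficiently random feasible policies with ergodic state chains
        (Pol : Set (Policy S A)) (_hfeas : ∀ π ∈ Pol, M.Feasible π)
        (πlow : ℝ) (_hlow : 0 < πlow) (_hrand : ∀ π ∈ Pol, ∀ s a, πlow ≤ π s a)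
        (_herg : ∀ π ∈ Pol, (M.stateMat π).IsPrimitive),
        (∃ k : CTDConst, M.ValidConst Pol k) ∧
        ∀ (k : CTDConst) (_hk : M.ValidConst Pol k),
          -- `J ε` iterations yield an `ε`-solution
          ∃ J : ℝ → ℕ,
            -- every run whose iterates belong to the class
            (∀ (Ω : Type w) [MeasurableSpace Ω] (Pr : Measure Ω) [IsProbabilityMeasure Pr]
              (Z : ℕ → Ω → S × A) (π : ℕ → Ω → Policy S A)
              (_hrun : M.IsRun μ cbar hbar k Pr Z π)
              (_hPol : ∀ᵐ ω ∂Pr, ∀ j, π j ω ∈ Pol),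
              -- the linear rate of convergence
              (∀ j : ℕ, Integrable (fun ω => M.gap μ νs πs (π j ω)) Pr ∧
                ∫ ω, M.gap μ νs πs (π j ω) ∂Pr
                  ≤ (1 / 2) ^ (j / M.epochLen) * M.gapConst μ νs πs) ∧
              (∀ ε : ℝ, 0 < ε → ∫ ω, M.gap μ νs πs (π (J ε) ω) ∂Pr ≤ ε)) ∧
            -- iteration and sample complexity
            (μ * (1 - M.γ) * M.gapConst μ νs πs ≤ κ →
              ∃ ε₀ : ℝ, 0 < ε₀ ∧ ∀ ε : ℝ, 0 < ε → ε ≤ ε₀ →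
                (J ε : ℝ) ≤ K * Real.logb M.γ ε ∧
                (M.numSamples cbar hbar k (J ε) : ℝ) ≤
                  K * (Real.logb M.γ (1 / 2) *
                    (Real.logb 2 (1 / ε) * Real.logb k.ρ (1 / 2)
                      + Real.logb k.ρ (k.lamMin / (k.C * M.Rsq cbar hbar k))) *
                    M.sampleRate μ cbar hbar k ε) ∧
                (2 * k.lamMin ≤ k.C * M.Rsq cbar hbar k →
                  (M.numSamples cbar hbar k (J ε) : ℝ) ≤
                    K * (Real.logb M.γ (1 / 2) * Real.logb 2 (1 / ε) *
                      Real.logb k.ρ (k.lamMin / (k.C * M.Rsq cbar hbar k)) *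
                      M.sampleRate μ cbar hbar k ε))) := by
  have hκ : 1 ≤ max κ 1 := le_max_right _ _
  have hlog : 0 ≤ Real.logb 2 (2 * max κ 1) :=
    Real.logb_nonneg (by norm_num) (by linarith)
  set b := 2 + Real.logb 2 (2 * max κ 1) with hb
  -- Twice the constant of `complexity_le`. The factor two is the price of the possibly negative
  -- term `X` in the logarithmic factor, see `exists_log_factor`.
  refine ⟨10 * b * (768 * max κ 1 + 1), by positivity, ?_⟩
  intro S A _ _ _ _ _ _ M μ cbar hbar hμ hsc hc hh πs hopt νs hνs Pol hfeas πlow hlow hrand herg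
  refine ⟨M.exists_validConst hc hh hfeas hlow hrand herg, fun k hk => ?_⟩
  have hγ := M.γ_pos
  have hγ1 : 0 < 1 - M.γ := by linarith [M.γ_lt_one]
  have hg := M.logb_half_pos
  have hL : 0 < Real.logb k.ρ (1 / 2) :=
    Real.logb_pos_of_base_lt_one hk.ρ_pos hk.ρ_lt_one (by norm_num) (by norm_num)
  have hθ := RegMDP.thetaBar_nonneg hc hh hopt.1
  set X := Real.logb k.ρ (k.lamMin / (k.C * M.Rsq cbar hbar k)) with hX
  obtain ⟨E₀, hE₀⟩ := RegMDP.exists_log_factor hk X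
  obtain ⟨ε₁, hε₁, hsmall⟩ := exists_small_logb E₀ one_pos
  -- A run starts at the uniform policy, so if that policy is outside the class there are no runs
  -- and zero iterations will do.
  by_cases hu : uniformPolicy S A ∈ Pol
  · refine ⟨M.numIter (M.gapConst μ νs πs), fun Ω _ Pr _ Z π hrun hPol => ⟨fun j =>
      hrun.integral_gap_le hPol hk hμ hsc hc hh hfeas hlow hrand hopt hνs j, fun ε hε =>
      (hrun.integral_gap_le hPol hk hμ hsc hc hh hfeas hlow hrand hopt hνs _).2.trans
        (M.pow_numIter_mul_le _ hε)⟩, fun hgap => ?_⟩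
    have hΔ := RegMDP.le_gapConst hμ hopt hνs (hfeas _ hu)
    have hq : 0 < 5 / (8 * M.γ * μ) := by positivity
    have hΔ0 : 0 < M.gapConst μ νs πs := by
      by_contra hneg
      nlinarith
    -- The term `5 / (8 γ μ)` in `Δ`, multiplied by `μ`, bounds `5 / (8 γ)` by `κ`. A small bound on
    -- `μ (1 - γ) Δ` thus excludes small `γ`.
    have hγκ : 1 / (2 * max κ 1) ≤ M.γ := by
      have h1 := mul_le_mul_of_nonneg_left hΔ hμ.le
      have h2 : μ * (5 / (8 * M.γ * μ)) = 5 / (8 * M.γ) := by field_simp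
      have h3 : 5 / (8 * M.γ) ≤ max κ 1 := by
        rw [mul_add, h2] at h1
        have := le_max_left κ 1
        linarith
      rw [div_le_iff₀ (by positivity)] at h3 ⊢
      linarith
    obtain ⟨ε₂, hε₂, hcomp⟩ := RegMDP.complexity_le (cbar := cbar) (hbar := hbar) hk hθ hμ hκ hγκ
      hΔ0 (hgap.trans (le_max_left _ _))
    refine ⟨min ε₁ ε₂, lt_min hε₁ hε₂, fun ε hε hle => ?_⟩
    obtain ⟨hE, hEX⟩ := hE₀ _ (hsmall ε hε (hle.trans (min_le_left _ _))).1
    obtain ⟨hJ, hN⟩ := hcomp ε hε (hle.trans (min_le_right _ _))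
    have hrate := RegMDP.sampleRate_nonneg (k := k) hμ hθ hε
    have hlogε : Real.logb M.γ ε = _ := M.logb_eq_mul
    rw [← hb] at hJ hN
    set E := Real.logb 2 (1 / ε)
    have hK : 0 ≤ 5 * b * (768 * max κ 1 + 1) := by positivity
    refine ⟨hJ.trans (mul_le_mul_of_nonneg_right ?_ (hlogε ▸ by positivity)), hN.trans ?_,
      fun hCR => hN.trans ?_⟩
    · nlinarith
    · have h1 := mul_le_mul_of_nonneg_left hEX (by positivity :
        0 ≤ 5 * b * (768 * max κ 1 + 1) * (Real.logb M.γ (1 / 2) * M.sampleRate μ cbar hbar k ε))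
      calc _ = _ := by ring
        _ ≤ _ := h1
        _ = _ := by ring
    · have h0 := RegMDP.logb_half_le hk hCR
      have h1 := mul_le_mul_of_nonneg_left h0 (by positivity : 0 ≤ 5 * b * (768 * max κ 1 + 1)
        * (Real.logb M.γ (1 / 2) * E * M.sampleRate μ cbar hbar k ε))
      have h2 : 0 ≤ 5 * b * (768 * max κ 1 + 1)
        * (Real.logb M.γ (1 / 2) * E * M.sampleRate μ cbar hbar k ε)
          * Real.logb k.ρ (k.lamMin / (k.C * M.Rsq cbar hbar k)) := by
        have := hL.le.trans h0
        positivity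
      calc _ = _ := by ring
        _ ≤ _ := h1
        _ ≤ _ := le_add_of_nonneg_right h2
        _ = _ := by ring
  · refine ⟨fun _ => 0, fun Ω _ Pr _ Z π hrun hPol => absurd (hrun.uniform_mem hPol) hu,
      fun _ => ⟨ε₁, hε₁, fun ε hε hle => ?_⟩⟩
    obtain ⟨hE, hEX⟩ := hE₀ _ (hsmall ε hε hle).1
    have hrate := RegMDP.sampleRate_nonneg (k := k) hμ hθ hε
    have hlogε : Real.logb M.γ ε = _ := M.logb_eq_mul
    have hN : (M.numSamples cbar hbar k 0 : ℝ) = 0 := by simp [RegMDP.numSamples]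
    have hsum : 0 ≤ Real.logb 2 (1 / ε) * Real.logb k.ρ (1 / 2) + X := by
      nlinarith [mul_nonneg hE hL.le]
    rw [hN, hlogε]
    refine ⟨?_, ?_, fun hCR => ?_⟩
    · rw [Nat.cast_zero]
      positivity
    · positivity
    · have hX0 : 0 ≤ X := hL.le.trans (RegMDP.logb_half_le hk hCR)
      positivity
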